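/- **Conventions.** Let $\mathfrak H_2$ be the Siegel upper half space of symmetric complex $2\times2$ matrices $\tau$ with positive definite imaginary part, $\Gamma={\rm Sp}(4,\mathbb Z)$ and $\Gamma[2]=\{M\in\Gamma: M\equiv 1_4 \bmod 2\}$. Let $S_{0,15}(\Gamma[2])$ be the space of scalar-valued Siegel cusp forms of weight $15$ on $\Gamma[2]$, i.e. holomorphic $F:\mathfrak H_2\to\mathbb C$ with $F((A\tau+B)(C\tau+D)^{-1})=\det(C\tau+D)^{15}F(\tau)$ for all $\left(\begin{smallmatrix}A&B\\C&D\end{smallmatrix}\right)\in\Gamma[2]$, such that the Siegel operator $\lim_{t\to\infty}(\cdot)({\rm diag}(z,it))$ annihilates $\det(C\tau+D)^{-15}F(M\langle\tau\rangle)$ for every $M=\left(\begin{smallmatrix}A&B\\C&D\end{smallmatrix}\right)\in\Gamma$. For a characteristic $(\mu_1,\mu_2,\nu_1,\nu_2)\in\{0,1\}^4$, with $\mu=(\mu_1,\mu_2)$, $\nu=(\nu_1,\nu_2)$, put $$\vartheta_{[\mu;\nu]}(\tau,z)=\sum_{n\in\mathbb Z^2}e^{\pi i (n+\mu/2)\left(\tau(n+\mu/2)^t+2(z+\nu/2)^t\right)}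 .$$ The odd characteristics are $m_1=0101$, $m_2=0111$, $m_3=1010$, $m_4=1011$, $m_5=1101$, $m_6=1110$; the even ones are $n_1=0000$, $n_2=0001$, $n_3=0010$, $n_4=0011$, $n_5=0100$, $n_6=0110$, $n_7=1000$, $n_8=1001$, $n_9=1100$, $n_{10}=1111$. Put $\vartheta_k=\vartheta_{n_k}(\tau,0)$, $x_k=\vartheta_k^4$, $\chi_5=\prod_{k=1}^{10}\vartheta_k$, $\chi_7=\chi_5(x_6-x_5)$, and let $G_i=(G_i^{(1)},G_i^{(2)})$ be the gradient of $z\mapsto\vartheta_{m_i}(\tau,z)$ at $z=0$. Write ${\rm Sym}^2(G_i,G_j)=(G_i^{(1)}G_j^{(1)},\,G_i^{(1)}G_j^{(2)}+G_i^{(2)}G_j^{(1)},\,G_i^{(2)}G_j^{(2)})$. For $i\ne j$ exactly four of the $n_k$ are congruent modulo $2$ to some $m_i+m_j+m_a$ with $a\notin\{i,j\}$; let $$G_{ij}={\rm Sym}^2(G_i,G_j)\prod_k\vartheta_k ,$$ the product over the remaining six $k$ (so $G_{12}={\rm Sym}^2(G_1,G_2)\vartheta_1\cdots\vartheta_6$).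 The wedge of three such $\mathbb C^3$-valued functions is the determinant of the $3\times 3$ matrix with these rows. Finally $H_1\subset\mathfrak H_2$, the Humbert surface of invariant $1$, is the set of all $\tau$ with $a\tau_{11}+b\tau_{12}+c\tau_{22}+d(\tau_{12}^2-\tau_{11}\tau_{22})+e=0$ for some primitive $(a,b,c,d,e)\in\mathbb Z^5$ with $b^2-4ac-4de=1$. **Proposition.** The following three wedge products belong to $S_{0,15}(\Gamma[2])$, and $$G_{12}\wedge G_{34}\wedge G_{56}=\pi^6\chi_5\,\vartheta_1^4\vartheta_2^4\vartheta_3^4\vartheta_4^4(\vartheta_5^4-\vartheta_6^4)=-\pi^6\chi_7\,x_1x_2x_3x_4,$$ $$G_{12}\wedge G_{13}\wedge G_{45}=\pi^6\,\frac{\chi_5^3\,\vartheta_1^2\vartheta_4^2\vartheta_6^2}{\vartheta_2^2\vartheta_7^2\vartheta_9^2}=\pi^6\chi_5\,\vartheta_1^4\vartheta_4^4\vartheta_6^4\,\vartheta_3^2\vartheta_5^2\vartheta_8^2\vartheta_{10}^2,$$ $$G_{12}\wedge G_{13}\wedge G_{14}=0 .$$ Moreover $G_{12}$ does not vanish outside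 the Humbert surface $H_1$: if $\tau\in\mathfrak H_2$ and $\tau\notin H_1$, then $G_{12}(\tau)\neq 0$. -/

import Mathlib

open Matrix Filter Topology

noncomputable section

namespace SiegelTwo

/-- The Siegel upper half space of degree 2: symmetric complex `2 × 2` matrices with positive
definite imaginary part. -/
def H2 : Set (Matrix (Fin 2) (Fin 2) ℂ) :=
  {τ | τᵀ = τ ∧ (τ.map Complex.im).PosDef}

/-! ### Modular forms on the principal congruence subgroup of level 2 -/

/-- `Γ = Sp(4, ℤ)`, as a set of integral `4 × 4` matrices in `2 × 2` blocks. -/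
def Gam : Set (Matrix (Fin 2 ⊕ Fin 2) (Fin 2 ⊕ Fin 2) ℤ) :=
  {M | M ∈ Matrix.symplecticGroup (Fin 2) ℤ}

/-- `Γ[2]`: the elements of `Γ` congruent to the identity modulo 2. -/
def GamTwo : Set (Matrix (Fin 2 ⊕ Fin 2) (Fin 2 ⊕ Fin 2) ℤ) :=
  {M | M ∈ Gam ∧ ∀ i j, (2 : ℤ) ∣ M i j - (1 : Matrix (Fin 2 ⊕ Fin 2) (Fin 2 ⊕ Fin 2) ℤ) i j}

/-- Numerator `Aτ + B`. -/
def numer (M : Matrix (Fin 2 ⊕ Fin 2) (Fin 2 ⊕ Fin 2) ℤ) (τ : Matrix (Fin 2) (Fin 2) ℂ) :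
    Matrix (Fin 2) (Fin 2) ℂ :=
  M.toBlocks₁₁.map (Int.cast : ℤ → ℂ) * τ + M.toBlocks₁₂.map (Int.cast : ℤ → ℂ)

/-- Denominator `Cτ + D`. -/
def denom (M : Matrix (Fin 2 ⊕ Fin 2) (Fin 2 ⊕ Fin 2) ℤ) (τ : Matrix (Fin 2) (Fin 2) ℂ) :
    Matrix (Fin 2) (Fin 2) ℂ :=
  M.toBlocks₂₁.map (Int.cast : ℤ → ℂ) * τ + M.toBlocks₂₂.map (Int.cast : ℤ → ℂ)

/-- The action `M⟨τ⟩ = (Aτ + B)(Cτ + D)⁻¹`. -/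
def act (M : Matrix (Fin 2 ⊕ Fin 2) (Fin 2 ⊕ Fin 2) ℤ) (τ : Matrix (Fin 2) (Fin 2) ℂ) :
    Matrix (Fin 2) (Fin 2) ℂ :=
  numer M τ * (denom M τ)⁻¹

/-- The slash operator `(F|_{0,k} M)(τ) = det(Cτ + D)^{-k} F(M⟨τ⟩)`. -/
def slash (k : ℤ) (F : Matrix (Fin 2) (Fin 2) ℂ → ℂ)
    (M : Matrix (Fin 2 ⊕ Fin 2) (Fin 2 ⊕ Fin 2) ℤ) (τ : Matrix (Fin 2) (Fin 2) ℂ) : ℂ :=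
  (denom M τ).det ^ (-k) * F (act M τ)

/-- Holomorphy on `H2`, in the three coordinates `τ₁₁, τ₁₂, τ₂₂`. -/
def IsHolomorphic (F : Matrix (Fin 2) (Fin 2) ℂ → ℂ) : Prop :=
  DifferentiableOn ℂ (fun w : ℂ × ℂ × ℂ => F !![w.1, w.2.1; w.2.1, w.2.2])
    {w : ℂ × ℂ × ℂ | !![w.1, w.2.1; w.2.1, w.2.2] ∈ H2}

/-- `F ∈ M_{0,k}(Γ[2])`: scalar-valued Siegel modular forms of weight `k` on `Γ[2]`. -/
structure IsModularForm (k : ℤ) (F : Matrix (Fin 2) (Fin 2) ℂ → ℂ) : Prop where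
  holo : IsHolomorphic F
  transf : ∀ M ∈ GamTwo, ∀ τ ∈ H2, F (act M τ) = (denom M τ).det ^ k * F τ

/-- `F ∈ S_{0,k}(Γ[2])`: modular forms all of whose translates `F|M`, `M ∈ Γ`, are killed by the
Siegel operator `f ↦ (z ↦ lim_{t → ∞} f(diag(z, it)))`. -/
structure IsCuspForm (k : ℤ) (F : Matrix (Fin 2) (Fin 2) ℂ → ℂ) : Prop
    extends IsModularForm k F where
  cusp : ∀ M ∈ Gam, ∀ z : ℂ, 0 < z.im →
    Tendsto (fun t : ℝ => slash k F M !![z, 0; 0, Complex.I * (t : ℂ)]) atTop (𝓝 0)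

/-! ### Theta functions. A characteristic is a row vector `(μ₁, μ₂, ν₁, ν₂)`. -/

/-- The theta series `ϑ_{[μ; ν]}(τ, z)`. -/
def theta (c : Fin 4 → ℤ) (τ : Matrix (Fin 2) (Fin 2) ℂ) (z : Fin 2 → ℂ) : ℂ :=
  ∑' n : Fin 2 → ℤ,
    let v : Fin 2 → ℂ := ![(n 0 : ℂ) + (c 0 : ℂ) / 2, (n 1 : ℂ) + (c 1 : ℂ) / 2]
    let w : Fin 2 → ℂ := ![z 0 + (c 2 : ℂ) / 2, z 1 + (c 3 : ℂ) / 2]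
    Complex.exp ((Real.pi : ℂ) * Complex.I * (v ⬝ᵥ (τ *ᵥ v + (2 : ℂ) • w)))

/-- The odd characteristics `m₁, …, m₆` (indices outside `1, …, 6` are not used). -/
def oddChar : ℕ → Fin 4 → ℤ
  | 1 => ![0, 1, 0, 1]
  | 2 => ![0, 1, 1, 1]
  | 3 => ![1, 0, 1, 0]
  | 4 => ![1, 0, 1, 1]
  | 5 => ![1, 1, 0, 1]
  | 6 => ![1, 1, 1, 0]
  | _ => 0

/-- The even characteristics `n₁, …, n₁₀` (indices outside `1, …, 10` are not used). -/
def evenChar : ℕ → Fin 4 → ℤ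
  | 1 => ![0, 0, 0, 0]
  | 2 => ![0, 0, 0, 1]
  | 3 => ![0, 0, 1, 0]
  | 4 => ![0, 0, 1, 1]
  | 5 => ![0, 1, 0, 0]
  | 6 => ![0, 1, 1, 0]
  | 7 => ![1, 0, 0, 0]
  | 8 => ![1, 0, 0, 1]
  | 9 => ![1, 1, 0, 0]
  | 10 => ![1, 1, 1, 1]
  | _ => 0

/-- The theta constant `ϑ_k(τ) = ϑ_{n_k}(τ, 0)`, for `k = 1, …, 10`. -/
def vt (k : ℕ) (τ : Matrix (Fin 2) (Fin 2) ℂ) : ℂ := theta (evenChar k) τ 0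

/-- `x_k = ϑ_k⁴`. -/
def xf (k : ℕ) (τ : Matrix (Fin 2) (Fin 2) ℂ) : ℂ := vt k τ ^ 4

/-- `χ₅ = ϑ₁ ϑ₂ ⋯ ϑ₁₀`. -/
def chi5 (τ : Matrix (Fin 2) (Fin 2) ℂ) : ℂ := ∏ k ∈ Finset.Icc 1 10, vt k τ

/-- `χ₇ = χ₅ (x₆ - x₅)`. -/
def chi7 (τ : Matrix (Fin 2) (Fin 2) ℂ) : ℂ := chi5 τ * (xf 6 τ - xf 5 τ)

/-- The gradient `G_i = (∂ϑ_{m_i}/∂z₁, ∂ϑ_{m_i}/∂z₂)` at `z = 0`, for `i = 1, …, 6`. -/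
def grad (i : ℕ) (τ : Matrix (Fin 2) (Fin 2) ℂ) : Fin 2 → ℂ :=
  fun a => deriv (fun s : ℂ => theta (oddChar i) τ (Pi.single a s)) 0

/-- `Sym²(u, v)` in coordinates. -/
def sym2 (u v : Fin 2 → ℂ) : Fin 3 → ℂ :=
  ![u 0 * v 0, u 0 * v 1 + u 1 * v 0, u 1 * v 1]

/-- The quadruple of (indices of) even characteristics attached to a pair `m_i, m_j`: those
`n_k` that are, modulo 2, of the form `m_i + m_j + m_a` with `a ∉ {i, j}`. -/
def quadruple (i j : ℕ) : Finset ℕ :=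
  (Finset.Icc 1 10).filter fun k => ∃ a ∈ Finset.Icc 1 6, a ≠ i ∧ a ≠ j ∧
    ∀ l : Fin 4, evenChar k l ≡ oddChar i l + oddChar j l + oddChar a l [ZMOD 2]

/-- `G_{ij} = Sym²(G_i, G_j) ∏ ϑ_k`, the product over the six even characteristics complementary
to the quadruple attached to `m_i, m_j`. -/
def Gf (i j : ℕ) (τ : Matrix (Fin 2) (Fin 2) ℂ) : Fin 3 → ℂ :=
  (∏ k ∈ Finset.Icc 1 10 \ quadruple i j, vt k τ) • sym2 (grad i τ) (grad j τ)

/-- The triple wedge product of functions with values in the three-dimensional space `Sym²`,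
written as a scalar function by means of the basis of `Sym²` fixed above. -/
def wedge (f g h : Matrix (Fin 2) (Fin 2) ℂ → Fin 3 → ℂ) (τ : Matrix (Fin 2) (Fin 2) ℂ) : ℂ :=
  Matrix.det !![f τ 0, f τ 1, f τ 2; g τ 0, g τ 1, g τ 2; h τ 0, h τ 1, h τ 2]

/-! ### Humbert surfaces -/

/-- The (preimage in `H2` of the) Humbert surface of invariant `Δ`. -/
def humbert (Δ : ℤ) : Set (Matrix (Fin 2) (Fin 2) ℂ) :=
  {τ | τ ∈ H2 ∧ ∃ a b c d e : ℤ,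
    (∀ k : ℤ, k ∣ a → k ∣ b → k ∣ c → k ∣ d → k ∣ e → IsUnit k) ∧
    b ^ 2 - 4 * a * c - 4 * d * e = Δ ∧
    (a : ℂ) * τ 0 0 + (b : ℂ) * τ 0 1 + (c : ℂ) * τ 1 1
      + (d : ℂ) * (τ 0 1 ^ 2 - τ 0 0 * τ 1 1) + (e : ℂ) = 0}

end SiegelTwo

end

open SiegelTwo

/-! The determinant of three vectors Sym²(G_i, G_j) is a polynomial in the brackets G_i ∧ G_j, so
the identities reduce to Rosenhain's formula: each bracket equals ±π² times a product of four even
theta constants. In the code `br` is the bracket divided by (2πi)², so the constants there are ±1/4.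

Rosenhain's formula comes from duplication. Passing to half sums and half differences of summation
vectors expresses a product of two theta constants with the same μ through theta constants at 2τ.
The same works for a gradient times a theta constant, because the value of the odd theta function at
z = 0 vanishes. For three brackets (`br_1_5`, `br_2_4`, `br_3_6`) the bracket and its conjectured
value D satisfy the same equation D(τ)A(τ) = D(2τ)R(τ). Their ratio is therefore invariant under τ ↦
2τ. Moving along a ray to infinity identifies the ratio with that of the leading terms, and the
identity theorem extends this to the whole space (`eq_mul_of_duplication`). Six further brackets are
then read off from these three at 2τ.

The first wedge becomes a sum of two products of three brackets, combined by a cubic relation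
between squares of theta constants. The second is a single product of three brackets. The third
vanishes because all three vectors are divisible by G₁.

For modularity, each wedge is χ₅ times a polynomial of degree five in fourth powers of theta
constants; in the second case the squares are turned into fourth powers by a quadratic relation. A
Euclidean algorithm on the first column shows that Γ[2] is generated by elementary elements
(`mem_of_levelN`). On these the fourth powers have weight 2 and χ₅ has weight 5, with trivial
character (`mem_thetaSub`). For all of Γ it is enough that χ₅ is multiplied by a nonzero constant
and the fifth power of the automorphy factor (`exists_chi5_act`). As χ₅ vanishes on diagonal
matrices, every translate of the forms vanishes there, which is the cusp condition.

For the last claim, χ₅(τ) ≠ 0 makes G₁ and G₂ linearly independent and the scalar factor nonzero, so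
G₁₂(τ) ≠ 0. It remains to see that χ₅ vanishes only on H₁. Both the zero set of χ₅ and H₁ are stable
under Γ, so τ may be taken in a reduced domain. There the leading terms dominate each theta series
explicitly; only ϑ₁₀ can vanish, and only for τ₁₂ = 0, which is an equation of H₁. -/

/-! ### Coordinates on the upper half space -/

/-- The upper half space in the coordinates `(τ₁₁, τ₁₂, τ₂₂)`. -/
def UHS : Set (ℂ × ℂ × ℂ) := {w | 0 < w.1.im ∧ w.2.1.im ^ 2 < w.1.im * w.2.2.im}

/-- The symmetric matrix with coordinates `w`. -/
def symMat (w : ℂ × ℂ × ℂ) : Matrix (Fin 2) (Fin 2) ℂ := !![w.1, w.2.1; w.2.1, w.2.2]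

/-- The quadratic form attached to the imaginary part. -/
noncomputable def imForm (w : ℂ × ℂ × ℂ) (x y : ℝ) : ℝ :=
  w.1.im * x ^ 2 + 2 * w.2.1.im * x * y + w.2.2.im * y ^ 2

/-- Completing the square after multiplication by y₁₁ leaves the determinant as the coefficient of
y². -/
theorem imForm_pos {w : ℂ × ℂ × ℂ} (hw : w ∈ UHS) {x y : ℝ} (h : x ≠ 0 ∨ y ≠ 0) :
    0 < imForm w x y := by
  obtain ⟨h1, h2⟩ := hw
  have key : w.1.im * imForm w x y = (w.1.im * x + w.2.1.im * y) ^ 2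
      + (w.1.im * w.2.2.im - w.2.1.im ^ 2) * y ^ 2 := by unfold imForm; ring
  by_cases hy : y = 0
  · have hx : x ≠ 0 := by tauto
    subst hy
    have : 0 < x ^ 2 := by positivity
    simp only [imForm]; nlinarith
  · have : 0 < y ^ 2 := by positivity
    have h3 : 0 < w.1.im * imForm w x y := by
      rw [key]; nlinarith [sq_nonneg (w.1.im * x + w.2.1.im * y), mul_pos (sub_pos.2 h2) this]
    exact pos_of_mul_pos_right h3 h1.le |> fun h => by simpa using h

theorem mem_UHS_iff {w : ℂ × ℂ × ℂ} :
    w ∈ UHS ↔ ∀ x y : ℝ, (x ≠ 0 ∨ y ≠ 0) → 0 < imForm w x y := by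
  refine ⟨fun hw x y h => imForm_pos hw h, fun h => ?_⟩
  have h1 : 0 < w.1.im := by simpa [imForm] using h 1 0 (by simp)
  refine ⟨h1, ?_⟩
  -- At the vector (-y₁₂, y₁₁) the form takes the value y₁₁ times the determinant.
  have h2 := h (-w.2.1.im) w.1.im (Or.inr h1.ne')
  have : imForm w (-w.2.1.im) w.1.im = w.1.im * (w.1.im * w.2.2.im - w.2.1.im ^ 2) := by
    unfold imForm; ring
  rw [this] at h2
  have := pos_of_mul_pos_right h2 h1.le
  linarith [(pos_iff_pos_of_mul_pos h2).1 h1]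

theorem symMat_mem_H2 {w : ℂ × ℂ × ℂ} : symMat w ∈ H2 ↔ w ∈ UHS := by
  have hq : ∀ v : Fin 2 → ℝ, star v ⬝ᵥ (((symMat w).map Complex.im) *ᵥ v)
      = imForm w (v 0) (v 1) := by
    intro v
    simp [symMat, imForm, Matrix.mulVec, dotProduct, Fin.sum_univ_two]
    ring
  have hs : (symMat w)ᵀ = symMat w := by
    ext i j; fin_cases i <;> fin_cases j <;> rfl
  rw [mem_UHS_iff]
  constructor
  · rintro ⟨-, h⟩ x y hxy
    have := h.dotProduct_mulVec_pos (x := ![x, y]) (by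
      intro h0
      have e0 := congrFun h0 0
      have e1 := congrFun h0 1
      simp at e0 e1
      tauto)
    rw [hq] at this
    simpa using this
  · intro h
    refine ⟨hs, Matrix.PosDef.of_dotProduct_mulVec_pos ?_ ?_⟩
    · ext i j; fin_cases i <;> fin_cases j <;> simp [symMat]
    · intro v hv
      rw [hq]
      refine h _ _ ?_
      by_contra hc
      push Not at hc
      exact hv (by ext i; fin_cases i; exacts [hc.1, hc.2])

theorem exists_symMat {τ : Matrix (Fin 2) (Fin 2) ℂ} (hτ : τ ∈ H2) :
    ∃ w ∈ UHS, τ = symMat w := by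
  have h : τ = symMat (τ 0 0, τ 0 1, τ 1 1) := by
    have h1 := congrFun (congrFun hτ.1 0) 1
    simp only [Matrix.transpose_apply] at h1
    ext i j; fin_cases i <;> fin_cases j <;> simp [symMat, h1]
  exact ⟨_, symMat_mem_H2.1 (h ▸ hτ), h⟩

theorem isOpen_UHS : IsOpen UHS := by
  have h1 : IsOpen {w : ℂ × ℂ × ℂ | 0 < w.1.im} := isOpen_lt continuous_const (by fun_prop)
  have h2 : IsOpen {w : ℂ × ℂ × ℂ | w.2.1.im ^ 2 < w.1.im * w.2.2.im} :=
    isOpen_lt (by fun_prop) (by fun_prop)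
  exact h1.inter h2

/-- The defining quadratic forms depend real-linearly on the point, and positivity passes to convex
combinations. -/
theorem convex_UHS : Convex ℝ UHS := by
  intro u hu v hv a b ha hb hab
  rw [mem_UHS_iff] at *
  intro x y h
  have e : imForm (a • u + b • v) x y = a * imForm u x y + b * imForm v x y := by
    simp [imForm]; ring
  rw [e]
  have h1 := hu x y h
  have h2 := hv x y h
  rcases ha.eq_or_lt with rfl | ha
  · have : b = 1 := by linarith
    subst this; linarith
  · nlinarith

/-- Points of the upper half space whose imaginary part exceeds `ε`. -/
noncomputable def UHSgt (ε : ℝ) : Set (ℂ × ℂ × ℂ) :=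
  (fun w => w + (-(ε * Complex.I), 0, -(ε * Complex.I))) ⁻¹' UHS

theorem isOpen_UHSgt (ε : ℝ) : IsOpen (UHSgt ε) := isOpen_UHS.preimage (by fun_prop)

theorem convex_UHSgt (ε : ℝ) : Convex ℝ (UHSgt ε) := by
  intro u hu v hv a b ha hb hab
  have := convex_UHS hu hv ha hb hab
  have e : a • (u + ((-(ε * Complex.I), 0, -(ε * Complex.I)) : ℂ × ℂ × ℂ))
      + b • (v + (-(ε * Complex.I), 0, -(ε * Complex.I)))
      = a • u + b • v + (-(ε * Complex.I), 0, -(ε * Complex.I)) := by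
    rw [smul_add, smul_add, add_add_add_comm, ← add_smul, hab, one_smul]
  show _ ∈ UHS
  simpa only [e] using this

theorem imForm_ge {ε : ℝ} {w : ℂ × ℂ × ℂ} (hw : w ∈ UHSgt ε) (x y : ℝ) :
    ε * (x ^ 2 + y ^ 2) ≤ imForm w x y := by
  have e : imForm (w + (-(ε * Complex.I), 0, -(ε * Complex.I))) x y
      = imForm w x y - ε * (x ^ 2 + y ^ 2) := by
    simp [imForm]; ring
  by_cases h : x ≠ 0 ∨ y ≠ 0
  · have := imForm_pos (show _ ∈ UHS from hw) h
    rw [e] at this; linarith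
  · push Not at h
    simp [h.1, h.2, imForm]

theorem exists_mem_UHSgt {w : ℂ × ℂ × ℂ} (hw : w ∈ UHS) : ∃ ε > 0, w ∈ UHSgt ε := by
  have hc : ContinuousAt (fun ε : ℝ =>
      w + ((-(ε * Complex.I), 0, -(ε * Complex.I)) : ℂ × ℂ × ℂ)) 0 := by fun_prop
  have h0 : ∀ᶠ ε : ℝ in 𝓝 0, w ∈ UHSgt ε :=
    hc.eventually (isOpen_UHS.mem_nhds (by
      have e : w + ((-(((0 : ℝ) : ℂ) * Complex.I), 0, -(((0 : ℝ) : ℂ) * Complex.I)) : ℂ × ℂ × ℂ)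
          = w := by ext <;> simp
      show _ + _ ∈ UHS
      rwa [e]))
  obtain ⟨δ, hδ, h⟩ := Metric.eventually_nhds_iff.1 h0
  exact ⟨δ / 2, by positivity, h (by rw [Real.dist_eq, sub_zero, abs_of_pos] <;> linarith)⟩

/-! ### Summability of Gaussian sums -/

/-- The cubic term of the exponential series bounds (1 + x²)³ exp(-δx²); the remaining factor 1/(1 +
x²) is compared with 1/(x + 1/4)². The shift by 1/4 keeps the denominator away from zero at integers
and half-integers. -/
theorem summable_gaussian (δ : ℝ) (hδ : 0 < δ) (m : ℤ) :
    Summable fun n : ℤ => (1 + ((n : ℝ) + m / 2) ^ 2) ^ 2 *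
      Real.exp (-(δ * ((n : ℝ) + m / 2) ^ 2)) := by
  have hs : Summable fun n : ℤ => 1 / |(n : ℝ) + ((m : ℝ) / 2 + 1 / 4)| ^ (2 : ℝ) :=
    (Real.summable_one_div_int_add_rpow _ _).2 (by norm_num)
  refine Summable.of_nonneg_of_le (fun n => by positivity) (fun n => ?_)
    (hs.mul_left (2 * (6 * Real.exp δ / δ ^ 3)))
  set x : ℝ := (n : ℝ) + m / 2 with hx
  -- Otherwise 4n + 2m + 1 would be an odd integer equal to zero.
  have hne : x + 1 / 4 ≠ 0 := by
    intro h
    have : ((4 * n + 2 * m + 1 : ℤ) : ℝ) = 0 := by push_cast; rw [hx] at h; linarith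
    have : 4 * n + 2 * m + 1 = 0 := by exact_mod_cast this
    omega
  have e1 : (n : ℝ) + ((m : ℝ) / 2 + 1 / 4) = x + 1 / 4 := by rw [hx]; ring
  rw [e1, Real.rpow_two, sq_abs]
  have hp : 0 < (x + 1 / 4) ^ 2 := by positivity
  have h1 : (1 + x ^ 2) ^ 3 * Real.exp (-(δ * x ^ 2)) ≤ 6 * Real.exp δ / δ ^ 3 := by
    have h2 := Real.pow_div_factorial_le_exp (δ * (1 + x ^ 2)) (by positivity) 3
    have e2 : Real.exp (δ * (1 + x ^ 2)) = Real.exp δ * Real.exp (δ * x ^ 2) := by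
      rw [← Real.exp_add]; ring_nf
    have h3 : ((3).factorial : ℝ) = 6 := by norm_num [Nat.factorial]
    rw [e2, h3, div_le_iff₀ (by norm_num), mul_pow] at h2
    rw [le_div_iff₀ (by positivity), Real.exp_neg]
    rw [← div_eq_mul_inv, div_mul_eq_mul_div, div_le_iff₀ (Real.exp_pos _)]
    linarith
  have h4 : (1 + x ^ 2)⁻¹ ≤ 2 * (1 / (x + 1 / 4) ^ 2) := by
    rw [mul_one_div, inv_eq_one_div, div_le_div_iff₀ (by positivity) hp]
    nlinarith [sq_nonneg (x - 1 / 4)]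
  calc (1 + x ^ 2) ^ 2 * Real.exp (-(δ * x ^ 2))
      = ((1 + x ^ 2) ^ 3 * Real.exp (-(δ * x ^ 2))) * (1 + x ^ 2)⁻¹ := by field_simp
    _ ≤ (6 * Real.exp δ / δ ^ 3) * (2 * (1 / (x + 1 / 4) ^ 2)) := by gcongr
    _ = _ := by ring

/-- A summable majorant for all the theta series used below. -/
noncomputable def thetaBound (ε : ℝ) (m₁ m₂ : ℤ) (n : ℤ × ℤ) : ℝ :=
  ((1 + ((n.1 : ℝ) + m₁ / 2) ^ 2) ^ 2 * Real.exp (-(Real.pi * ε * ((n.1 : ℝ) + m₁ / 2) ^ 2))) *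
  ((1 + ((n.2 : ℝ) + m₂ / 2) ^ 2) ^ 2 * Real.exp (-(Real.pi * ε * ((n.2 : ℝ) + m₂ / 2) ^ 2)))

theorem summable_thetaBound {ε : ℝ} (hε : 0 < ε) (m₁ m₂ : ℤ) : Summable (thetaBound ε m₁ m₂) :=
  (summable_gaussian (Real.pi * ε) (by positivity) m₁).mul_of_nonneg
    (summable_gaussian (Real.pi * ε) (by positivity) m₂) (fun n => by positivity)
    (fun n => by positivity)

/-! ### Theta series with weights -/

/-- The exponential in the theta series of characteristic `(m₁, m₂, k₁, k₂)`. -/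
noncomputable def thTerm (m₁ m₂ k₁ k₂ : ℤ) (w : ℂ × ℂ × ℂ) (n : ℤ × ℤ) : ℂ :=
  Complex.exp (Real.pi * Complex.I * (w.1 * ((n.1 : ℂ) + m₁ / 2) ^ 2
    + 2 * w.2.1 * ((n.1 : ℂ) + m₁ / 2) * ((n.2 : ℂ) + m₂ / 2) + w.2.2 * ((n.2 : ℂ) + m₂ / 2) ^ 2
    + ((n.1 : ℂ) + m₁ / 2) * k₁ + ((n.2 : ℂ) + m₂ / 2) * k₂))

/-- Theta series with a weight `p`. -/
noncomputable def wTheta (p : ℂ → ℂ → ℂ) (m₁ m₂ k₁ k₂ : ℤ) (w : ℂ × ℂ × ℂ) : ℂ :=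
  ∑' n : ℤ × ℤ, p ((n.1 : ℂ) + m₁ / 2) ((n.2 : ℂ) + m₂ / 2) * thTerm m₁ m₂ k₁ k₂ w n

/-- Weights of moderate growth. -/
def Mild (p : ℂ → ℂ → ℂ) : Prop := ∀ x y : ℝ, ‖p x y‖ ≤ (1 + x ^ 2) * (1 + y ^ 2)

theorem mild_one : Mild fun _ _ => 1 := by
  intro x y; rw [norm_one]; nlinarith [sq_nonneg x, sq_nonneg y, mul_nonneg (sq_nonneg x) (sq_nonneg y)]

theorem mild_fst : Mild fun x _ => x := by
  intro x y; rw [Complex.norm_real, Real.norm_eq_abs]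
  have : |x| ≤ 1 + x ^ 2 := by rw [abs_le]; constructor <;> nlinarith [sq_nonneg (x - 1), sq_nonneg (x + 1)]
  nlinarith [sq_nonneg x, sq_nonneg y, mul_nonneg (sq_nonneg x) (sq_nonneg y)]

theorem mild_snd : Mild fun _ y => y := by
  intro x y; rw [Complex.norm_real, Real.norm_eq_abs]
  have : |y| ≤ 1 + y ^ 2 := by rw [abs_le]; constructor <;> nlinarith [sq_nonneg (y - 1), sq_nonneg (y + 1)]
  nlinarith [sq_nonneg x, sq_nonneg y, mul_nonneg (sq_nonneg x) (sq_nonneg y)]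

theorem norm_thTerm (m₁ m₂ k₁ k₂ : ℤ) (w : ℂ × ℂ × ℂ) (n : ℤ × ℤ) :
    ‖thTerm m₁ m₂ k₁ k₂ w n‖
      = Real.exp (-(Real.pi * imForm w ((n.1 : ℝ) + m₁ / 2) ((n.2 : ℝ) + m₂ / 2))) := by
  rw [thTerm, Complex.norm_exp]
  congr 1
  have e1 : (n.1 : ℂ) + m₁ / 2 = (((n.1 : ℝ) + m₁ / 2 : ℝ) : ℂ) := by push_cast; ring
  have e2 : (n.2 : ℂ) + m₂ / 2 = (((n.2 : ℝ) + m₂ / 2 : ℝ) : ℂ) := by push_cast; ring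
  have e3 : (k₁ : ℂ) = ((k₁ : ℝ) : ℂ) := by simp
  have e4 : (k₂ : ℂ) = ((k₂ : ℝ) : ℂ) := by simp
  rw [e1, e2, e3, e4]
  generalize (n.1 : ℝ) + m₁ / 2 = x
  generalize (n.2 : ℝ) + m₂ / 2 = y
  generalize (k₁ : ℝ) = s
  generalize (k₂ : ℝ) = t
  simp [imForm, Complex.mul_re, Complex.mul_im, pow_two]

theorem norm_weight_le {p : ℂ → ℂ → ℂ} (hp : Mild p) (m₁ m₂ : ℤ) (n : ℤ × ℤ) :
    ‖p ((n.1 : ℂ) + m₁ / 2) ((n.2 : ℂ) + m₂ / 2)‖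
      ≤ (1 + ((n.1 : ℝ) + m₁ / 2) ^ 2) * (1 + ((n.2 : ℝ) + m₂ / 2) ^ 2) := by
  have := hp ((n.1 : ℝ) + m₁ / 2) ((n.2 : ℝ) + m₂ / 2)
  push_cast at this
  exact this

theorem norm_thTerm_le {ε : ℝ} {w : ℂ × ℂ × ℂ} (hw : w ∈ UHSgt ε) (m₁ m₂ k₁ k₂ : ℤ) (n : ℤ × ℤ) :
    ((1 + ((n.1 : ℝ) + m₁ / 2) ^ 2) * (1 + ((n.2 : ℝ) + m₂ / 2) ^ 2)) ^ 2
      * ‖thTerm m₁ m₂ k₁ k₂ w n‖ ≤ thetaBound ε m₁ m₂ n := by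
  rw [norm_thTerm, thetaBound]
  have h := imForm_ge hw ((n.1 : ℝ) + m₁ / 2) ((n.2 : ℝ) + m₂ / 2)
  set x := (n.1 : ℝ) + m₁ / 2
  set y := (n.2 : ℝ) + m₂ / 2
  have : Real.exp (-(Real.pi * imForm w x y))
      ≤ Real.exp (-(Real.pi * ε * x ^ 2)) * Real.exp (-(Real.pi * ε * y ^ 2)) := by
    rw [← Real.exp_add]
    apply Real.exp_le_exp.2
    nlinarith [Real.pi_pos]
  calc _ ≤ ((1 + x ^ 2) * (1 + y ^ 2)) ^ 2 *
      (Real.exp (-(Real.pi * ε * x ^ 2)) * Real.exp (-(Real.pi * ε * y ^ 2))) := by gcongr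
    _ = _ := by ring

theorem norm_wTerm_le {p : ℂ → ℂ → ℂ} (hp : Mild p) {ε : ℝ} {w : ℂ × ℂ × ℂ} (hw : w ∈ UHSgt ε)
    (m₁ m₂ k₁ k₂ : ℤ) (n : ℤ × ℤ) :
    ‖p ((n.1 : ℂ) + m₁ / 2) ((n.2 : ℂ) + m₂ / 2) * thTerm m₁ m₂ k₁ k₂ w n‖
      ≤ thetaBound ε m₁ m₂ n := by
  refine le_trans ?_ (norm_thTerm_le hw m₁ m₂ k₁ k₂ n)
  rw [norm_mul]
  gcongr
  refine (norm_weight_le hp m₁ m₂ n).trans ?_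
  refine le_self_pow₀ ?_ two_ne_zero
  nlinarith [sq_nonneg ((n.1 : ℝ) + m₁ / 2), sq_nonneg ((n.2 : ℝ) + m₂ / 2),
    mul_nonneg (sq_nonneg ((n.1 : ℝ) + m₁ / 2)) (sq_nonneg ((n.2 : ℝ) + m₂ / 2))]

theorem summable_wTheta {p : ℂ → ℂ → ℂ} (hp : Mild p) (m₁ m₂ k₁ k₂ : ℤ) {w : ℂ × ℂ × ℂ}
    (hw : w ∈ UHS) : Summable fun n : ℤ × ℤ =>
      p ((n.1 : ℂ) + m₁ / 2) ((n.2 : ℂ) + m₂ / 2) * thTerm m₁ m₂ k₁ k₂ w n := by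
  obtain ⟨ε, hε, h⟩ := exists_mem_UHSgt hw
  exact Summable.of_norm_bounded (summable_thetaBound hε m₁ m₂) (norm_wTerm_le hp h m₁ m₂ k₁ k₂)

theorem summable_thTerm (m₁ m₂ k₁ k₂ : ℤ) {w : ℂ × ℂ × ℂ} (hw : w ∈ UHS) :
    Summable (thTerm m₁ m₂ k₁ k₂ w) := by
  simpa using summable_wTheta mild_one m₁ m₂ k₁ k₂ hw

/-- Termwise differentiation on the open convex set `UHSgt ε`. The weight costs one factor (1 +
x²)(1 + y²) and the derivative of the quadratic form another, which is why `thetaBound` carries the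
squares. -/
theorem differentiableAt_wTheta {p : ℂ → ℂ → ℂ} (hp : Mild p) (m₁ m₂ k₁ k₂ : ℤ) {w : ℂ × ℂ × ℂ}
    (hw : w ∈ UHS) : DifferentiableAt ℂ (wTheta p m₁ m₂ k₁ k₂) w := by
  obtain ⟨ε, hε, h⟩ := exists_mem_UHSgt hw
  let l : ℤ × ℤ → (ℂ × ℂ × ℂ →L[ℂ] ℂ) := fun n =>
    ((n.1 : ℂ) + m₁ / 2) ^ 2 • ContinuousLinearMap.fst ℂ ℂ (ℂ × ℂ)
    + (2 * ((n.1 : ℂ) + m₁ / 2) * ((n.2 : ℂ) + m₂ / 2)) •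
      (ContinuousLinearMap.fst ℂ ℂ ℂ).comp (ContinuousLinearMap.snd ℂ ℂ (ℂ × ℂ))
    + ((n.2 : ℂ) + m₂ / 2) ^ 2 •
      (ContinuousLinearMap.snd ℂ ℂ ℂ).comp (ContinuousLinearMap.snd ℂ ℂ (ℂ × ℂ))
  have hl : ∀ n : ℤ × ℤ, ‖l n‖ ≤
      (((n.1 : ℝ) + m₁ / 2) ^ 2 + 2 * |(n.1 : ℝ) + m₁ / 2| * |(n.2 : ℝ) + m₂ / 2|
        + ((n.2 : ℝ) + m₂ / 2) ^ 2) := by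
    intro n
    have e1 : (n.1 : ℂ) + m₁ / 2 = (((n.1 : ℝ) + m₁ / 2 : ℝ) : ℂ) := by push_cast; ring
    have e2 : (n.2 : ℂ) + m₂ / 2 = (((n.2 : ℝ) + m₂ / 2 : ℝ) : ℂ) := by push_cast; ring
    have f1 : ‖(ContinuousLinearMap.fst ℂ ℂ ℂ).comp (ContinuousLinearMap.snd ℂ ℂ (ℂ × ℂ))‖ ≤ 1 :=
      (ContinuousLinearMap.opNorm_comp_le _ _).trans
        (mul_le_one₀ (ContinuousLinearMap.norm_fst_le ..) (norm_nonneg _)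
          (ContinuousLinearMap.norm_snd_le ..))
    have f2 : ‖(ContinuousLinearMap.snd ℂ ℂ ℂ).comp (ContinuousLinearMap.snd ℂ ℂ (ℂ × ℂ))‖ ≤ 1 :=
      (ContinuousLinearMap.opNorm_comp_le _ _).trans
        (mul_le_one₀ (ContinuousLinearMap.norm_snd_le ..) (norm_nonneg _)
          (ContinuousLinearMap.norm_snd_le ..))
    refine (norm_add₃_le).trans ?_
    simp only [norm_smul, norm_mul, norm_pow, e1, e2, Complex.norm_real, Real.norm_eq_abs, sq_abs]
    refine add_le_add (add_le_add ?_ ?_) ?_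
    · exact mul_le_of_le_one_right (by positivity) (ContinuousLinearMap.norm_fst_le ..)
    · simp only [Complex.norm_ofNat]
      exact mul_le_of_le_one_right (by positivity) f1
    · exact mul_le_of_le_one_right (by positivity) f2
  have := hasFDerivAt_tsum_of_isPreconnected (𝕜 := ℂ)
    (u := fun n => Real.pi * 2 * thetaBound ε m₁ m₂ n)
    (f := fun (n : ℤ × ℤ) w => p ((n.1 : ℂ) + m₁ / 2) ((n.2 : ℂ) + m₂ / 2) * thTerm m₁ m₂ k₁ k₂ w n)
    (f' := fun n w => (p ((n.1 : ℂ) + m₁ / 2) ((n.2 : ℂ) + m₂ / 2)) •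
      (thTerm m₁ m₂ k₁ k₂ w n • ((Real.pi * Complex.I) • l n)))
    ((summable_thetaBound hε m₁ m₂).mul_left _) (isOpen_UHSgt ε)
    (convex_UHSgt ε).isPreconnected ?_ ?_ h (summable_wTheta hp m₁ m₂ k₁ k₂ hw) h
  · exact this.differentiableAt
  · intro n x _
    refine HasFDerivAt.const_mul ?_ _
    refine HasFDerivAt.cexp (HasFDerivAt.const_mul ?_ _)
    have h1 := (l n).hasFDerivAt (x := x)
    have := h1.add_const (((n.1 : ℂ) + m₁ / 2) * k₁ + ((n.2 : ℂ) + m₂ / 2) * k₂)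
    refine this.congr_of_eventuallyEq (Filter.Eventually.of_forall fun y => ?_)
    simp [l]
    ring
  · intro n x hx
    refine le_trans ?_ (mul_le_mul_of_nonneg_left (norm_thTerm_le hx m₁ m₂ k₁ k₂ n) (by positivity))
    simp only [norm_smul, norm_mul, Complex.norm_real, Real.norm_eq_abs, Complex.norm_I, mul_one,
      abs_of_pos Real.pi_pos]
    have h1 := norm_weight_le hp m₁ m₂ n
    have h2 := hl n
    set X := (n.1 : ℝ) + m₁ / 2
    set Y := (n.2 : ℝ) + m₂ / 2
    have h3 : X ^ 2 + 2 * |X| * |Y| + Y ^ 2 ≤ 2 * ((1 + X ^ 2) * (1 + Y ^ 2)) := by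
      have := sq_nonneg (|X| - |Y|)
      have e1 := sq_abs X
      have e2 := sq_abs Y
      nlinarith [mul_nonneg (sq_nonneg X) (sq_nonneg Y)]
    calc _ ≤ ((1 + X ^ 2) * (1 + Y ^ 2)) * (‖thTerm m₁ m₂ k₁ k₂ x n‖ *
        (Real.pi * (2 * ((1 + X ^ 2) * (1 + Y ^ 2))))) := by gcongr; exact h2.trans h3
      _ = _ := by ring

/-! ### Theta constants and gradients in coordinates -/

theorem theta_symMat (c : Fin 4 → ℤ) (w : ℂ × ℂ × ℂ) (z : Fin 2 → ℂ) :
    theta c (symMat w) z = ∑' n : ℤ × ℤ, Complex.exp (2 * Real.pi * Complex.I *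
      (((n.1 : ℂ) + c 0 / 2) * z 0 + ((n.2 : ℂ) + c 1 / 2) * z 1))
      * thTerm (c 0) (c 1) (c 2) (c 3) w n := by
  rw [theta, ← (finTwoArrowEquiv ℤ).symm.tsum_eq]
  refine tsum_congr fun n => ?_
  rw [thTerm, ← Complex.exp_add]
  simp [symMat, dotProduct, Fin.sum_univ_two, finTwoArrowEquiv]
  congr 1
  ring

theorem theta_zero (c : Fin 4 → ℤ) (w : ℂ × ℂ × ℂ) :
    theta c (symMat w) 0 = wTheta (fun _ _ => 1) (c 0) (c 1) (c 2) (c 3) w := by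
  rw [theta_symMat, wTheta]; simp

/-- Termwise differentiation on the unit disc, where the exponential of index n is at most exp(2π|x
n|) in absolute value. -/
theorem deriv_tsum_exp {ι : Type*} (x : ι → ℝ) (g : ι → ℂ) (u : ι → ℝ) (hu : Summable u)
    (h : ∀ n, Real.exp (2 * Real.pi * |x n|) * (1 + |x n|) * ‖g n‖ ≤ u n) :
    deriv (fun s : ℂ => ∑' n, Complex.exp (2 * Real.pi * Complex.I * (x n * s)) * g n) 0
      = 2 * Real.pi * Complex.I * ∑' n, x n * g n := by
  have hb : ∀ n (s : ℂ), s ∈ Metric.ball (0 : ℂ) 1 →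
      ‖Complex.exp (2 * Real.pi * Complex.I * (x n * s))‖ ≤ Real.exp (2 * Real.pi * |x n|) := by
    intro n s hs
    rw [Complex.norm_exp]
    apply Real.exp_le_exp.2
    have hs' : |s.im| ≤ 1 := (Complex.abs_im_le_norm s).trans (by simpa using (mem_ball_zero_iff.1 hs).le)
    have e : (2 * Real.pi * Complex.I * (x n * s)).re = -(2 * Real.pi) * (x n * s.im) := by
      simp [Complex.mul_re, Complex.mul_im]
    rw [e]
    have : |x n * s.im| ≤ |x n| := by
      rw [abs_mul]; exact mul_le_of_le_one_right (abs_nonneg _) hs'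
    nlinarith [neg_abs_le (x n * s.im), Real.pi_pos]
  have hd : HasDerivAt (fun s : ℂ => ∑' n, Complex.exp (2 * Real.pi * Complex.I * (x n * s)) * g n)
      (∑' n, Complex.exp (2 * Real.pi * Complex.I * (x n * 0)) * (2 * Real.pi * Complex.I * x n) * g n)
      0 := by
    refine hasDerivAt_tsum_of_isPreconnected (u := fun n => 2 * Real.pi * u n)
      (g := fun n s => Complex.exp (2 * Real.pi * Complex.I * (x n * s)) * g n)
      (g' := fun n s => Complex.exp (2 * Real.pi * Complex.I * (x n * s))
        * (2 * Real.pi * Complex.I * x n) * g n)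
      (hu.mul_left _) (Metric.isOpen_ball (x := (0 : ℂ)) (ε := 1))
      (convex_ball _ _).isPreconnected ?_ ?_ (Metric.mem_ball_self one_pos) ?_
      (Metric.mem_ball_self one_pos)
    · intro n s _
      refine HasDerivAt.mul_const (HasDerivAt.cexp ?_) _
      have := (hasDerivAt_id s).const_mul (2 * Real.pi * Complex.I * x n)
      simp only [id, mul_one] at this
      refine this.congr_of_eventuallyEq (Filter.Eventually.of_forall fun y => ?_)
      simp only; ring
    · intro n s hs
      simp only [norm_mul, Complex.norm_real, Complex.norm_I, Real.norm_eq_abs, mul_one,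
        Complex.norm_ofNat, abs_of_pos Real.pi_pos]
      refine le_trans ?_ (mul_le_mul_of_nonneg_left (h n) (by positivity))
      have := hb n s hs
      calc _ ≤ Real.exp (2 * Real.pi * |x n|) * (2 * Real.pi * (1 + |x n|)) * ‖g n‖ := by
            gcongr; linarith [abs_nonneg (x n)]
        _ = _ := by ring
    · refine Summable.of_norm_bounded hu fun n => ?_
      refine le_trans ?_ (h n)
      rw [norm_mul]
      gcongr
      refine (hb n 0 (Metric.mem_ball_self one_pos)).trans ?_
      exact le_mul_of_one_le_right (Real.exp_pos _).le (by linarith [abs_nonneg (x n)])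
  rw [hd.deriv, ← tsum_mul_left]
  refine tsum_congr fun n => ?_
  simp; ring

/-- Half of the Gaussian decay absorbs the linear exponential, so the majorant uses ε/2 in place of
ε. -/
theorem summable_exp_bound {w : ℂ × ℂ × ℂ} (hw : w ∈ UHS) (m₁ m₂ k₁ k₂ : ℤ) :
    ∃ u : ℤ × ℤ → ℝ, Summable u ∧ ∀ n : ℤ × ℤ,
      Real.exp (2 * Real.pi * |(n.1 : ℝ) + m₁ / 2|) * (1 + |(n.1 : ℝ) + m₁ / 2|)
        * ‖thTerm m₁ m₂ k₁ k₂ w n‖ ≤ u n ∧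
      Real.exp (2 * Real.pi * |(n.2 : ℝ) + m₂ / 2|) * (1 + |(n.2 : ℝ) + m₂ / 2|)
        * ‖thTerm m₁ m₂ k₁ k₂ w n‖ ≤ u n := by
  obtain ⟨ε, hε, h⟩ := exists_mem_UHSgt hw
  refine ⟨fun n => 2 * Real.exp (Real.pi * (2 / ε)) * thetaBound (ε / 2) m₁ m₂ n,
    (summable_thetaBound (half_pos hε) m₁ m₂).mul_left _, fun n => ?_⟩
  rw [norm_thTerm]
  simp only [thetaBound]
  have h1 := imForm_ge h ((n.1 : ℝ) + m₁ / 2) ((n.2 : ℝ) + m₂ / 2)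
  set x := (n.1 : ℝ) + m₁ / 2
  set y := (n.2 : ℝ) + m₂ / 2
  have key : ∀ a b : ℝ, ε * (a ^ 2 + b ^ 2) ≤ imForm w x y →
      Real.exp (2 * Real.pi * |a|) * (1 + |a|) * Real.exp (-(Real.pi * imForm w x y)) ≤
      2 * Real.exp (Real.pi * (2 / ε)) *
      (((1 + a ^ 2) ^ 2 * Real.exp (-(Real.pi * (ε / 2) * a ^ 2))) *
      ((1 + b ^ 2) ^ 2 * Real.exp (-(Real.pi * (ε / 2) * b ^ 2)))) := by
    intro a b hab
    have h3 : Real.exp (2 * Real.pi * |a|) * Real.exp (-(Real.pi * imForm w x y)) ≤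
        Real.exp (Real.pi * (2 / ε)) * (Real.exp (-(Real.pi * (ε / 2) * a ^ 2)) *
        Real.exp (-(Real.pi * (ε / 2) * b ^ 2))) := by
      rw [← Real.exp_add, ← Real.exp_add, ← Real.exp_add]
      apply Real.exp_le_exp.2
      -- The inequality between arithmetic and geometric means for 2/ε and (ε/2)a².
      have h4 : 2 * |a| ≤ 2 / ε + ε / 2 * a ^ 2 := by
        have : 0 ≤ (2 / ε) * (1 - ε / 2 * |a|) ^ 2 := by positivity
        have e : (2 / ε) * (1 - ε / 2 * |a|) ^ 2 = 2 / ε - 2 * |a| + ε / 2 * |a| ^ 2 := by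
          field_simp; ring
        rw [e, sq_abs] at this; linarith
      nlinarith [Real.pi_pos, mul_nonneg hε.le (sq_nonneg b)]
    have h5 : 1 + |a| ≤ 2 * ((1 + a ^ 2) ^ 2 * (1 + b ^ 2) ^ 2) := by
      have h6 : 1 + |a| ≤ 2 * (1 + a ^ 2) := by
        nlinarith [sq_nonneg (|a| - 1), sq_abs a, abs_nonneg a]
      have h7 : (1 + a ^ 2) ≤ (1 + a ^ 2) ^ 2 := le_self_pow₀ (by nlinarith [sq_nonneg a]) two_ne_zero
      have h8 : 1 ≤ (1 + b ^ 2) ^ 2 := one_le_pow₀ (by nlinarith [sq_nonneg b])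
      nlinarith [sq_nonneg a]
    calc _ = (1 + |a|) * (Real.exp (2 * Real.pi * |a|) * Real.exp (-(Real.pi * imForm w x y))) := by
          ring
      _ ≤ (2 * ((1 + a ^ 2) ^ 2 * (1 + b ^ 2) ^ 2)) * (Real.exp (Real.pi * (2 / ε)) *
          (Real.exp (-(Real.pi * (ε / 2) * a ^ 2)) * Real.exp (-(Real.pi * (ε / 2) * b ^ 2)))) :=
          mul_le_mul h5 h3 (by positivity) (by positivity)
      _ = _ := by ring
  refine ⟨key x y h1, ?_⟩
  have := key y x (by rw [add_comm]; exact h1)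
  rwa [mul_comm ((1 + y ^ 2) ^ 2 * _)] at this

theorem grad_symMat (i : ℕ) {w : ℂ × ℂ × ℂ} (hw : w ∈ UHS) :
    grad i (symMat w) = ![
      2 * Real.pi * Complex.I * wTheta (fun x _ => x) (oddChar i 0) (oddChar i 1) (oddChar i 2)
        (oddChar i 3) w,
      2 * Real.pi * Complex.I * wTheta (fun _ y => y) (oddChar i 0) (oddChar i 1) (oddChar i 2)
        (oddChar i 3) w] := by
  obtain ⟨u, hu, h⟩ := summable_exp_bound hw (oddChar i 0) (oddChar i 1) (oddChar i 2) (oddChar i 3)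
  ext a
  fin_cases a
  · have := deriv_tsum_exp (fun n : ℤ × ℤ => (n.1 : ℝ) + (oddChar i 0 : ℝ) / 2) _ u hu
      fun n => (h n).1
    push_cast at this
    simp only [grad, theta_symMat]
    simpa [wTheta] using this
  · have := deriv_tsum_exp (fun n : ℤ × ℤ => (n.2 : ℝ) + (oddChar i 1 : ℝ) / 2) _ u hu
      fun n => (h n).2
    push_cast at this
    simp only [grad, theta_symMat]
    simpa [wTheta] using this

/-! ### Elementary symmetries of theta series -/

theorem Complex.exp_pi_mul_I_int (j : ℤ) : Complex.exp (Real.pi * Complex.I * j) = (-1) ^ j := by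
  rw [← Complex.exp_pi_mul_I, ← Complex.exp_int_mul]; congr 1; ring

theorem wTheta_m₁ (p : ℂ → ℂ → ℂ) (m₁ m₂ k₁ k₂ j : ℤ) (w : ℂ × ℂ × ℂ) :
    wTheta p (m₁ + 2 * j) m₂ k₁ k₂ w = wTheta p m₁ m₂ k₁ k₂ w := by
  rw [wTheta, wTheta, ← ((Equiv.addRight j).prodCongr (Equiv.refl ℤ)).tsum_eq
    (fun n : ℤ × ℤ => p ((n.1 : ℂ) + m₁ / 2) ((n.2 : ℂ) + m₂ / 2) * thTerm m₁ m₂ k₁ k₂ w n)]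
  refine tsum_congr fun n => ?_
  have e : (n.1 : ℂ) + ((m₁ + 2 * j : ℤ) : ℂ) / 2 = ((n.1 + j : ℤ) : ℂ) + m₁ / 2 := by
    push_cast; ring
  simp only [thTerm, e, Equiv.prodCongr_apply, Prod.map, Equiv.coe_addRight, Equiv.refl_apply]

theorem wTheta_m₂ (p : ℂ → ℂ → ℂ) (m₁ m₂ k₁ k₂ j : ℤ) (w : ℂ × ℂ × ℂ) :
    wTheta p m₁ (m₂ + 2 * j) k₁ k₂ w = wTheta p m₁ m₂ k₁ k₂ w := by
  rw [wTheta, wTheta, ← ((Equiv.refl ℤ).prodCongr (Equiv.addRight j)).tsum_eq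
    (fun n : ℤ × ℤ => p ((n.1 : ℂ) + m₁ / 2) ((n.2 : ℂ) + m₂ / 2) * thTerm m₁ m₂ k₁ k₂ w n)]
  refine tsum_congr fun n => ?_
  have e : (n.2 : ℂ) + ((m₂ + 2 * j : ℤ) : ℂ) / 2 = ((n.2 + j : ℤ) : ℂ) + m₂ / 2 := by
    push_cast; ring
  simp only [thTerm, e, Equiv.prodCongr_apply, Prod.map, Equiv.coe_addRight, Equiv.refl_apply]

theorem wTheta_k (p : ℂ → ℂ → ℂ) (m₁ m₂ k₁ k₂ i j : ℤ) (w : ℂ × ℂ × ℂ) :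
    wTheta p m₁ m₂ (k₁ + 2 * i) (k₂ + 2 * j) w
      = (-1) ^ (m₁ * i + m₂ * j) * wTheta p m₁ m₂ k₁ k₂ w := by
  rw [wTheta, wTheta, ← tsum_mul_left]
  refine tsum_congr fun n => ?_
  rw [mul_left_comm]
  congr 1
  rw [← Complex.exp_pi_mul_I_int, thTerm, thTerm, ← Complex.exp_add, Complex.exp_eq_exp_iff_exists_int]
  exact ⟨n.1 * i + n.2 * j, by push_cast; ring⟩

/-- The substitution n ↦ -m - n changes the sign of the vector n + m/2. -/
theorem wTheta_neg (p : ℂ → ℂ → ℂ) (m₁ m₂ k₁ k₂ : ℤ) (w : ℂ × ℂ × ℂ) :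
    wTheta (fun x y => p (-x) (-y)) m₁ m₂ k₁ k₂ w
      = (-1) ^ (m₁ * k₁ + m₂ * k₂) * wTheta p m₁ m₂ k₁ k₂ w := by
  rw [wTheta, wTheta, ← tsum_mul_left,
    ← ((Equiv.subLeft (-m₁)).prodCongr (Equiv.subLeft (-m₂))).tsum_eq]
  refine tsum_congr fun n => ?_
  simp only [Equiv.prodCongr_apply, Prod.map, Equiv.subLeft_apply]
  have e1 : (((-m₁ - n.1 : ℤ) : ℂ) + m₁ / 2) = -((n.1 : ℂ) + m₁ / 2) := by push_cast; ring
  have e2 : (((-m₂ - n.2 : ℤ) : ℂ) + m₂ / 2) = -((n.2 : ℂ) + m₂ / 2) := by push_cast; ring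
  rw [mul_left_comm, thTerm]
  simp only [e1, e2, neg_neg]
  congr 1
  rw [← Complex.exp_pi_mul_I_int, thTerm, ← Complex.exp_add, Complex.exp_eq_exp_iff_exists_int]
  exact ⟨-(n.1 * k₁ + n.2 * k₂ + (m₁ * k₁ + m₂ * k₂)), by push_cast; ring⟩

theorem wTheta_one_eq_zero {m₁ m₂ k₁ k₂ : ℤ} (h : Odd (m₁ * k₁ + m₂ * k₂)) (w : ℂ × ℂ × ℂ) :
    wTheta (fun _ _ => 1) m₁ m₂ k₁ k₂ w = 0 := by
  have := wTheta_neg (fun _ _ => 1) m₁ m₂ k₁ k₂ w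
  rw [h.neg_one_zpow] at this
  linear_combination this / 2

/-! ### The duplication formula -/

theorem two_smul_mem_UHS {w : ℂ × ℂ × ℂ} (hw : w ∈ UHS) {t : ℝ} (ht : 0 < t) :
    (t : ℂ) • w ∈ UHS := by
  obtain ⟨h1, h2⟩ := hw
  have : 0 < t ^ 2 := by positivity
  refine ⟨by simpa using mul_pos ht h1, ?_⟩
  simp
  nlinarith

/-- The parallelogram law τ[a] + τ[b] = 2τ[(a+b)/2] + 2τ[(a-b)/2]. Here the half sum is l + (s +
m)/2 and the half difference is k + s/2, with s recording the parity of the difference of the two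
integral vectors. -/
theorem thTerm_mul (m₁ m₂ k₁ k₂ k₁' k₂' s₁ s₂ : ℤ) (w : ℂ × ℂ × ℂ) (k l : ℤ × ℤ) :
    thTerm m₁ m₂ k₁ k₂ w (l.1 + k.1 + s₁, l.2 + k.2 + s₂)
      * thTerm m₁ m₂ k₁' k₂' w (l.1 - k.1, l.2 - k.2)
    = thTerm (s₁ + m₁) (s₂ + m₂) (k₁ + k₁') (k₂ + k₂') ((2 : ℂ) • w) l
      * thTerm s₁ s₂ (k₁ - k₁') (k₂ - k₂') ((2 : ℂ) • w) k := by
  simp only [thTerm, ← Complex.exp_add]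
  congr 1
  simp
  ring

/-- The reindexing of pairs of integral vectors by half sum and half difference. -/
noncomputable def sumDiffEquiv : (Fin 2 × Fin 2) × ((ℤ × ℤ) × (ℤ × ℤ)) ≃ (ℤ × ℤ) × (ℤ × ℤ) :=
  Equiv.ofBijective (fun x => ((x.2.1.1 + x.2.2.1 + ((x.1.1 : ℕ) : ℤ),
      x.2.1.2 + x.2.2.2 + ((x.1.2 : ℕ) : ℤ)), (x.2.1.1 - x.2.2.1, x.2.1.2 - x.2.2.2))) <| by
    constructor
    · rintro ⟨⟨s₁, s₂⟩, ⟨l₁, l₂⟩, ⟨k₁, k₂⟩⟩ ⟨⟨s₁', s₂'⟩, ⟨l₁', l₂'⟩, ⟨k₁', k₂'⟩⟩ h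
      simp only [Prod.mk.injEq, Fin.ext_iff] at h ⊢
      have := s₁.2; have := s₂.2; have := s₁'.2; have := s₂'.2
      omega
    · rintro ⟨⟨a, b⟩, ⟨c, d⟩⟩
      refine ⟨⟨⟨⟨((a - c) % 2).toNat, by omega⟩, ⟨((b - d) % 2).toNat, by omega⟩⟩,
        ⟨c + (a - c) / 2, d + (b - d) / 2⟩, ⟨(a - c) / 2, (b - d) / 2⟩⟩, ?_⟩
      simp only [Prod.mk.injEq]
      omega

theorem sumDiffEquiv_apply (s₁ s₂ : Fin 2) (l k : ℤ × ℤ) : sumDiffEquiv ((s₁, s₂), (l, k)) =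
    ((l.1 + k.1 + ((s₁ : ℕ) : ℤ), l.2 + k.2 + ((s₂ : ℕ) : ℤ)), (l.1 - k.1, l.2 - k.2)) := rfl

theorem tsum_fintype_prod_mul {S A B : Type*} [Fintype S] (f : S → A → ℂ) (g : S → B → ℂ)
    (hf : ∀ s, Summable fun a => ‖f s a‖) (hg : ∀ s, Summable fun b => ‖g s b‖) :
    ∑' x : S × (A × B), f x.1 x.2.1 * g x.1 x.2.2 = ∑ s, (∑' a, f s a) * ∑' b, g s b := by
  have hs : ∀ s, Summable fun y : A × B => ‖f s y.1 * g s y.2‖ :=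
    fun s => (summable_mul_of_summable_norm (hf s) (hg s)).norm
  have hsum : Summable fun x : S × (A × B) => f x.1 x.2.1 * g x.1 x.2.2 :=
    Summable.of_norm ((summable_prod_of_nonneg (fun _ => norm_nonneg _)).2
      ⟨hs, (hasSum_fintype _).summable⟩)
  rw [hsum.tsum_prod' fun s => (hs s).of_norm, tsum_fintype]
  exact Finset.sum_congr rfl fun s _ => (tsum_mul_tsum_of_summable_norm (hf s) (hg s)).symm

/-- The weight is evaluated at the midpoint of the two vectors, so after the change of variables it
involves only the half sum and the double series factors for each parity class s. -/
theorem duplication {p : ℂ → ℂ → ℂ} (hp : Mild p) (m₁ m₂ k₁ k₂ k₁' k₂' : ℤ) {w : ℂ × ℂ × ℂ}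
    (hw : w ∈ UHS) :
    ∑' x : (ℤ × ℤ) × (ℤ × ℤ),
      p (((x.1.1 : ℂ) + m₁ / 2 + ((x.2.1 : ℂ) + m₁ / 2)) / 2)
        (((x.1.2 : ℂ) + m₂ / 2 + ((x.2.2 : ℂ) + m₂ / 2)) / 2)
      * (thTerm m₁ m₂ k₁ k₂ w x.1 * thTerm m₁ m₂ k₁' k₂' w x.2)
    = ∑ s : Fin 2 × Fin 2,
      wTheta p (((s.1 : ℕ) : ℤ) + m₁) (((s.2 : ℕ) : ℤ) + m₂) (k₁ + k₁') (k₂ + k₂') ((2 : ℂ) • w)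
      * wTheta (fun _ _ => 1) ((s.1 : ℕ) : ℤ) ((s.2 : ℕ) : ℤ) (k₁ - k₁') (k₂ - k₂') ((2 : ℂ) • w)
      := by
  have hw2 : (2 : ℂ) • w ∈ UHS := by simpa using two_smul_mem_UHS hw (t := 2) two_pos
  have h := tsum_fintype_prod_mul
    (fun (s : Fin 2 × Fin 2) (n : ℤ × ℤ) =>
      p ((n.1 : ℂ) + ((((s.1 : ℕ) : ℤ) + m₁ : ℤ) : ℂ) / 2)
        ((n.2 : ℂ) + ((((s.2 : ℕ) : ℤ) + m₂ : ℤ) : ℂ) / 2)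
      * thTerm (((s.1 : ℕ) : ℤ) + m₁) (((s.2 : ℕ) : ℤ) + m₂) (k₁ + k₁') (k₂ + k₂')
          ((2 : ℂ) • w) n)
    (fun (s : Fin 2 × Fin 2) (n : ℤ × ℤ) =>
      thTerm ((s.1 : ℕ) : ℤ) ((s.2 : ℕ) : ℤ) (k₁ - k₁') (k₂ - k₂') ((2 : ℂ) • w) n)
    (fun s => (summable_wTheta hp _ _ _ _ hw2).norm) (fun s => (summable_thTerm _ _ _ _ hw2).norm)
  simp only [wTheta, one_mul]
  rw [← h, ← sumDiffEquiv.tsum_eq]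
  refine tsum_congr ?_
  rintro ⟨⟨s₁, s₂⟩, l, k⟩
  rw [sumDiffEquiv_apply]
  simp only
  rw [thTerm_mul, ← mul_assoc]
  congr 3 <;> push_cast <;> ring

theorem theta_mul_theta (m₁ m₂ k₁ k₂ k₁' k₂' : ℤ) {w : ℂ × ℂ × ℂ} (hw : w ∈ UHS) :
    wTheta (fun _ _ => 1) m₁ m₂ k₁ k₂ w * wTheta (fun _ _ => 1) m₁ m₂ k₁' k₂' w
    = ∑ s : Fin 2 × Fin 2,
      wTheta (fun _ _ => 1) (((s.1 : ℕ) : ℤ) + m₁) (((s.2 : ℕ) : ℤ) + m₂) (k₁ + k₁') (k₂ + k₂')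
        ((2 : ℂ) • w)
      * wTheta (fun _ _ => 1) ((s.1 : ℕ) : ℤ) ((s.2 : ℕ) : ℤ) (k₁ - k₁') (k₂ - k₂') ((2 : ℂ) • w)
      := by
  rw [← duplication mild_one m₁ m₂ k₁ k₂ k₁' k₂' hw]
  simp only [wTheta, one_mul]
  exact tsum_mul_tsum_of_summable_norm (summable_thTerm _ _ _ _ hw).norm
    (summable_thTerm _ _ _ _ hw).norm

/-- Weights that are odd and compatible with midpoints. -/
structure OddW (p : ℂ → ℂ → ℂ) : Prop where
  mild : Mild p
  neg : ∀ x y, p (-x) (-y) = -p x y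
  mid : ∀ x y x' y', p ((x + x') / 2) ((y + y') / 2) = (p x y + p x' y') / 2

theorem oddW_fst : OddW fun x _ => x := ⟨mild_fst, fun _ _ => rfl, fun _ _ _ _ => rfl⟩

theorem oddW_snd : OddW fun _ y => y := ⟨mild_snd, fun _ _ => rfl, fun _ _ _ _ => rfl⟩

/-- For an odd linear weight the value at the midpoint is the average of the values at the two
vectors. The half with the weight on the second factor contains the odd theta constant and vanishes;
the factor 2 undoes the averaging. -/
theorem grad_mul_theta {p : ℂ → ℂ → ℂ} (hp : OddW p) {m₁ m₂ k₁ k₂ k₁' k₂' : ℤ}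
    (h : Odd (m₁ * k₁ + m₂ * k₂)) {w : ℂ × ℂ × ℂ} (hw : w ∈ UHS) :
    wTheta p m₁ m₂ k₁ k₂ w * wTheta (fun _ _ => 1) m₁ m₂ k₁' k₂' w
    = 2 * ∑ s : Fin 2 × Fin 2,
      wTheta p (((s.1 : ℕ) : ℤ) + m₁) (((s.2 : ℕ) : ℤ) + m₂) (k₁ + k₁') (k₂ + k₂')
        ((2 : ℂ) • w)
      * wTheta (fun _ _ => 1) ((s.1 : ℕ) : ℤ) ((s.2 : ℕ) : ℤ) (k₁ - k₁') (k₂ - k₂') ((2 : ℂ) • w)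
      := by
  rw [← duplication hp.mild m₁ m₂ k₁ k₂ k₁' k₂' hw]
  have e1 := tsum_mul_tsum_of_summable_norm (summable_wTheta hp.mild m₁ m₂ k₁ k₂ hw).norm
    (summable_thTerm m₁ m₂ k₁' k₂' hw).norm
  have e2 := tsum_mul_tsum_of_summable_norm (summable_thTerm m₁ m₂ k₁ k₂ hw).norm
    (summable_wTheta hp.mild m₁ m₂ k₁' k₂' hw).norm
  have s1 := summable_mul_of_summable_norm (summable_wTheta hp.mild m₁ m₂ k₁ k₂ hw).norm
    (summable_thTerm m₁ m₂ k₁' k₂' hw).norm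
  have s2 := summable_mul_of_summable_norm (summable_thTerm m₁ m₂ k₁ k₂ hw).norm
    (summable_wTheta hp.mild m₁ m₂ k₁' k₂' hw).norm
  have h0 := wTheta_one_eq_zero h w
  simp only [wTheta, one_mul] at h0 ⊢
  rw [h0, zero_mul] at e2
  rw [e1, ← add_zero (tsum _), e2, ← s1.tsum_add s2, ← tsum_mul_left]
  refine tsum_congr fun x => ?_
  rw [hp.mid]
  ring

/-! ### Duplication of the theta constants and of the gradients -/

/-- The theta constants in coordinates. -/
noncomputable def tc (k : ℕ) (w : ℂ × ℂ × ℂ) : ℂ :=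
  wTheta (fun _ _ => 1) (evenChar k 0) (evenChar k 1) (evenChar k 2) (evenChar k 3) w

/-- The components of the gradients in coordinates, up to the factor `2πi`. -/
noncomputable def gc (p : ℂ → ℂ → ℂ) (i : ℕ) (w : ℂ × ℂ × ℂ) : ℂ :=
  wTheta p (oddChar i 0) (oddChar i 1) (oddChar i 2) (oddChar i 3) w

theorem vt_symMat (k : ℕ) (w : ℂ × ℂ × ℂ) : vt k (symMat w) = tc k w := theta_zero _ _

/-! ### Normal forms of characteristics -/

section Normalize

variable (p : ℂ → ℂ → ℂ) (a b c d : ℤ) (w : ℂ × ℂ × ℂ)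

-- The duplication formulas produce characteristic entries 2 and -1; these rules bring them back to
-- 0 and 1, recording the signs.
@[simp] theorem wTheta_two₁ : wTheta p 2 b c d w = wTheta p 0 b c d w := wTheta_m₁ p 0 b c d 1 w

@[simp] theorem wTheta_two₂ : wTheta p a 2 c d w = wTheta p a 0 c d w := wTheta_m₂ p a 0 c d 1 w

@[simp] theorem wTheta_two₃ : wTheta p a b 2 d w = (-1) ^ a * wTheta p a b 0 d w := by
  simpa using wTheta_k p a b 0 d 1 0 w

@[simp] theorem wTheta_two₄ : wTheta p a b c 2 w = (-1) ^ b * wTheta p a b c 0 w := by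
  simpa using wTheta_k p a b c 0 0 1 w

@[simp] theorem wTheta_neg_one₃ : wTheta p a b (-1) d w = (-1) ^ a * wTheta p a b 1 d w := by
  have h := wTheta_k p a b (-1) d 1 0 w
  have e : ((-1 : ℂ) ^ a) * (-1) ^ a = 1 := by rw [← zpow_add₀ (by norm_num)]; exact Even.neg_one_zpow ⟨a, rfl⟩
  simp only [mul_one, mul_zero, add_zero] at h
  rw [show (-1 + 2 : ℤ) = 1 by norm_num] at h
  rw [h, ← mul_assoc, e, one_mul]

@[simp] theorem wTheta_neg_one₄ : wTheta p a b c (-1) w = (-1) ^ b * wTheta p a b c 1 w := by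
  have h := wTheta_k p a b c (-1) 0 1 w
  have e : ((-1 : ℂ) ^ b) * (-1) ^ b = 1 := by rw [← zpow_add₀ (by norm_num)]; exact Even.neg_one_zpow ⟨b, rfl⟩
  simp only [mul_one, mul_zero, zero_add, add_zero] at h
  rw [show (-1 + 2 : ℤ) = 1 by norm_num] at h
  rw [h, ← mul_assoc, e, one_mul]

end Normalize

@[simp] theorem wTheta_one_0101 (w : ℂ × ℂ × ℂ) : wTheta (fun _ _ => 1) 0 1 0 1 w = 0 :=
  wTheta_one_eq_zero (by decide) w

@[simp] theorem wTheta_one_0111 (w : ℂ × ℂ × ℂ) : wTheta (fun _ _ => 1) 0 1 1 1 w = 0 :=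
  wTheta_one_eq_zero (by decide) w

@[simp] theorem wTheta_one_1010 (w : ℂ × ℂ × ℂ) : wTheta (fun _ _ => 1) 1 0 1 0 w = 0 :=
  wTheta_one_eq_zero (by decide) w

@[simp] theorem wTheta_one_1011 (w : ℂ × ℂ × ℂ) : wTheta (fun _ _ => 1) 1 0 1 1 w = 0 :=
  wTheta_one_eq_zero (by decide) w

@[simp] theorem wTheta_one_1101 (w : ℂ × ℂ × ℂ) : wTheta (fun _ _ => 1) 1 1 0 1 w = 0 :=
  wTheta_one_eq_zero (by decide) w

@[simp] theorem wTheta_one_1110 (w : ℂ × ℂ × ℂ) : wTheta (fun _ _ => 1) 1 1 1 0 w = 0 :=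
  wTheta_one_eq_zero (by decide) w

/-- This and the following formulas are instances of `grad_mul_theta`. Since the two characteristics
differ in ν, two of the four parity classes give an odd theta constant and drop out. -/
theorem gc_1_mul_tc_5 {p : ℂ → ℂ → ℂ} (hp : OddW p) {w : ℂ × ℂ × ℂ} (hw : w ∈ UHS) :
    gc p 1 w * tc 5 w = 2 * (gc p 1 ((2 : ℂ) • w) * tc 2 ((2 : ℂ) • w) + gc p 5 ((2 : ℂ) • w) * tc 8 ((2 : ℂ) • w)) := by
  have h := grad_mul_theta hp (m₁ := 0) (m₂ := 1) (k₁ := 0) (k₂ := 1) (k₁' := 0) (k₂' := 0)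
    (by decide) hw
  simp [Fintype.sum_prod_type] at h
  simp only [tc, gc, evenChar, oddChar, Matrix.cons_val]
  linear_combination h

theorem gc_1_mul_tc_6 {p : ℂ → ℂ → ℂ} (hp : OddW p) {w : ℂ × ℂ × ℂ} (hw : w ∈ UHS) :
    gc p 1 w * tc 6 w = 2 * (gc p 2 ((2 : ℂ) • w) * tc 4 ((2 : ℂ) • w) - gc p 4 ((2 : ℂ) • w) * tc 10 ((2 : ℂ) • w)) := by
  have h := grad_mul_theta hp (m₁ := 0) (m₂ := 1) (k₁ := 0) (k₂ := 1) (k₁' := 1) (k₂' := 0)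
    (by decide) hw
  simp [Fintype.sum_prod_type] at h
  simp only [tc, gc, evenChar, oddChar, Matrix.cons_val]
  linear_combination h

theorem gc_2_mul_tc_5 {p : ℂ → ℂ → ℂ} (hp : OddW p) {w : ℂ × ℂ × ℂ} (hw : w ∈ UHS) :
    gc p 2 w * tc 5 w = 2 * (gc p 2 ((2 : ℂ) • w) * tc 4 ((2 : ℂ) • w) + gc p 4 ((2 : ℂ) • w) * tc 10 ((2 : ℂ) • w)) := by
  have h := grad_mul_theta hp (m₁ := 0) (m₂ := 1) (k₁ := 1) (k₂ := 1) (k₁' := 0) (k₂' := 0)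
    (by decide) hw
  simp [Fintype.sum_prod_type] at h
  simp only [tc, gc, evenChar, oddChar, Matrix.cons_val]
  linear_combination h

theorem gc_2_mul_tc_6 {p : ℂ → ℂ → ℂ} (hp : OddW p) {w : ℂ × ℂ × ℂ} (hw : w ∈ UHS) :
    gc p 2 w * tc 6 w = 2 * (gc p 1 ((2 : ℂ) • w) * tc 2 ((2 : ℂ) • w) - gc p 5 ((2 : ℂ) • w) * tc 8 ((2 : ℂ) • w)) := by
  have h := grad_mul_theta hp (m₁ := 0) (m₂ := 1) (k₁ := 1) (k₂ := 1) (k₁' := 1) (k₂' := 0)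
    (by decide) hw
  simp [Fintype.sum_prod_type] at h
  simp only [tc, gc, evenChar, oddChar, Matrix.cons_val]
  linear_combination h

theorem gc_3_mul_tc_7 {p : ℂ → ℂ → ℂ} (hp : OddW p) {w : ℂ × ℂ × ℂ} (hw : w ∈ UHS) :
    gc p 3 w * tc 7 w = 2 * (gc p 3 ((2 : ℂ) • w) * tc 3 ((2 : ℂ) • w) + gc p 6 ((2 : ℂ) • w) * tc 6 ((2 : ℂ) • w)) := by
  have h := grad_mul_theta hp (m₁ := 1) (m₂ := 0) (k₁ := 1) (k₂ := 0) (k₁' := 0) (k₂' := 0)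
    (by decide) hw
  simp [Fintype.sum_prod_type] at h
  simp only [tc, gc, evenChar, oddChar, Matrix.cons_val]
  linear_combination h

theorem gc_3_mul_tc_8 {p : ℂ → ℂ → ℂ} (hp : OddW p) {w : ℂ × ℂ × ℂ} (hw : w ∈ UHS) :
    gc p 3 w * tc 8 w = 2 * (gc p 4 ((2 : ℂ) • w) * tc 4 ((2 : ℂ) • w) - gc p 2 ((2 : ℂ) • w) * tc 10 ((2 : ℂ) • w)) := by
  have h := grad_mul_theta hp (m₁ := 1) (m₂ := 0) (k₁ := 1) (k₂ := 0) (k₁' := 0) (k₂' := 1)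
    (by decide) hw
  simp [Fintype.sum_prod_type] at h
  simp only [tc, gc, evenChar, oddChar, Matrix.cons_val]
  linear_combination h

theorem gc_4_mul_tc_7 {p : ℂ → ℂ → ℂ} (hp : OddW p) {w : ℂ × ℂ × ℂ} (hw : w ∈ UHS) :
    gc p 4 w * tc 7 w = 2 * (gc p 4 ((2 : ℂ) • w) * tc 4 ((2 : ℂ) • w) + gc p 2 ((2 : ℂ) • w) * tc 10 ((2 : ℂ) • w)) := by
  have h := grad_mul_theta hp (m₁ := 1) (m₂ := 0) (k₁ := 1) (k₂ := 1) (k₁' := 0) (k₂' := 0)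
    (by decide) hw
  simp [Fintype.sum_prod_type] at h
  simp only [tc, gc, evenChar, oddChar, Matrix.cons_val]
  linear_combination h

theorem gc_4_mul_tc_8 {p : ℂ → ℂ → ℂ} (hp : OddW p) {w : ℂ × ℂ × ℂ} (hw : w ∈ UHS) :
    gc p 4 w * tc 8 w = 2 * (gc p 3 ((2 : ℂ) • w) * tc 3 ((2 : ℂ) • w) - gc p 6 ((2 : ℂ) • w) * tc 6 ((2 : ℂ) • w)) := by
  have h := grad_mul_theta hp (m₁ := 1) (m₂ := 0) (k₁ := 1) (k₂ := 1) (k₁' := 0) (k₂' := 1)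
    (by decide) hw
  simp [Fintype.sum_prod_type] at h
  simp only [tc, gc, evenChar, oddChar, Matrix.cons_val]
  linear_combination h

theorem gc_5_mul_tc_9 {p : ℂ → ℂ → ℂ} (hp : OddW p) {w : ℂ × ℂ × ℂ} (hw : w ∈ UHS) :
    gc p 5 w * tc 9 w = 2 * (gc p 5 ((2 : ℂ) • w) * tc 2 ((2 : ℂ) • w) + gc p 1 ((2 : ℂ) • w) * tc 8 ((2 : ℂ) • w)) := by
  have h := grad_mul_theta hp (m₁ := 1) (m₂ := 1) (k₁ := 0) (k₂ := 1) (k₁' := 0) (k₂' := 0)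
    (by decide) hw
  simp [Fintype.sum_prod_type] at h
  simp only [tc, gc, evenChar, oddChar, Matrix.cons_val]
  linear_combination h

theorem gc_5_mul_tc_10 {p : ℂ → ℂ → ℂ} (hp : OddW p) {w : ℂ × ℂ × ℂ} (hw : w ∈ UHS) :
    gc p 5 w * tc 10 w = 2 * (- gc p 6 ((2 : ℂ) • w) * tc 3 ((2 : ℂ) • w) + gc p 3 ((2 : ℂ) • w) * tc 6 ((2 : ℂ) • w)) := by
  have h := grad_mul_theta hp (m₁ := 1) (m₂ := 1) (k₁ := 0) (k₂ := 1) (k₁' := 1) (k₂' := 1)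
    (by decide) hw
  simp [Fintype.sum_prod_type] at h
  simp only [tc, gc, evenChar, oddChar, Matrix.cons_val]
  linear_combination h

theorem gc_6_mul_tc_9 {p : ℂ → ℂ → ℂ} (hp : OddW p) {w : ℂ × ℂ × ℂ} (hw : w ∈ UHS) :
    gc p 6 w * tc 9 w = 2 * (gc p 6 ((2 : ℂ) • w) * tc 3 ((2 : ℂ) • w) + gc p 3 ((2 : ℂ) • w) * tc 6 ((2 : ℂ) • w)) := by
  have h := grad_mul_theta hp (m₁ := 1) (m₂ := 1) (k₁ := 1) (k₂ := 0) (k₁' := 0) (k₂' := 0)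
    (by decide) hw
  simp [Fintype.sum_prod_type] at h
  simp only [tc, gc, evenChar, oddChar, Matrix.cons_val]
  linear_combination h

theorem gc_6_mul_tc_10 {p : ℂ → ℂ → ℂ} (hp : OddW p) {w : ℂ × ℂ × ℂ} (hw : w ∈ UHS) :
    gc p 6 w * tc 10 w = 2 * (- gc p 5 ((2 : ℂ) • w) * tc 2 ((2 : ℂ) • w) + gc p 1 ((2 : ℂ) • w) * tc 8 ((2 : ℂ) • w)) := by
  have h := grad_mul_theta hp (m₁ := 1) (m₂ := 1) (k₁ := 1) (k₂ := 0) (k₁' := 1) (k₂' := 1)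
    (by decide) hw
  simp [Fintype.sum_prod_type] at h
  simp only [tc, gc, evenChar, oddChar, Matrix.cons_val]
  linear_combination h

/-! ### Duplication of products of theta constants -/

/-- The squares become quadratic forms in the four constants with ν = 0 at 2τ, namely those of index
1, 5, 7, 9. Relations between squares can thus be checked as polynomial identities in four
variables. -/
theorem tc_1_mul_tc_1 {w : ℂ × ℂ × ℂ} (hw : w ∈ UHS) :
    tc 1 w * tc 1 w = tc 1 ((2 : ℂ) • w) * tc 1 ((2 : ℂ) • w) + tc 5 ((2 : ℂ) • w) * tc 5 ((2 : ℂ) • w) + tc 7 ((2 : ℂ) • w) * tc 7 ((2 : ℂ) • w) + tc 9 ((2 : ℂ) • w) * tc 9 ((2 : ℂ) • w) := by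
  have h := theta_mul_theta 0 0 0 0 0 0 hw
  simp [Fintype.sum_prod_type] at h
  simp only [tc, evenChar, Matrix.cons_val]
  linear_combination h

theorem tc_2_mul_tc_2 {w : ℂ × ℂ × ℂ} (hw : w ∈ UHS) :
    tc 2 w * tc 2 w = tc 1 ((2 : ℂ) • w) * tc 1 ((2 : ℂ) • w) - tc 5 ((2 : ℂ) • w) * tc 5 ((2 : ℂ) • w) + tc 7 ((2 : ℂ) • w) * tc 7 ((2 : ℂ) • w) - tc 9 ((2 : ℂ) • w) * tc 9 ((2 : ℂ) • w) := by
  have h := theta_mul_theta 0 0 0 1 0 1 hw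
  simp [Fintype.sum_prod_type] at h
  simp only [tc, evenChar, Matrix.cons_val]
  linear_combination h

theorem tc_3_mul_tc_3 {w : ℂ × ℂ × ℂ} (hw : w ∈ UHS) :
    tc 3 w * tc 3 w = tc 1 ((2 : ℂ) • w) * tc 1 ((2 : ℂ) • w) + tc 5 ((2 : ℂ) • w) * tc 5 ((2 : ℂ) • w) - tc 7 ((2 : ℂ) • w) * tc 7 ((2 : ℂ) • w) - tc 9 ((2 : ℂ) • w) * tc 9 ((2 : ℂ) • w) := by
  have h := theta_mul_theta 0 0 1 0 1 0 hw
  simp [Fintype.sum_prod_type] at h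
  simp only [tc, evenChar, Matrix.cons_val]
  linear_combination h

theorem tc_5_mul_tc_5 {w : ℂ × ℂ × ℂ} (hw : w ∈ UHS) :
    tc 5 w * tc 5 w = tc 5 ((2 : ℂ) • w) * tc 1 ((2 : ℂ) • w) + tc 1 ((2 : ℂ) • w) * tc 5 ((2 : ℂ) • w) + tc 9 ((2 : ℂ) • w) * tc 7 ((2 : ℂ) • w) + tc 7 ((2 : ℂ) • w) * tc 9 ((2 : ℂ) • w) := by
  have h := theta_mul_theta 0 1 0 0 0 0 hw
  simp [Fintype.sum_prod_type] at h
  simp only [tc, evenChar, Matrix.cons_val]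
  linear_combination h

theorem tc_6_mul_tc_6 {w : ℂ × ℂ × ℂ} (hw : w ∈ UHS) :
    tc 6 w * tc 6 w = tc 5 ((2 : ℂ) • w) * tc 1 ((2 : ℂ) • w) + tc 1 ((2 : ℂ) • w) * tc 5 ((2 : ℂ) • w) - tc 9 ((2 : ℂ) • w) * tc 7 ((2 : ℂ) • w) - tc 7 ((2 : ℂ) • w) * tc 9 ((2 : ℂ) • w) := by
  have h := theta_mul_theta 0 1 1 0 1 0 hw
  simp [Fintype.sum_prod_type] at h
  simp only [tc, evenChar, Matrix.cons_val]
  linear_combination h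

theorem tc_7_mul_tc_7 {w : ℂ × ℂ × ℂ} (hw : w ∈ UHS) :
    tc 7 w * tc 7 w = tc 7 ((2 : ℂ) • w) * tc 1 ((2 : ℂ) • w) + tc 9 ((2 : ℂ) • w) * tc 5 ((2 : ℂ) • w) + tc 1 ((2 : ℂ) • w) * tc 7 ((2 : ℂ) • w) + tc 5 ((2 : ℂ) • w) * tc 9 ((2 : ℂ) • w) := by
  have h := theta_mul_theta 1 0 0 0 0 0 hw
  simp [Fintype.sum_prod_type] at h
  simp only [tc, evenChar, Matrix.cons_val]
  linear_combination h

theorem tc_8_mul_tc_8 {w : ℂ × ℂ × ℂ} (hw : w ∈ UHS) :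
    tc 8 w * tc 8 w = tc 7 ((2 : ℂ) • w) * tc 1 ((2 : ℂ) • w) - tc 9 ((2 : ℂ) • w) * tc 5 ((2 : ℂ) • w) + tc 1 ((2 : ℂ) • w) * tc 7 ((2 : ℂ) • w) - tc 5 ((2 : ℂ) • w) * tc 9 ((2 : ℂ) • w) := by
  have h := theta_mul_theta 1 0 0 1 0 1 hw
  simp [Fintype.sum_prod_type] at h
  simp only [tc, evenChar, Matrix.cons_val]
  linear_combination h

theorem tc_9_mul_tc_9 {w : ℂ × ℂ × ℂ} (hw : w ∈ UHS) :
    tc 9 w * tc 9 w = tc 9 ((2 : ℂ) • w) * tc 1 ((2 : ℂ) • w) + tc 7 ((2 : ℂ) • w) * tc 5 ((2 : ℂ) • w) + tc 5 ((2 : ℂ) • w) * tc 7 ((2 : ℂ) • w) + tc 1 ((2 : ℂ) • w) * tc 9 ((2 : ℂ) • w) := by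
  have h := theta_mul_theta 1 1 0 0 0 0 hw
  simp [Fintype.sum_prod_type] at h
  simp only [tc, evenChar, Matrix.cons_val]
  linear_combination h

theorem tc_10_mul_tc_10 {w : ℂ × ℂ × ℂ} (hw : w ∈ UHS) :
    tc 10 w * tc 10 w = tc 9 ((2 : ℂ) • w) * tc 1 ((2 : ℂ) • w) - tc 7 ((2 : ℂ) • w) * tc 5 ((2 : ℂ) • w) - tc 5 ((2 : ℂ) • w) * tc 7 ((2 : ℂ) • w) + tc 1 ((2 : ℂ) • w) * tc 9 ((2 : ℂ) • w) := by
  have h := theta_mul_theta 1 1 1 1 1 1 hw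
  simp [Fintype.sum_prod_type] at h
  simp only [tc, evenChar, Matrix.cons_val]
  linear_combination h

/-- For two different characteristics with the same μ, only two parity classes survive. -/
theorem tc_1_mul_tc_3 {w : ℂ × ℂ × ℂ} (hw : w ∈ UHS) :
    tc 1 w * tc 3 w = tc 3 ((2 : ℂ) • w) * tc 3 ((2 : ℂ) • w) + tc 6 ((2 : ℂ) • w) * tc 6 ((2 : ℂ) • w) := by
  have h := theta_mul_theta 0 0 0 0 1 0 hw
  simp [Fintype.sum_prod_type] at h
  simp only [tc, evenChar, Matrix.cons_val]
  linear_combination h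

theorem tc_1_mul_tc_4 {w : ℂ × ℂ × ℂ} (hw : w ∈ UHS) :
    tc 1 w * tc 4 w = tc 4 ((2 : ℂ) • w) * tc 4 ((2 : ℂ) • w) + tc 10 ((2 : ℂ) • w) * tc 10 ((2 : ℂ) • w) := by
  have h := theta_mul_theta 0 0 0 0 1 1 hw
  simp [Fintype.sum_prod_type] at h
  simp only [tc, evenChar, Matrix.cons_val]
  linear_combination h

theorem tc_3_mul_tc_4 {w : ℂ × ℂ × ℂ} (hw : w ∈ UHS) :
    tc 3 w * tc 4 w = tc 2 ((2 : ℂ) • w) * tc 2 ((2 : ℂ) • w) - tc 8 ((2 : ℂ) • w) * tc 8 ((2 : ℂ) • w) := by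
  have h := theta_mul_theta 0 0 1 0 1 1 hw
  simp [Fintype.sum_prod_type] at h
  simp only [tc, evenChar, Matrix.cons_val]
  linear_combination h

theorem tc_5_mul_tc_6 {w : ℂ × ℂ × ℂ} (hw : w ∈ UHS) :
    tc 5 w * tc 6 w = tc 6 ((2 : ℂ) • w) * tc 3 ((2 : ℂ) • w) + tc 3 ((2 : ℂ) • w) * tc 6 ((2 : ℂ) • w) := by
  have h := theta_mul_theta 0 1 0 0 1 0 hw
  simp [Fintype.sum_prod_type] at h
  simp only [tc, evenChar, Matrix.cons_val]
  linear_combination h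

theorem tc_9_mul_tc_10 {w : ℂ × ℂ × ℂ} (hw : w ∈ UHS) :
    tc 9 w * tc 10 w = tc 10 ((2 : ℂ) • w) * tc 4 ((2 : ℂ) • w) + tc 4 ((2 : ℂ) • w) * tc 10 ((2 : ℂ) • w) := by
  have h := theta_mul_theta 1 1 0 0 1 1 hw
  simp [Fintype.sum_prod_type] at h
  simp only [tc, evenChar, Matrix.cons_val]
  linear_combination h

theorem tc_2_mul_tc_3 {w : ℂ × ℂ × ℂ} (hw : w ∈ UHS) :
    tc 2 w * tc 3 w = tc 4 ((2 : ℂ) • w) * tc 4 ((2 : ℂ) • w) - tc 10 ((2 : ℂ) • w) * tc 10 ((2 : ℂ) • w) := by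
  have h := theta_mul_theta 0 0 0 1 1 0 hw
  simp [Fintype.sum_prod_type] at h
  simp only [tc, evenChar, Matrix.cons_val]
  linear_combination h

theorem tc_7_mul_tc_8 {w : ℂ × ℂ × ℂ} (hw : w ∈ UHS) :
    tc 7 w * tc 8 w = tc 8 ((2 : ℂ) • w) * tc 2 ((2 : ℂ) • w) + tc 2 ((2 : ℂ) • w) * tc 8 ((2 : ℂ) • w) := by
  have h := theta_mul_theta 1 0 0 0 0 1 hw
  simp [Fintype.sum_prod_type] at h
  simp only [tc, evenChar, Matrix.cons_val]
  linear_combination h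

theorem tc_2_mul_tc_4 {w : ℂ × ℂ × ℂ} (hw : w ∈ UHS) :
    tc 2 w * tc 4 w = tc 3 ((2 : ℂ) • w) * tc 3 ((2 : ℂ) • w) - tc 6 ((2 : ℂ) • w) * tc 6 ((2 : ℂ) • w) := by
  have h := theta_mul_theta 0 0 0 1 1 1 hw
  simp [Fintype.sum_prod_type] at h
  simp only [tc, evenChar, Matrix.cons_val]
  linear_combination h

/-! ### The identity theorem on the upper half space -/

/-- The complex line meets the upper half space in a convex, hence connected, open set of
parameters, so the identity theorem in one variable applies. -/
theorem eq_zero_of_line {f : ℂ × ℂ × ℂ → ℂ} (hf : DifferentiableOn ℂ f UHS) (u v : ℂ × ℂ × ℂ)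
    {s₀ s₁ : ℂ} (h₀ : u + s₀ • v ∈ UHS) (h₁ : u + s₁ • v ∈ UHS)
    (h : ∃ᶠ s in 𝓝[≠] s₀, f (u + s • v) = 0) : f (u + s₁ • v) = 0 := by
  set S : Set ℂ := (fun s : ℂ => u + s • v) ⁻¹' UHS with hS
  have hopen : IsOpen S := isOpen_UHS.preimage (by fun_prop)
  have hconv : Convex ℝ S := by
    intro a ha b hb x y hx hy hxy
    have := convex_UHS ha hb hx hy hxy
    have e : x • (u + a • v) + y • (u + b • v) = u + (x • a + y • b) • v := by
      rw [smul_add, smul_add, add_add_add_comm, ← add_smul, hxy, one_smul, add_smul, smul_assoc,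
        smul_assoc]
    show _ ∈ UHS
    simpa only [e] using this
  have hd : DifferentiableOn ℂ (fun s : ℂ => f (u + s • v)) S :=
    hf.comp (by fun_prop) fun s hs => hs
  have := (hd.analyticOnNhd hopen).eqOn_of_preconnected_of_frequently_eq
    (analyticOnNhd_const (v := (0 : ℂ))) hconv.isPreconnected h₀ h
  exact this h₁

theorem eq_zero_of_eventually {f : ℂ × ℂ × ℂ → ℂ} (hf : DifferentiableOn ℂ f UHS) {w₀ w : ℂ × ℂ × ℂ}
    (h₀ : w₀ ∈ UHS) (hw : w ∈ UHS) (h : ∀ᶠ x in 𝓝 w₀, f x = 0) : f w = 0 := by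
  have hc : Tendsto (fun s : ℂ => w₀ + s • (w - w₀)) (𝓝 0) (𝓝 w₀) := by
    have : Continuous fun s : ℂ => w₀ + s • (w - w₀) := by fun_prop
    simpa using this.tendsto 0
  have := eq_zero_of_line hf w₀ (w - w₀) (s₀ := 0) (s₁ := 1) (by simpa using h₀) (by simpa using hw)
    ((hc.eventually h).filter_mono nhdsWithin_le_nhds).frequently
  simpa using this

/-- Near a point where g does not vanish f is zero, and this spreads to the whole domain. It allows
cancellation of a holomorphic factor that is not identically zero. -/
theorem eq_zero_of_mul_eq_zero {f g : ℂ × ℂ × ℂ → ℂ} (hf : DifferentiableOn ℂ f UHS)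
    (hg : DifferentiableOn ℂ g UHS) {w₀ : ℂ × ℂ × ℂ} (h₀ : w₀ ∈ UHS) (hg₀ : g w₀ ≠ 0)
    (h : ∀ w ∈ UHS, f w * g w = 0) {w : ℂ × ℂ × ℂ} (hw : w ∈ UHS) : f w = 0 := by
  refine eq_zero_of_eventually hf h₀ hw ?_
  have hn := isOpen_UHS.mem_nhds h₀
  filter_upwards [hn, (hg.continuousOn.continuousAt hn).eventually_ne hg₀] with x hx hgx
  exact (mul_eq_zero.1 (h x hx)).resolve_right hgx

/-! ### Asymptotics of theta series -/

/-- The quadratic form `τ[v]`. -/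
noncomputable def qForm (w : ℂ × ℂ × ℂ) (x y : ℝ) : ℂ :=
  w.1 * x ^ 2 + 2 * w.2.1 * x * y + w.2.2 * y ^ 2

theorem qForm_im (w : ℂ × ℂ × ℂ) (x y : ℝ) : (qForm w x y).im = imForm w x y := by
  simp [qForm, imForm, pow_two]

/-- After division by the leading exponential each term is constant in t on F and decays
exponentially off F. The absolute values at t = 1 serve as a dominating series. -/
theorem tendsto_wTheta {p : ℂ → ℂ → ℂ} (hp : Mild p) (m₁ m₂ k₁ k₂ : ℤ) {w : ℂ × ℂ × ℂ}
    (hw : w ∈ UHS) (x₀ y₀ : ℝ) (F : Finset (ℤ × ℤ))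
    (hF : ∀ n ∈ F, qForm w ((n.1 : ℝ) + m₁ / 2) ((n.2 : ℝ) + m₂ / 2) = qForm w x₀ y₀)
    (hF' : ∀ n ∉ F, imForm w x₀ y₀ < imForm w ((n.1 : ℝ) + m₁ / 2) ((n.2 : ℝ) + m₂ / 2)) :
    Tendsto (fun t : ℝ => Complex.exp (-(Real.pi * Complex.I * t * qForm w x₀ y₀))
      * wTheta p m₁ m₂ k₁ k₂ ((t : ℂ) • w)) atTop
      (𝓝 (∑ n ∈ F, p ((n.1 : ℂ) + m₁ / 2) ((n.2 : ℂ) + m₂ / 2) * Complex.exp (Real.pi * Complex.I *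
        (((n.1 : ℂ) + m₁ / 2) * k₁ + ((n.2 : ℂ) + m₂ / 2) * k₂)))) := by
  set P : ℤ × ℤ → ℂ := fun n => p ((n.1 : ℂ) + m₁ / 2) ((n.2 : ℂ) + m₂ / 2) with hP
  set K : ℤ × ℤ → ℂ := fun n => Complex.exp (Real.pi * Complex.I *
        (((n.1 : ℂ) + m₁ / 2) * k₁ + ((n.2 : ℂ) + m₂ / 2) * k₂)) with hK
  set dq : ℤ × ℤ → ℂ := fun n =>
    qForm w ((n.1 : ℝ) + m₁ / 2) ((n.2 : ℝ) + m₂ / 2) - qForm w x₀ y₀ with hdq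
  have hdim : ∀ n, (dq n).im
      = imForm w ((n.1 : ℝ) + m₁ / 2) ((n.2 : ℝ) + m₂ / 2) - imForm w x₀ y₀ := by
    intro n; simp only [hdq, Complex.sub_im, qForm_im]
  have hterm : ∀ (t : ℝ) n, Complex.exp (-(Real.pi * Complex.I * t * qForm w x₀ y₀)) *
      (P n * thTerm m₁ m₂ k₁ k₂ ((t : ℂ) • w) n)
      = P n * (K n * Complex.exp (Real.pi * Complex.I * (t * dq n))) := by
    intro t n
    rw [mul_left_comm, thTerm, ← Complex.exp_add, ← Complex.exp_add]
    congr 2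
    simp [hdq, qForm]
    ring
  have hnK : ∀ n, ‖K n‖ = 1 := by
    intro n
    have : K n = Complex.exp (((Real.pi * (((n.1 : ℝ) + m₁ / 2) * k₁ + ((n.2 : ℝ) + m₂ / 2) * k₂)
      : ℝ) : ℂ) * Complex.I) := by
      simp only [hK]; congr 1; push_cast; ring
    rw [this, Complex.norm_exp_ofReal_mul_I]
  have hnE : ∀ (t : ℝ) n, ‖Complex.exp (Real.pi * Complex.I * (t * dq n))‖
      = Real.exp (-(Real.pi * (t * (dq n).im))) := by
    intro t n
    rw [Complex.norm_exp]
    congr 1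
    simp [Complex.mul_re, Complex.mul_im]
  have hsum : ∑ n ∈ F, P n * K n = ∑' n, if n ∈ F then P n * K n else 0 := by
    rw [tsum_eq_sum (s := F) fun n hn => by simp [hn]]
    exact Finset.sum_congr rfl fun n hn => by simp [hn]
  rw [hsum]
  have hfun : ∀ t : ℝ, Complex.exp (-(Real.pi * Complex.I * t * qForm w x₀ y₀))
      * wTheta p m₁ m₂ k₁ k₂ ((t : ℂ) • w)
      = ∑' n, P n * (K n * Complex.exp (Real.pi * Complex.I * (t * dq n))) := by
    intro t
    rw [wTheta, ← tsum_mul_left]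
    exact tsum_congr (hterm t)
  simp only [hfun]
  have hdn : ∀ n, 0 ≤ (dq n).im := by
    intro n
    by_cases hn : n ∈ F
    · have : dq n = 0 := sub_eq_zero.2 (hF n hn)
      rw [this]; simp
    · rw [hdim]; exact (sub_pos.2 (hF' n hn)).le
  refine tendsto_tsum_of_dominated_convergence
    (bound := fun n => ‖P n * (K n * Complex.exp (Real.pi * Complex.I * ((1 : ℝ) * dq n)))‖) ?_ ?_ ?_
  · have := ((summable_wTheta hp m₁ m₂ k₁ k₂ hw).mul_left
      (Complex.exp (-(Real.pi * Complex.I * (1 : ℝ) * qForm w x₀ y₀)))).norm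
    refine this.congr fun n => ?_
    rw [← hterm 1 n]; simp [hP]
  · intro n
    by_cases hn : n ∈ F
    · have : dq n = 0 := sub_eq_zero.2 (hF n hn)
      simp [hn, this]
    · simp only [hn, if_false]
      rw [tendsto_zero_iff_norm_tendsto_zero]
      simp only [norm_mul, hnK, hnE, one_mul]
      rw [← mul_zero ‖P n‖]
      refine Tendsto.const_mul _ (Real.tendsto_exp_neg_atTop_nhds_zero.comp ?_)
      refine Tendsto.const_mul_atTop Real.pi_pos (Tendsto.atTop_mul_const ?_ tendsto_id)
      rw [hdim]; exact sub_pos.2 (hF' n hn)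
  · filter_upwards [eventually_ge_atTop 1] with t ht n
    simp only [norm_mul, hnK, hnE]
    gcongr
    exact hdn n

/-- A region where the leading terms of the theta series are isolated. -/
def baseRegion : Set (ℂ × ℂ × ℂ) :=
  {w | w ∈ UHS ∧ 0 < w.2.1.im ∧ 4 * w.2.1.im < w.1.im ∧ 4 * w.2.1.im < w.2.2.im}

theorem isOpen_baseRegion : IsOpen baseRegion := by
  have h1 : IsOpen {w : ℂ × ℂ × ℂ | 0 < w.2.1.im} := isOpen_lt continuous_const (by fun_prop)
  have h2 : IsOpen {w : ℂ × ℂ × ℂ | 4 * w.2.1.im < w.1.im} := isOpen_lt (by fun_prop) (by fun_prop)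
  have h3 : IsOpen {w : ℂ × ℂ × ℂ | 4 * w.2.1.im < w.2.2.im} :=
    isOpen_lt (by fun_prop) (by fun_prop)
  exact isOpen_UHS.inter (h1.inter (h2.inter h3))

theorem exists_mem_baseRegion : ∃ w, w ∈ baseRegion :=
  ⟨(5 * Complex.I, Complex.I, 5 * Complex.I), by
    simp [baseRegion, UHS]; norm_num⟩

/-- The inverse of the leading exponential. -/
noncomputable def lead (w : ℂ × ℂ × ℂ) (x y t : ℝ) : ℂ :=
  Complex.exp (-(Real.pi * Complex.I * t * qForm w x y))

theorem lead_ne_zero (w : ℂ × ℂ × ℂ) (x y t : ℝ) : lead w x y t ≠ 0 := Complex.exp_ne_zero _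

theorem tendsto_00 {p : ℂ → ℂ → ℂ} (hp : Mild p) (k₁ k₂ : ℤ) {w : ℂ × ℂ × ℂ} (hw : w ∈ baseRegion) :
    Tendsto (fun t : ℝ => lead w 0 0 t * wTheta p 0 0 k₁ k₂ ((t : ℂ) • w)) atTop (𝓝 (p 0 0)) := by
  have := tendsto_wTheta hp 0 0 k₁ k₂ hw.1 0 0 {(0, 0)} (by simp) (by
    rintro ⟨a, b⟩ hn
    have h0 : imForm w 0 0 = 0 := by simp [imForm]
    rw [h0]
    refine imForm_pos hw.1 ?_
    by_contra hc
    push Not at hc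
    apply hn
    simpa using hc)
  simpa [lead] using this

/-- The three quantities y₁₁ - 4y₁₂, y₂₂ - 4y₁₂ and y₁₂ are positive on `baseRegion`. A difference
of values of the form is written as a non-negative integral combination of them, so comparing terms
becomes integer arithmetic. -/
theorem imForm_lt_of_int {w : ℂ × ℂ × ℂ} (hw : w ∈ baseRegion) {x₀ y₀ x y : ℝ} {r s e : ℤ}
    (h : imForm w x y - imForm w x₀ y₀
      = ((w.1.im - 4 * w.2.1.im) * r + (w.2.2.im - 4 * w.2.1.im) * s + w.2.1.im * e) / 4)
    (hr : 0 ≤ r) (hs : 0 ≤ s) (he : 0 ≤ e) (hpos : 0 < r ∨ 0 < s ∨ 0 < e) :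
    imForm w x₀ y₀ < imForm w x y := by
  obtain ⟨-, h1, h2, h3⟩ := hw
  rw [← sub_pos, h]
  have hr' : (0 : ℝ) ≤ r := by exact_mod_cast hr
  have hs' : (0 : ℝ) ≤ s := by exact_mod_cast hs
  have he' : (0 : ℝ) ≤ e := by exact_mod_cast he
  have t1 := mul_nonneg (sub_pos.2 h2).le hr'
  have t2 := mul_nonneg (sub_pos.2 h3).le hs'
  have t3 := mul_nonneg h1.le he'
  rcases hpos with hp | hp | hp
  · have := mul_pos (sub_pos.2 h2) (show (0 : ℝ) < r by exact_mod_cast hp); linarith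
  · have := mul_pos (sub_pos.2 h3) (show (0 : ℝ) < s by exact_mod_cast hp); linarith
  · have := mul_pos h1 (show (0 : ℝ) < e by exact_mod_cast hp); linarith

theorem tendsto_10 {p : ℂ → ℂ → ℂ} (hp : Mild p) (k₁ k₂ : ℤ) {w : ℂ × ℂ × ℂ} (hw : w ∈ baseRegion) :
    Tendsto (fun t : ℝ => lead w 2⁻¹ 0 t * wTheta p 1 0 k₁ k₂ ((t : ℂ) • w)) atTop
      (𝓝 (p 2⁻¹ 0 * Complex.exp (Real.pi * Complex.I * (2⁻¹ * k₁))
        + p (-2⁻¹) 0 * Complex.exp (Real.pi * Complex.I * (-2⁻¹ * k₁)))) := by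
  have := tendsto_wTheta hp 1 0 k₁ k₂ hw.1 2⁻¹ 0 {(0, 0), (-1, 0)}
    (by simp [qForm]; norm_num) (by
    rintro ⟨a, b⟩ hn
    have hn' : ¬ ((a = 0 ∨ a = -1) ∧ b = 0) := by simpa [or_and_right] using hn
    have ha : 0 ≤ a * (a + 1) := by rcases le_or_gt 0 a with h | h <;> nlinarith
    -- The excess is y₁₁ a(a+1) + y₁₂ (2a+1)b + y₂₂ b². Rewriting y₁₁ and y₂₂ through y₁₁ - 4y₁₂ and
    -- y₂₂ - 4y₁₂ gives the coefficients.
    refine imForm_lt_of_int hw (r := 4 * (a * (a + 1))) (s := 4 * b ^ 2)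
      (e := 16 * (a * (a + 1)) + 16 * b ^ 2 + 4 * ((2 * a + 1) * b)) ?_ (by positivity)
      (by positivity) (by nlinarith [sq_nonneg (2 * a + 1 + b)]) ?_
    · simp [imForm]; ring
    · by_cases hb : b = 0
      · left
        have h1 : a ≠ 0 := by tauto
        have h2 : a + 1 ≠ 0 := fun h => hn' ⟨Or.inr (by omega), hb⟩
        have := mul_ne_zero h1 h2
        omega
      · right; left; positivity)
  rw [Finset.sum_pair (by simp)] at this
  have e : (-1 : ℂ) + 2⁻¹ = -2⁻¹ := by norm_num
  simpa [lead, e] using this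

theorem tendsto_01 {p : ℂ → ℂ → ℂ} (hp : Mild p) (k₁ k₂ : ℤ) {w : ℂ × ℂ × ℂ} (hw : w ∈ baseRegion) :
    Tendsto (fun t : ℝ => lead w 0 2⁻¹ t * wTheta p 0 1 k₁ k₂ ((t : ℂ) • w)) atTop
      (𝓝 (p 0 2⁻¹ * Complex.exp (Real.pi * Complex.I * (2⁻¹ * k₂))
        + p 0 (-2⁻¹) * Complex.exp (Real.pi * Complex.I * (-2⁻¹ * k₂)))) := by
  have := tendsto_wTheta hp 0 1 k₁ k₂ hw.1 0 2⁻¹ {(0, 0), (0, -1)}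
    (by simp [qForm]; norm_num) (by
    rintro ⟨a, b⟩ hn
    have hn' : ¬ (a = 0 ∧ (b = 0 ∨ b = -1)) := by simpa [and_or_left] using hn
    have ha : 0 ≤ b * (b + 1) := by rcases le_or_gt 0 b with h | h <;> nlinarith
    refine imForm_lt_of_int hw (r := 4 * a ^ 2) (s := 4 * (b * (b + 1)))
      (e := 16 * (b * (b + 1)) + 16 * a ^ 2 + 4 * ((2 * b + 1) * a)) ?_ (by positivity)
      (by positivity) (by nlinarith [sq_nonneg (2 * b + 1 + a)]) ?_
    · simp [imForm]; ring
    · by_cases hb : a = 0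
      · right; left
        have h1 : b ≠ 0 := by tauto
        have h2 : b + 1 ≠ 0 := fun h => hn' ⟨hb, Or.inr (by omega)⟩
        have := mul_ne_zero h1 h2
        omega
      · left; positivity)
  rw [Finset.sum_pair (by simp)] at this
  have e : (-1 : ℂ) + 2⁻¹ = -2⁻¹ := by norm_num
  simpa [lead, e] using this

/-- As y₁₂ > 0, the minimal vectors are ±(1/2, -1/2) and not ±(1/2, 1/2). -/
theorem tendsto_11 {p : ℂ → ℂ → ℂ} (hp : Mild p) (k₁ k₂ : ℤ) {w : ℂ × ℂ × ℂ} (hw : w ∈ baseRegion) :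
    Tendsto (fun t : ℝ => lead w 2⁻¹ (-2⁻¹) t * wTheta p 1 1 k₁ k₂ ((t : ℂ) • w)) atTop
      (𝓝 (p 2⁻¹ (-2⁻¹) * Complex.exp (Real.pi * Complex.I * (2⁻¹ * k₁ + -2⁻¹ * k₂))
        + p (-2⁻¹) 2⁻¹ * Complex.exp (Real.pi * Complex.I * (-2⁻¹ * k₁ + 2⁻¹ * k₂)))) := by
  have := tendsto_wTheta hp 1 1 k₁ k₂ hw.1 2⁻¹ (-2⁻¹) {(0, -1), (-1, 0)}
    (by simp [qForm]; norm_num) (by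
    rintro ⟨a, b⟩ hn
    have hn' : ¬ (a = 0 ∧ b = -1 ∨ a = -1 ∧ b = 0) := by simpa using hn
    have ha : 0 ≤ a * (a + 1) := by rcases le_or_gt 0 a with h | h <;> nlinarith
    have hb : 0 ≤ b * (b + 1) := by rcases le_or_gt 0 b with h | h <;> nlinarith
    refine imForm_lt_of_int hw (r := 4 * (a * (a + 1))) (s := 4 * (b * (b + 1)))
      (e := 16 * (a * (a + 1)) + 16 * (b * (b + 1)) + 2 * ((2 * a + 1) * (2 * b + 1) + 1)) ?_
      (by positivity) (by positivity) (by nlinarith [sq_nonneg (2 * a + 1 + (2 * b + 1))]) ?_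
    · simp [imForm]; ring
    · by_contra hc
      push Not at hc
      obtain ⟨h1, h2, h3⟩ := hc
      have h4 : a * (a + 1) = 0 := by omega
      have h5 : b * (b + 1) = 0 := by omega
      rcases mul_eq_zero.1 h4 with h | h <;> rcases mul_eq_zero.1 h5 with h' | h'
      · subst h h'; norm_num at h3
      · exact hn' (Or.inl ⟨h, by omega⟩)
      · exact hn' (Or.inr ⟨by omega, h'⟩)
      · have : a = -1 := by omega
        have : b = -1 := by omega
        subst a b; norm_num at h3)
  rw [Finset.sum_pair (by simp)] at this
  have e : (-1 : ℂ) + 2⁻¹ = -2⁻¹ := by norm_num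
  simpa [lead, e] using this

/-! ### Proportionality from duplication -/

/-- Two holomorphic functions with the same behaviour under `τ ↦ 2τ` and proportional leading terms
are proportional. -/
theorem eq_mul_of_duplication {D P A R : ℂ × ℂ × ℂ → ℂ} (hD : DifferentiableOn ℂ D UHS)
    (hP : DifferentiableOn ℂ P UHS)
    (hDA : ∀ w ∈ UHS, D w * A w = D ((2 : ℂ) • w) * R w)
    (hPA : ∀ w ∈ UHS, P w * A w = P ((2 : ℂ) • w) * R w) {d q a : ℂ} (hq : q ≠ 0) (ha : a ≠ 0)
    (hlim : ∀ w ∈ baseRegion, ∃ N M : ℝ → ℂ, (∀ t, N t ≠ 0) ∧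
      Tendsto (fun t : ℝ => N t * D ((t : ℂ) • w)) atTop (𝓝 d) ∧
      Tendsto (fun t : ℝ => N t * P ((t : ℂ) • w)) atTop (𝓝 q) ∧
      Tendsto (fun t : ℝ => M t * A ((t : ℂ) • w)) atTop (𝓝 a))
    {w : ℂ × ℂ × ℂ} (hw : w ∈ UHS) : D w = d / q * P w := by
  have hdiff : DifferentiableOn ℂ (fun w => D w - d / q * P w) UHS := hD.sub (hP.const_mul _)
  have hbase : ∀ w ∈ baseRegion, D w - d / q * P w = 0 := by
    intro w hw
    obtain ⟨N, M, hN, hlD, hlP, hlA⟩ := hlim w hw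
    have hP0 : ∀ᶠ t : ℝ in atTop, P ((t : ℂ) • w) ≠ 0 :=
      (hlP.eventually_ne hq).mono fun t ht h => ht (by rw [h, mul_zero])
    have hA0 : ∀ᶠ t : ℝ in atTop, A ((t : ℂ) • w) ≠ 0 :=
      (hlA.eventually_ne ha).mono fun t ht h => ht (by rw [h, mul_zero])
    have hratio : Tendsto (fun t : ℝ => D ((t : ℂ) • w) / P ((t : ℂ) • w)) atTop (𝓝 (d / q)) := by
      refine (hlD.div hlP hq).congr fun t => ?_
      rw [Pi.div_apply, mul_div_mul_left _ _ (hN t)]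
    obtain ⟨t₀, ht₀⟩ := eventually_atTop.1 (hP0.and (hA0.and (eventually_gt_atTop 0)))
    -- Dividing the two duplication equations shows that D/P is unchanged by doubling. The factor R
    -- may be cancelled since P · A is nonzero at the point.
    have hstep : ∀ t : ℝ, t₀ ≤ t → D ((t : ℂ) • w) / P ((t : ℂ) • w)
        = D (((2 * t : ℝ) : ℂ) • w) / P (((2 * t : ℝ) : ℂ) • w) := by
      intro t ht
      obtain ⟨h1, h2, h3⟩ := ht₀ t ht
      obtain ⟨h1', -, -⟩ := ht₀ (2 * t) (by linarith)
      have hm := two_smul_mem_UHS hw.1 h3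
      have e : (((2 * t : ℝ) : ℂ) • w) = (2 : ℂ) • ((t : ℂ) • w) := by
        rw [smul_smul]; push_cast; rfl
      rw [e] at h1' ⊢
      have eD := hDA _ hm
      have eP := hPA _ hm
      rw [div_eq_div_iff h1 h1']
      have hR : R ((t : ℂ) • w) ≠ 0 := by
        intro h
        rw [h, mul_zero] at eP
        exact (mul_ne_zero h1 h2) eP
      apply mul_right_cancel₀ hR
      apply mul_right_cancel₀ h2
      linear_combination D ((t : ℂ) • w) * A ((t : ℂ) • w) * (-eP) + P ((t : ℂ) • w) * A ((t : ℂ) • w) * eD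
    have hpow : ∀ t : ℝ, t₀ ≤ t → ∀ n : ℕ, D ((t : ℂ) • w) / P ((t : ℂ) • w)
        = D (((2 ^ n * t : ℝ) : ℂ) • w) / P (((2 ^ n * t : ℝ) : ℂ) • w) := by
      intro t ht n
      have ht0 := (ht₀ t ht).2.2
      induction n with
      | zero => simp
      | succ n ih =>
        have h1 : t₀ ≤ 2 ^ n * t := by
          have : (1 : ℝ) ≤ 2 ^ n := one_le_pow₀ (by norm_num)
          nlinarith
        rw [ih, hstep _ h1]
        congr 4 <;> ring
    have hval : ∀ t : ℝ, t₀ ≤ t → D ((t : ℂ) • w) - d / q * P ((t : ℂ) • w) = 0 := by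
      intro t ht
      obtain ⟨h1, -, h3⟩ := ht₀ t ht
      have hseq : Tendsto (fun n : ℕ => (2 ^ n * t : ℝ)) atTop atTop :=
        Tendsto.atTop_mul_const h3 (tendsto_pow_atTop_atTop_of_one_lt (by norm_num))
      -- The ratio is constant along 2ⁿt and also tends to d/q.
      have := tendsto_nhds_unique
        ((hratio.comp hseq).congr fun n => (hpow t ht n).symm) tendsto_const_nhds
      rw [this, div_mul_cancel₀ _ h1, sub_self]
    -- Vanishing for real t ≥ t₀ gives an accumulation of zeros at t₀ + 1 on the complex line
    -- through 0 and w; the parameter 1 on this line is w itself.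
    have hfreq : ∃ᶠ s : ℂ in 𝓝[≠] ((t₀ + 1 : ℝ) : ℂ),
        (fun w => D w - d / q * P w) (0 + s • w) = 0 := by
      have hmap : Tendsto (fun t : ℝ => (t : ℂ)) (𝓝[≠] (t₀ + 1)) (𝓝[≠] ((t₀ + 1 : ℝ) : ℂ)) := by
        refine tendsto_nhdsWithin_iff.2
          ⟨(Complex.continuous_ofReal.tendsto _).mono_left nhdsWithin_le_nhds, ?_⟩
        filter_upwards [self_mem_nhdsWithin] with t ht
        simpa [← Complex.ofReal_one, ← Complex.ofReal_add, -Complex.ofReal_add, -Complex.ofReal_one]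
          using ht
      refine hmap.frequently (Eventually.frequently ?_)
      have : ∀ᶠ t : ℝ in 𝓝[≠] (t₀ + 1), t₀ ≤ t :=
        nhdsWithin_le_nhds (eventually_ge_nhds (by linarith))
      filter_upwards [this] with t ht
      simpa using hval t ht
    have := eq_zero_of_line hdiff 0 w (s₀ := ((t₀ + 1 : ℝ) : ℂ)) (s₁ := 1)
      (by simpa using two_smul_mem_UHS hw.1 (ht₀ (t₀ + 1) (by linarith)).2.2)
      (by simpa using hw.1) hfreq
    simpa using this
  obtain ⟨w₀, hw₀⟩ := exists_mem_baseRegion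
  exact sub_eq_zero.1 (eq_zero_of_eventually hdiff hw₀.1 hw
    (Filter.mem_of_superset (isOpen_baseRegion.mem_nhds hw₀) hbase))

/-! ### Rosenhain's formula -/

theorem exp_pi_mul_I_mul_half : Complex.exp (Real.pi * Complex.I * 2⁻¹) = Complex.I := by
  rw [show (Real.pi * Complex.I * 2⁻¹ : ℂ) = Real.pi / 2 * Complex.I by ring,
    Complex.exp_pi_div_two_mul_I]

theorem exp_neg_pi_mul_I_mul_half : Complex.exp (-(Real.pi * Complex.I * 2⁻¹)) = -Complex.I := by
  rw [show (-(Real.pi * Complex.I * 2⁻¹) : ℂ) = -Real.pi / 2 * Complex.I by ring,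
    Complex.exp_neg_pi_div_two_mul_I]

theorem differentiableOn_tc (k : ℕ) : DifferentiableOn ℂ (tc k) UHS := fun _ hw =>
  (differentiableAt_wTheta mild_one _ _ _ _ hw).differentiableWithinAt

theorem differentiableOn_gc {p : ℂ → ℂ → ℂ} (hp : Mild p) (i : ℕ) :
    DifferentiableOn ℂ (gc p i) UHS := fun _ hw =>
  (differentiableAt_wTheta hp _ _ _ _ hw).differentiableWithinAt

/-- The bracket `G_i ∧ G_j`, up to the factor `(2πi)²`. -/
noncomputable def br (i j : ℕ) (w : ℂ × ℂ × ℂ) : ℂ :=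
  gc (fun x _ => x) i w * gc (fun _ y => y) j w - gc (fun _ y => y) i w * gc (fun x _ => x) j w

theorem differentiableOn_br (i j : ℕ) : DifferentiableOn ℂ (br i j) UHS :=
  ((differentiableOn_gc mild_fst i).mul (differentiableOn_gc mild_snd j)).sub
    ((differentiableOn_gc mild_snd i).mul (differentiableOn_gc mild_fst j))

section Limits

variable {w : ℂ × ℂ × ℂ}

theorem tendsto_tc_00 (hw : w ∈ baseRegion) {k : ℕ} (h₁ : evenChar k 0 = 0) (h₂ : evenChar k 1 = 0) :
    Tendsto (fun t : ℝ => lead w 0 0 t * tc k ((t : ℂ) • w)) atTop (𝓝 1) := by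
  simpa [tc, h₁, h₂] using tendsto_00 mild_one (evenChar k 2) (evenChar k 3) hw

theorem tendsto_tc_01 (hw : w ∈ baseRegion) {k : ℕ} (h₁ : evenChar k 0 = 0) (h₂ : evenChar k 1 = 1)
    (h₃ : evenChar k 3 = 0) :
    Tendsto (fun t : ℝ => lead w 0 2⁻¹ t * tc k ((t : ℂ) • w)) atTop (𝓝 2) := by
  have := tendsto_01 mild_one (evenChar k 2) (evenChar k 3) hw
  norm_num [h₃] at this
  simpa [tc, h₁, h₂, h₃] using this

theorem tendsto_tc_10 (hw : w ∈ baseRegion) {k : ℕ} (h₁ : evenChar k 0 = 1) (h₂ : evenChar k 1 = 0)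
    (h₃ : evenChar k 2 = 0) :
    Tendsto (fun t : ℝ => lead w 2⁻¹ 0 t * tc k ((t : ℂ) • w)) atTop (𝓝 2) := by
  have := tendsto_10 mild_one (evenChar k 2) (evenChar k 3) hw
  norm_num [h₃] at this
  simpa [tc, h₁, h₂, h₃] using this

theorem tendsto_tc_11 (hw : w ∈ baseRegion) {k : ℕ} (h₁ : evenChar k 0 = 1) (h₂ : evenChar k 1 = 1)
    (h₃ : evenChar k 2 = evenChar k 3) :
    Tendsto (fun t : ℝ => lead w 2⁻¹ (-2⁻¹) t * tc k ((t : ℂ) • w)) atTop (𝓝 2) := by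
  have := tendsto_11 mild_one (evenChar k 2) (evenChar k 3) hw
  norm_num [h₃] at this
  simpa [tc, h₁, h₂, h₃] using this

theorem tendsto_gc_01 (hw : w ∈ baseRegion) {k : ℕ} (h₁ : oddChar k 0 = 0) (h₂ : oddChar k 1 = 1)
    (h₃ : oddChar k 3 = 1) :
    Tendsto (fun t : ℝ => lead w 0 2⁻¹ t * gc (fun x _ => x) k ((t : ℂ) • w)) atTop (𝓝 0) ∧
    Tendsto (fun t : ℝ => lead w 0 2⁻¹ t * gc (fun _ y => y) k ((t : ℂ) • w)) atTop (𝓝 Complex.I)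
    := by
  have f := tendsto_01 mild_fst (oddChar k 2) (oddChar k 3) hw
  have g := tendsto_01 mild_snd (oddChar k 2) (oddChar k 3) hw
  have e : 2⁻¹ * Complex.I + 2⁻¹ * Complex.I = Complex.I := by ring
  simp only [h₃, Int.cast_one, mul_one, neg_mul, mul_neg, exp_pi_mul_I_mul_half,
    exp_neg_pi_mul_I_mul_half, zero_mul, neg_zero, add_zero, neg_neg, e] at f g
  constructor <;> simpa [gc, h₁, h₂, h₃]

theorem tendsto_gc_10 (hw : w ∈ baseRegion) {k : ℕ} (h₁ : oddChar k 0 = 1) (h₂ : oddChar k 1 = 0)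
    (h₃ : oddChar k 2 = 1) :
    Tendsto (fun t : ℝ => lead w 2⁻¹ 0 t * gc (fun x _ => x) k ((t : ℂ) • w)) atTop (𝓝 Complex.I) ∧
    Tendsto (fun t : ℝ => lead w 2⁻¹ 0 t * gc (fun _ y => y) k ((t : ℂ) • w)) atTop (𝓝 0) := by
  have f := tendsto_10 mild_fst (oddChar k 2) (oddChar k 3) hw
  have g := tendsto_10 mild_snd (oddChar k 2) (oddChar k 3) hw
  have e : 2⁻¹ * Complex.I + 2⁻¹ * Complex.I = Complex.I := by ring
  simp only [h₃, Int.cast_one, mul_one, neg_mul, mul_neg, exp_pi_mul_I_mul_half,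
    exp_neg_pi_mul_I_mul_half, zero_mul, neg_zero, add_zero, neg_neg, e] at f g
  constructor <;> simpa [gc, h₁, h₂, h₃]

theorem tendsto_gc_5 (hw : w ∈ baseRegion) :
    Tendsto (fun t : ℝ => lead w 2⁻¹ (-2⁻¹) t * gc (fun x _ => x) 5 ((t : ℂ) • w)) atTop
      (𝓝 (-Complex.I)) ∧
    Tendsto (fun t : ℝ => lead w 2⁻¹ (-2⁻¹) t * gc (fun _ y => y) 5 ((t : ℂ) • w)) atTop
      (𝓝 Complex.I) := by
  have f := tendsto_11 mild_fst 0 1 hw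
  have g := tendsto_11 mild_snd 0 1 hw
  have e : 2⁻¹ * Complex.I + 2⁻¹ * Complex.I = Complex.I := by ring
  have e' : -(2⁻¹ * Complex.I) + -(2⁻¹ * Complex.I) = -Complex.I := by ring
  simp only [Int.cast_one, Int.cast_zero, mul_zero, zero_add, mul_one, neg_mul, mul_neg,
    exp_pi_mul_I_mul_half, exp_neg_pi_mul_I_mul_half, neg_neg, e, e'] at f g
  constructor <;> simpa [gc, oddChar]

theorem tendsto_gc_6 (hw : w ∈ baseRegion) :
    Tendsto (fun t : ℝ => lead w 2⁻¹ (-2⁻¹) t * gc (fun x _ => x) 6 ((t : ℂ) • w)) atTop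
      (𝓝 Complex.I) ∧
    Tendsto (fun t : ℝ => lead w 2⁻¹ (-2⁻¹) t * gc (fun _ y => y) 6 ((t : ℂ) • w)) atTop
      (𝓝 (-Complex.I)) := by
  have f := tendsto_11 mild_fst 1 0 hw
  have g := tendsto_11 mild_snd 1 0 hw
  have e : 2⁻¹ * Complex.I + 2⁻¹ * Complex.I = Complex.I := by ring
  have e' : -(2⁻¹ * Complex.I) + -(2⁻¹ * Complex.I) = -Complex.I := by ring
  simp only [Int.cast_one, Int.cast_zero, mul_zero, add_zero, mul_one, neg_mul, mul_neg,
    exp_pi_mul_I_mul_half, exp_neg_pi_mul_I_mul_half, neg_neg, e, e'] at f g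
  constructor <;> simpa [gc, oddChar]

end Limits

/-- After multiplication by ϑ₅ϑ₉ both gradients are combinations of G₁ and G₅ at 2τ, with
determinant proportional to (ϑ₂² - ϑ₈²)(2τ) = (ϑ₃ϑ₄)(τ). The bracket therefore reproduces itself at
2τ. The constant -1/4 is the ratio of the leading coefficients -1 and 4. -/
theorem br_1_5 {w : ℂ × ℂ × ℂ} (hw : w ∈ UHS) :
    br 1 5 w = -1 / 4 * (tc 3 w * tc 4 w * tc 6 w * tc 10 w) := by
  refine eq_mul_of_duplication (P := fun w => tc 3 w * tc 4 w * tc 6 w * tc 10 w)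
    (A := fun w => tc 5 w * tc 9 w) (R := fun w => 4 * (tc 3 w * tc 4 w)) (d := -1) (q := 4)
    (a := 4) (differentiableOn_br 1 5)
    ((((differentiableOn_tc 3).mul (differentiableOn_tc 4)).mul (differentiableOn_tc 6)).mul
      (differentiableOn_tc 10)) (fun w hw => ?_) (fun w hw => ?_) (by norm_num) (by norm_num)
    (fun w hw => ?_) hw
  · have h1 := gc_1_mul_tc_5 oddW_fst hw
    have h2 := gc_1_mul_tc_5 oddW_snd hw
    have h3 := gc_5_mul_tc_9 oddW_fst hw
    have h4 := gc_5_mul_tc_9 oddW_snd hw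
    have h5 := tc_3_mul_tc_4 hw
    simp only [br]
    rw [h5]
    calc _ = (gc (fun x _ => x) 1 w * tc 5 w) * (gc (fun _ y => y) 5 w * tc 9 w)
          - (gc (fun _ y => y) 1 w * tc 5 w) * (gc (fun x _ => x) 5 w * tc 9 w) := by ring
      _ = _ := by rw [h1, h2, h3, h4]; ring
  -- On the side of the product, ϑ₅ϑ₆ and ϑ₉ϑ₁₀ become 2ϑ₃ϑ₆ and 2ϑ₄ϑ₁₀ at 2τ, which restores the
  -- four-fold product there with the same factor 4ϑ₃ϑ₄.
  · have h1 := tc_5_mul_tc_6 hw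
    have h2 := tc_9_mul_tc_10 hw
    linear_combination tc 3 w * tc 4 w * (tc 9 w * tc 10 w) * h1
      + tc 3 w * tc 4 w * (2 * tc 6 ((2 : ℂ) • w) * tc 3 ((2 : ℂ) • w)) * h2
  · obtain ⟨a1, b1⟩ := tendsto_gc_01 hw (k := 1) rfl rfl rfl
    obtain ⟨a2, b2⟩ := tendsto_gc_5 hw
    refine ⟨fun t => lead w 0 2⁻¹ t * lead w 2⁻¹ (-2⁻¹) t,
      fun t => lead w 0 2⁻¹ t * lead w 2⁻¹ (-2⁻¹) t,
      fun t => mul_ne_zero (lead_ne_zero _ _ _ _) (lead_ne_zero _ _ _ _), ?_, ?_, ?_⟩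
    · have := (a1.mul b2).sub (b1.mul a2)
      have e : 0 * Complex.I - Complex.I * -Complex.I = -1 := by simp
      rw [e] at this
      refine this.congr fun t => ?_
      simp only [br]; ring
    · have h := ((tendsto_tc_00 hw (k := 3) rfl rfl).mul (tendsto_tc_00 hw (k := 4) rfl rfl)).mul
        ((tendsto_tc_01 hw (k := 6) rfl rfl rfl).mul (tendsto_tc_11 hw (k := 10) rfl rfl rfl))
      rw [show (1 : ℂ) * 1 * (2 * 2) = 4 by norm_num] at h
      refine h.congr fun t => ?_
      simp [lead, qForm]; ring
    · have h := (tendsto_tc_01 hw (k := 5) rfl rfl rfl).mul (tendsto_tc_11 hw (k := 9) rfl rfl rfl)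
      rw [show (2 : ℂ) * 2 = 4 by norm_num] at h
      refine h.congr fun t => ?_
      ring

theorem br_2_4 {w : ℂ × ℂ × ℂ} (hw : w ∈ UHS) :
    br 2 4 w = 1 / 4 * (tc 2 w * tc 3 w * tc 6 w * tc 8 w) := by
  refine eq_mul_of_duplication (P := fun w => tc 2 w * tc 3 w * tc 6 w * tc 8 w)
    (A := fun w => tc 5 w * tc 7 w) (R := fun w => 4 * (tc 2 w * tc 3 w)) (d := 1) (q := 4)
    (a := 4) (differentiableOn_br 2 4)
    ((((differentiableOn_tc 2).mul (differentiableOn_tc 3)).mul (differentiableOn_tc 6)).mul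
      (differentiableOn_tc 8)) (fun w hw => ?_) (fun w hw => ?_) (by norm_num) (by norm_num)
    (fun w hw => ?_) hw
  · have h1 := gc_2_mul_tc_5 oddW_fst hw
    have h2 := gc_2_mul_tc_5 oddW_snd hw
    have h3 := gc_4_mul_tc_7 oddW_fst hw
    have h4 := gc_4_mul_tc_7 oddW_snd hw
    have h5 := tc_2_mul_tc_3 hw
    simp only [br]
    rw [h5]
    calc _ = (gc (fun x _ => x) 2 w * tc 5 w) * (gc (fun _ y => y) 4 w * tc 7 w)
          - (gc (fun _ y => y) 2 w * tc 5 w) * (gc (fun x _ => x) 4 w * tc 7 w) := by ring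
      _ = _ := by rw [h1, h2, h3, h4]; ring
  · have h1 := tc_5_mul_tc_6 hw
    have h2 := tc_7_mul_tc_8 hw
    linear_combination tc 2 w * tc 3 w * (tc 7 w * tc 8 w) * h1
      + tc 2 w * tc 3 w * (2 * tc 6 ((2 : ℂ) • w) * tc 3 ((2 : ℂ) • w)) * h2
  · obtain ⟨a1, b1⟩ := tendsto_gc_01 hw (k := 2) rfl rfl rfl
    obtain ⟨a2, b2⟩ := tendsto_gc_10 hw (k := 4) rfl rfl rfl
    refine ⟨fun t => lead w 0 2⁻¹ t * lead w 2⁻¹ 0 t,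
      fun t => lead w 0 2⁻¹ t * lead w 2⁻¹ 0 t,
      fun t => mul_ne_zero (lead_ne_zero _ _ _ _) (lead_ne_zero _ _ _ _), ?_, ?_, ?_⟩
    · have := (a1.mul b2).sub (b1.mul a2)
      have e : 0 * 0 - Complex.I * Complex.I = 1 := by simp
      rw [e] at this
      refine this.congr fun t => ?_
      simp only [br]; ring
    · have h := ((tendsto_tc_00 hw (k := 2) rfl rfl).mul (tendsto_tc_00 hw (k := 3) rfl rfl)).mul
        ((tendsto_tc_01 hw (k := 6) rfl rfl rfl).mul (tendsto_tc_10 hw (k := 8) rfl rfl rfl))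
      rw [show (1 : ℂ) * 1 * (2 * 2) = 4 by norm_num] at h
      refine h.congr fun t => ?_
      simp [lead, qForm]; ring
    · have h := (tendsto_tc_01 hw (k := 5) rfl rfl rfl).mul (tendsto_tc_10 hw (k := 7) rfl rfl rfl)
      rw [show (2 : ℂ) * 2 = 4 by norm_num] at h
      refine h.congr fun t => ?_
      ring

theorem br_3_6 {w : ℂ × ℂ × ℂ} (hw : w ∈ UHS) :
    br 3 6 w = 1 / 4 * (tc 2 w * tc 4 w * tc 8 w * tc 10 w) := by
  refine eq_mul_of_duplication (P := fun w => tc 2 w * tc 4 w * tc 8 w * tc 10 w)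
    (A := fun w => tc 7 w * tc 9 w) (R := fun w => 4 * (tc 2 w * tc 4 w)) (d := 1) (q := 4)
    (a := 4) (differentiableOn_br 3 6)
    ((((differentiableOn_tc 2).mul (differentiableOn_tc 4)).mul (differentiableOn_tc 8)).mul
      (differentiableOn_tc 10)) (fun w hw => ?_) (fun w hw => ?_) (by norm_num) (by norm_num)
    (fun w hw => ?_) hw
  · have h1 := gc_3_mul_tc_7 oddW_fst hw
    have h2 := gc_3_mul_tc_7 oddW_snd hw
    have h3 := gc_6_mul_tc_9 oddW_fst hw
    have h4 := gc_6_mul_tc_9 oddW_snd hw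
    have h5 := tc_2_mul_tc_4 hw
    simp only [br]
    rw [h5]
    calc _ = (gc (fun x _ => x) 3 w * tc 7 w) * (gc (fun _ y => y) 6 w * tc 9 w)
          - (gc (fun _ y => y) 3 w * tc 7 w) * (gc (fun x _ => x) 6 w * tc 9 w) := by ring
      _ = _ := by rw [h1, h2, h3, h4]; ring
  · have h1 := tc_7_mul_tc_8 hw
    have h2 := tc_9_mul_tc_10 hw
    linear_combination tc 2 w * tc 4 w * (tc 9 w * tc 10 w) * h1
      + tc 2 w * tc 4 w * (2 * tc 8 ((2 : ℂ) • w) * tc 2 ((2 : ℂ) • w)) * h2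
  · obtain ⟨a1, b1⟩ := tendsto_gc_10 hw (k := 3) rfl rfl rfl
    obtain ⟨a2, b2⟩ := tendsto_gc_6 hw
    refine ⟨fun t => lead w 2⁻¹ 0 t * lead w 2⁻¹ (-2⁻¹) t,
      fun t => lead w 2⁻¹ 0 t * lead w 2⁻¹ (-2⁻¹) t,
      fun t => mul_ne_zero (lead_ne_zero _ _ _ _) (lead_ne_zero _ _ _ _), ?_, ?_, ?_⟩
    · have := (a1.mul b2).sub (b1.mul a2)
      have e : Complex.I * -Complex.I - 0 * Complex.I = 1 := by simp
      rw [e] at this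
      refine this.congr fun t => ?_
      simp only [br]; ring
    · have h := ((tendsto_tc_00 hw (k := 2) rfl rfl).mul (tendsto_tc_00 hw (k := 4) rfl rfl)).mul
        ((tendsto_tc_10 hw (k := 8) rfl rfl rfl).mul (tendsto_tc_11 hw (k := 10) rfl rfl rfl))
      rw [show (1 : ℂ) * 1 * (2 * 2) = 4 by norm_num] at h
      refine h.congr fun t => ?_
      simp [lead, qForm]; ring
    · have h := (tendsto_tc_10 hw (k := 7) rfl rfl rfl).mul (tendsto_tc_11 hw (k := 9) rfl rfl rfl)
      rw [show (2 : ℂ) * 2 = 4 by norm_num] at h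
      refine h.congr fun t => ?_
      ring

/-! ### The remaining six brackets -/

/-- A theta constant with isolated leading term is not identically zero. -/
theorem exists_tc_mul_tc_ne_zero (k l : ℕ) {w : ℂ × ℂ × ℂ} (hw : w ∈ baseRegion) {N M : ℝ → ℂ}
    {a b : ℂ} (ha : a ≠ 0) (hb : b ≠ 0)
    (hN : Tendsto (fun t : ℝ => N t * tc k ((t : ℂ) • w)) atTop (𝓝 a))
    (hM : Tendsto (fun t : ℝ => M t * tc l ((t : ℂ) • w)) atTop (𝓝 b)) :
    ∃ w ∈ UHS, tc k w * tc l w ≠ 0 := by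
  have h1 := hN.eventually_ne ha
  have h2 := hM.eventually_ne hb
  obtain ⟨t, h1, h2, h3⟩ := (h1.and (h2.and (eventually_gt_atTop 0))).exists
  exact ⟨_, two_smul_mem_UHS hw.1 h3, mul_ne_zero (right_ne_zero_of_mul h1) (right_ne_zero_of_mul h2)⟩

theorem br_eq_of_mul {i j k l : ℕ} {P : ℂ × ℂ × ℂ → ℂ} (hP : DifferentiableOn ℂ P UHS)
    (hne : ∃ w ∈ UHS, tc k w * tc l w ≠ 0)
    (h : ∀ w ∈ UHS, br i j w * (tc k w * tc l w) = P w * (tc k w * tc l w))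
    {w : ℂ × ℂ × ℂ} (hw : w ∈ UHS) : br i j w = P w := by
  obtain ⟨w₀, h₀, hne⟩ := hne
  have := eq_zero_of_mul_eq_zero (f := fun w => br i j w - P w) (g := fun w => tc k w * tc l w)
    ((differentiableOn_br i j).sub hP) ((differentiableOn_tc k).mul (differentiableOn_tc l)) h₀ hne
    (fun w hw => by rw [sub_mul, h w hw, sub_self]) hw
  exact sub_eq_zero.1 this

theorem differentiableOn_four (c : ℂ) (k l m n : ℕ) :
    DifferentiableOn ℂ (fun w => c * (tc k w * tc l w * tc m w * tc n w)) UHS :=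
  ((((differentiableOn_tc k).mul (differentiableOn_tc l)).mul (differentiableOn_tc m)).mul
    (differentiableOn_tc n)).const_mul c

/-- After multiplication by ϑ₅ϑ₆ both gradients become combinations of the same pair G₁, G₅ at 2τ,
so the bracket is a multiple of the known bracket of that pair. The other brackets below are
obtained in the same way from `br_1_5`, `br_2_4` or `br_3_6` at 2τ. -/
theorem br_1_2 {w : ℂ × ℂ × ℂ} (hw : w ∈ UHS) :
    br 1 2 w = 1 / 4 * (tc 7 w * tc 8 w * tc 9 w * tc 10 w) := by
  obtain ⟨w₀, h₀⟩ := exists_mem_baseRegion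
  refine br_eq_of_mul (k := 5) (l := 6) (differentiableOn_four _ _ _ _ _)
    (exists_tc_mul_tc_ne_zero 5 6 h₀ two_ne_zero two_ne_zero (tendsto_tc_01 h₀ rfl rfl rfl)
      (tendsto_tc_01 h₀ rfl rfl rfl)) (fun w hw => ?_) hw
  have e := br_1_5 (w := (2 : ℂ) • w) (by simpa using two_smul_mem_UHS hw two_pos)
  have e' : 1 / 4 * (tc 7 w * tc 8 w * tc 9 w * tc 10 w) * (tc 5 w * tc 6 w)
    = 1 / 4 * ((tc 7 w * tc 8 w) * (tc 9 w * tc 10 w) * (tc 5 w * tc 6 w)) := by ring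
  conv_rhs => rw [e', tc_7_mul_tc_8 hw, tc_9_mul_tc_10 hw, tc_5_mul_tc_6 hw]
  calc br 1 2 w * (tc 5 w * tc 6 w)
      = (gc (fun x _ => x) 1 w * tc 5 w) * (gc (fun _ y => y) 2 w * tc 6 w)
        - (gc (fun _ y => y) 1 w * tc 5 w) * (gc (fun x _ => x) 2 w * tc 6 w) := by
        simp only [br]; ring
    _ = _ := by
      rw [gc_1_mul_tc_5 oddW_fst hw, gc_1_mul_tc_5 oddW_snd hw, gc_2_mul_tc_6 oddW_fst hw,
        gc_2_mul_tc_6 oddW_snd hw]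
      simp only [br] at e
      -- The coefficient is 2 · 2 times the determinant -2ϑ₂ϑ₈ of the two combinations ϑ₂G₁ ± ϑ₈G₅.
      linear_combination (-8 * (tc 2 ((2 : ℂ) • w) * tc 8 ((2 : ℂ) • w))) * e

theorem br_2_6 {w : ℂ × ℂ × ℂ} (hw : w ∈ UHS) :
    br 2 6 w = 1 / 4 * (tc 3 w * tc 4 w * tc 5 w * tc 9 w) := by
  obtain ⟨w₀, h₀⟩ := exists_mem_baseRegion
  refine br_eq_of_mul (k := 6) (l := 10) (differentiableOn_four _ _ _ _ _)
    (exists_tc_mul_tc_ne_zero 6 10 h₀ two_ne_zero two_ne_zero (tendsto_tc_01 h₀ rfl rfl rfl)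
      (tendsto_tc_11 h₀ rfl rfl rfl)) (fun w hw => ?_) hw
  have e := br_1_5 (w := (2 : ℂ) • w) (by simpa using two_smul_mem_UHS hw two_pos)
  have e' : 1 / 4 * (tc 3 w * tc 4 w * tc 5 w * tc 9 w) * (tc 6 w * tc 10 w)
    = 1 / 4 * ((tc 3 w * tc 4 w) * (tc 5 w * tc 6 w) * (tc 9 w * tc 10 w)) := by ring
  conv_rhs => rw [e', tc_3_mul_tc_4 hw, tc_5_mul_tc_6 hw, tc_9_mul_tc_10 hw]
  calc br 2 6 w * (tc 6 w * tc 10 w)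
      = (gc (fun x _ => x) 2 w * tc 6 w) * (gc (fun _ y => y) 6 w * tc 10 w)
        - (gc (fun _ y => y) 2 w * tc 6 w) * (gc (fun x _ => x) 6 w * tc 10 w) := by
        simp only [br]; ring
    _ = _ := by
      rw [gc_2_mul_tc_6 oddW_fst hw, gc_2_mul_tc_6 oddW_snd hw, gc_6_mul_tc_10 oddW_fst hw,
        gc_6_mul_tc_10 oddW_snd hw]
      simp only [br] at e
      linear_combination (-4 * (tc 2 ((2 : ℂ) • w) ^ 2 - tc 8 ((2 : ℂ) • w) ^ 2)) * e

theorem br_3_5 {w : ℂ × ℂ × ℂ} (hw : w ∈ UHS) :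
    br 3 5 w = -1 / 4 * (tc 1 w * tc 3 w * tc 8 w * tc 9 w) := by
  obtain ⟨w₀, h₀⟩ := exists_mem_baseRegion
  refine br_eq_of_mul (k := 7) (l := 10) (differentiableOn_four _ _ _ _ _)
    (exists_tc_mul_tc_ne_zero 7 10 h₀ two_ne_zero two_ne_zero (tendsto_tc_10 h₀ rfl rfl rfl)
      (tendsto_tc_11 h₀ rfl rfl rfl)) (fun w hw => ?_) hw
  have e := br_3_6 (w := (2 : ℂ) • w) (by simpa using two_smul_mem_UHS hw two_pos)
  have e' : -1 / 4 * (tc 1 w * tc 3 w * tc 8 w * tc 9 w) * (tc 7 w * tc 10 w)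
    = -1 / 4 * ((tc 1 w * tc 3 w) * (tc 7 w * tc 8 w) * (tc 9 w * tc 10 w)) := by ring
  conv_rhs => rw [e', tc_1_mul_tc_3 hw, tc_7_mul_tc_8 hw, tc_9_mul_tc_10 hw]
  calc br 3 5 w * (tc 7 w * tc 10 w)
      = (gc (fun x _ => x) 3 w * tc 7 w) * (gc (fun _ y => y) 5 w * tc 10 w)
        - (gc (fun _ y => y) 3 w * tc 7 w) * (gc (fun x _ => x) 5 w * tc 10 w) := by
        simp only [br]; ring
    _ = _ := by
      rw [gc_3_mul_tc_7 oddW_fst hw, gc_3_mul_tc_7 oddW_snd hw, gc_5_mul_tc_10 oddW_fst hw,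
        gc_5_mul_tc_10 oddW_snd hw]
      simp only [br] at e
      linear_combination (-4 * (tc 3 ((2 : ℂ) • w) ^ 2 + tc 6 ((2 : ℂ) • w) ^ 2)) * e

theorem br_4_6 {w : ℂ × ℂ × ℂ} (hw : w ∈ UHS) :
    br 4 6 w = 1 / 4 * (tc 1 w * tc 3 w * tc 7 w * tc 10 w) := by
  obtain ⟨w₀, h₀⟩ := exists_mem_baseRegion
  refine br_eq_of_mul (k := 8) (l := 9) (differentiableOn_four _ _ _ _ _)
    (exists_tc_mul_tc_ne_zero 8 9 h₀ two_ne_zero two_ne_zero (tendsto_tc_10 h₀ rfl rfl rfl)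
      (tendsto_tc_11 h₀ rfl rfl rfl)) (fun w hw => ?_) hw
  have e := br_3_6 (w := (2 : ℂ) • w) (by simpa using two_smul_mem_UHS hw two_pos)
  have e' : 1 / 4 * (tc 1 w * tc 3 w * tc 7 w * tc 10 w) * (tc 8 w * tc 9 w)
    = 1 / 4 * ((tc 1 w * tc 3 w) * (tc 7 w * tc 8 w) * (tc 9 w * tc 10 w)) := by ring
  conv_rhs => rw [e', tc_1_mul_tc_3 hw, tc_7_mul_tc_8 hw, tc_9_mul_tc_10 hw]
  calc br 4 6 w * (tc 8 w * tc 9 w)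
      = (gc (fun x _ => x) 4 w * tc 8 w) * (gc (fun _ y => y) 6 w * tc 9 w)
        - (gc (fun _ y => y) 4 w * tc 8 w) * (gc (fun x _ => x) 6 w * tc 9 w) := by
        simp only [br]; ring
    _ = _ := by
      rw [gc_4_mul_tc_8 oddW_fst hw, gc_4_mul_tc_8 oddW_snd hw, gc_6_mul_tc_9 oddW_fst hw,
        gc_6_mul_tc_9 oddW_snd hw]
      simp only [br] at e
      linear_combination (4 * (tc 3 ((2 : ℂ) • w) ^ 2 + tc 6 ((2 : ℂ) • w) ^ 2)) * e

theorem br_1_4 {w : ℂ × ℂ × ℂ} (hw : w ∈ UHS) :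
    br 1 4 w = 1 / 4 * (tc 1 w * tc 4 w * tc 5 w * tc 8 w) := by
  obtain ⟨w₀, h₀⟩ := exists_mem_baseRegion
  refine br_eq_of_mul (k := 6) (l := 7) (differentiableOn_four _ _ _ _ _)
    (exists_tc_mul_tc_ne_zero 6 7 h₀ two_ne_zero two_ne_zero (tendsto_tc_01 h₀ rfl rfl rfl)
      (tendsto_tc_10 h₀ rfl rfl rfl)) (fun w hw => ?_) hw
  have e := br_2_4 (w := (2 : ℂ) • w) (by simpa using two_smul_mem_UHS hw two_pos)
  have e' : 1 / 4 * (tc 1 w * tc 4 w * tc 5 w * tc 8 w) * (tc 6 w * tc 7 w)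
    = 1 / 4 * ((tc 1 w * tc 4 w) * (tc 5 w * tc 6 w) * (tc 7 w * tc 8 w)) := by ring
  conv_rhs => rw [e', tc_1_mul_tc_4 hw, tc_5_mul_tc_6 hw, tc_7_mul_tc_8 hw]
  calc br 1 4 w * (tc 6 w * tc 7 w)
      = (gc (fun x _ => x) 1 w * tc 6 w) * (gc (fun _ y => y) 4 w * tc 7 w)
        - (gc (fun _ y => y) 1 w * tc 6 w) * (gc (fun x _ => x) 4 w * tc 7 w) := by
        simp only [br]; ring
    _ = _ := by
      rw [gc_1_mul_tc_6 oddW_fst hw, gc_1_mul_tc_6 oddW_snd hw, gc_4_mul_tc_7 oddW_fst hw,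
        gc_4_mul_tc_7 oddW_snd hw]
      simp only [br] at e
      linear_combination (4 * (tc 4 ((2 : ℂ) • w) ^ 2 + tc 10 ((2 : ℂ) • w) ^ 2)) * e

theorem br_2_3 {w : ℂ × ℂ × ℂ} (hw : w ∈ UHS) :
    br 2 3 w = 1 / 4 * (tc 1 w * tc 4 w * tc 6 w * tc 7 w) := by
  obtain ⟨w₀, h₀⟩ := exists_mem_baseRegion
  refine br_eq_of_mul (k := 5) (l := 8) (differentiableOn_four _ _ _ _ _)
    (exists_tc_mul_tc_ne_zero 5 8 h₀ two_ne_zero two_ne_zero (tendsto_tc_01 h₀ rfl rfl rfl)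
      (tendsto_tc_10 h₀ rfl rfl rfl)) (fun w hw => ?_) hw
  have e := br_2_4 (w := (2 : ℂ) • w) (by simpa using two_smul_mem_UHS hw two_pos)
  have e' : 1 / 4 * (tc 1 w * tc 4 w * tc 6 w * tc 7 w) * (tc 5 w * tc 8 w)
    = 1 / 4 * ((tc 1 w * tc 4 w) * (tc 5 w * tc 6 w) * (tc 7 w * tc 8 w)) := by ring
  conv_rhs => rw [e', tc_1_mul_tc_4 hw, tc_5_mul_tc_6 hw, tc_7_mul_tc_8 hw]
  calc br 2 3 w * (tc 5 w * tc 8 w)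
      = (gc (fun x _ => x) 2 w * tc 5 w) * (gc (fun _ y => y) 3 w * tc 8 w)
        - (gc (fun _ y => y) 2 w * tc 5 w) * (gc (fun x _ => x) 3 w * tc 8 w) := by
        simp only [br]; ring
    _ = _ := by
      rw [gc_2_mul_tc_5 oddW_fst hw, gc_2_mul_tc_5 oddW_snd hw, gc_3_mul_tc_8 oddW_fst hw,
        gc_3_mul_tc_8 oddW_snd hw]
      simp only [br] at e
      linear_combination (4 * (tc 4 ((2 : ℂ) • w) ^ 2 + tc 10 ((2 : ℂ) • w) ^ 2)) * e


/-! ### Relations between the theta constants -/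

/-- Only squares of theta constants occur, so both sides become the same polynomial in the four
constants of index 1, 5, 7, 9 at 2τ. The relation merges the two bracket products in the first
wedge. -/
theorem tc_relation_cubic {w : ℂ × ℂ × ℂ} (hw : w ∈ UHS) :
    (tc 5 w * tc 8 w * tc 9 w) ^ 2 + (tc 6 w * tc 7 w * tc 10 w) ^ 2
      = tc 2 w ^ 2 * (tc 5 w ^ 4 - tc 6 w ^ 4) := by
  have e : (tc 5 w * tc 8 w * tc 9 w) ^ 2 + (tc 6 w * tc 7 w * tc 10 w) ^ 2
      - tc 2 w ^ 2 * (tc 5 w ^ 4 - tc 6 w ^ 4)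
    = (tc 5 w * tc 5 w) * (tc 8 w * tc 8 w) * (tc 9 w * tc 9 w)
      + (tc 6 w * tc 6 w) * (tc 7 w * tc 7 w) * (tc 10 w * tc 10 w)
      - (tc 2 w * tc 2 w) * ((tc 5 w * tc 5 w) ^ 2 - (tc 6 w * tc 6 w) ^ 2) := by ring
  rw [← sub_eq_zero, e, tc_5_mul_tc_5 hw, tc_8_mul_tc_8 hw, tc_9_mul_tc_9 hw, tc_6_mul_tc_6 hw,
    tc_7_mul_tc_7 hw, tc_10_mul_tc_10 hw, tc_2_mul_tc_2 hw]
  ring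

/-- Squaring the Riemann relation ϑ₃²ϑ₅² - ϑ₈²ϑ₁₀² = ϑ₁²ϑ₆² rewrites a product of squares through
fourth powers, whose behaviour under Γ[2] involves no character. -/
theorem tc_relation_quadratic {w : ℂ × ℂ × ℂ} (hw : w ∈ UHS) :
    2 * (tc 3 w ^ 2 * tc 5 w ^ 2 * tc 8 w ^ 2 * tc 10 w ^ 2)
      = tc 3 w ^ 4 * tc 5 w ^ 4 + tc 8 w ^ 4 * tc 10 w ^ 4 - tc 1 w ^ 4 * tc 6 w ^ 4 := by
  have h : tc 3 w ^ 2 * tc 5 w ^ 2 - tc 8 w ^ 2 * tc 10 w ^ 2 = tc 1 w ^ 2 * tc 6 w ^ 2 := by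
    simp only [pow_two]
    rw [tc_3_mul_tc_3 hw, tc_5_mul_tc_5 hw, tc_8_mul_tc_8 hw, tc_10_mul_tc_10 hw,
      tc_1_mul_tc_1 hw, tc_6_mul_tc_6 hw]
    ring
  linear_combination (-(tc 3 w ^ 2 * tc 5 w ^ 2 - tc 8 w ^ 2 * tc 10 w ^ 2)
    - tc 1 w ^ 2 * tc 6 w ^ 2) * h

/-! ### The wedge products -/

/-- The constant -4π² is (2πi)², one factor 2πi from each gradient. -/
theorem Gf_symMat (i j : ℕ) {w : ℂ × ℂ × ℂ} (hw : w ∈ UHS) :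
    Gf i j (symMat w) = (-4 * (Real.pi : ℂ) ^ 2 * ∏ k ∈ Finset.Icc 1 10 \ quadruple i j, tc k w) •
      sym2 ![gc (fun x _ => x) i w, gc (fun _ y => y) i w]
        ![gc (fun x _ => x) j w, gc (fun _ y => y) j w] := by
  have hI := Complex.I_sq
  rw [Gf, grad_symMat i hw, grad_symMat j hw]
  simp only [vt_symMat, gc]
  generalize wTheta (fun x _ => x) (oddChar i 0) (oddChar i 1) (oddChar i 2) (oddChar i 3) w = a
  generalize wTheta (fun _ y => y) (oddChar i 0) (oddChar i 1) (oddChar i 2) (oddChar i 3) w = b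
  generalize wTheta (fun x _ => x) (oddChar j 0) (oddChar j 1) (oddChar j 2) (oddChar j 3) w = c
  generalize wTheta (fun _ y => y) (oddChar j 0) (oddChar j 1) (oddChar j 2) (oddChar j 3) w = d
  generalize (∏ k ∈ Finset.Icc 1 10 \ quadruple i j, tc k w) = P
  ext l
  fin_cases l <;> simp [sym2]
  · linear_combination 4 * P * Real.pi ^ 2 * a * c * hI
  · linear_combination 4 * P * Real.pi ^ 2 * (a * d + b * c) * hI
  · linear_combination 4 * P * Real.pi ^ 2 * b * d * hI

theorem prod_compl_1_2 (f : ℕ → ℂ) : ∏ k ∈ Finset.Icc 1 10 \ quadruple 1 2, f k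
    = f 1 * f 2 * f 3 * f 4 * f 5 * f 6 := by
  rw [show Finset.Icc 1 10 \ quadruple 1 2 = {1, 2, 3, 4, 5, 6} by decide]
  simp; ring

theorem prod_compl_3_4 (f : ℕ → ℂ) : ∏ k ∈ Finset.Icc 1 10 \ quadruple 3 4, f k
    = f 1 * f 2 * f 3 * f 4 * f 7 * f 8 := by
  rw [show Finset.Icc 1 10 \ quadruple 3 4 = {1, 2, 3, 4, 7, 8} by decide]
  simp; ring

theorem prod_compl_5_6 (f : ℕ → ℂ) : ∏ k ∈ Finset.Icc 1 10 \ quadruple 5 6, f k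
    = f 1 * f 2 * f 3 * f 4 * f 9 * f 10 := by
  rw [show Finset.Icc 1 10 \ quadruple 5 6 = {1, 2, 3, 4, 9, 10} by decide]
  simp; ring

theorem prod_compl_1_3 (f : ℕ → ℂ) : ∏ k ∈ Finset.Icc 1 10 \ quadruple 1 3, f k
    = f 1 * f 4 * f 6 * f 8 * f 9 * f 10 := by
  rw [show Finset.Icc 1 10 \ quadruple 1 3 = {1, 4, 6, 8, 9, 10} by decide]
  simp; ring

theorem prod_compl_4_5 (f : ℕ → ℂ) : ∏ k ∈ Finset.Icc 1 10 \ quadruple 4 5, f k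
    = f 1 * f 3 * f 5 * f 6 * f 8 * f 10 := by
  rw [show Finset.Icc 1 10 \ quadruple 4 5 = {1, 3, 5, 6, 8, 10} by decide]
  simp; ring

theorem chi5_symMat (w : ℂ × ℂ × ℂ) : chi5 (symMat w) = tc 1 w * tc 2 w * tc 3 w * tc 4 w * tc 5 w
    * tc 6 w * tc 7 w * tc 8 w * tc 9 w * tc 10 w := by
  rw [chi5, show Finset.Icc 1 10 = {1, 2, 3, 4, 5, 6, 7, 8, 9, 10} by decide]
  simp [vt_symMat]; ring

/-- The determinant of three products of linear forms is [14][35][26] + [23][46][15] in terms of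
brackets. Rosenhain's formula leaves a common factor times the left side of `tc_relation_cubic`. -/
theorem wedge_12_34_56 {w : ℂ × ℂ × ℂ} (hw : w ∈ UHS) :
    wedge (Gf 1 2) (Gf 3 4) (Gf 5 6) (symMat w) = (Real.pi : ℂ) ^ 6 * chi5 (symMat w) *
      (tc 1 w * tc 2 w * tc 3 w * tc 4 w) ^ 4 * (tc 5 w ^ 4 - tc 6 w ^ 4) := by
  rw [wedge, Gf_symMat 1 2 hw, Gf_symMat 3 4 hw, Gf_symMat 5 6 hw, prod_compl_1_2, prod_compl_3_4,
    prod_compl_5_6, chi5_symMat]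
  have h : ∀ A B C : ℂ, Matrix.det
      !![A * (gc (fun x _ => x) 1 w * gc (fun x _ => x) 2 w),
        A * (gc (fun x _ => x) 1 w * gc (fun _ y => y) 2 w + gc (fun _ y => y) 1 w * gc (fun x _ => x) 2 w),
        A * (gc (fun _ y => y) 1 w * gc (fun _ y => y) 2 w);
        B * (gc (fun x _ => x) 3 w * gc (fun x _ => x) 4 w),
        B * (gc (fun x _ => x) 3 w * gc (fun _ y => y) 4 w + gc (fun _ y => y) 3 w * gc (fun x _ => x) 4 w),
        B * (gc (fun _ y => y) 3 w * gc (fun _ y => y) 4 w);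
        C * (gc (fun x _ => x) 5 w * gc (fun x _ => x) 6 w),
        C * (gc (fun x _ => x) 5 w * gc (fun _ y => y) 6 w + gc (fun _ y => y) 5 w * gc (fun x _ => x) 6 w),
        C * (gc (fun _ y => y) 5 w * gc (fun _ y => y) 6 w)]
      = A * B * C * (br 1 4 w * br 3 5 w * br 2 6 w + br 2 3 w * br 4 6 w * br 1 5 w) := by
    intro A B C
    simp only [br, Matrix.det_fin_three, Matrix.of_apply, Matrix.cons_val]
    ring
  simp only [Pi.smul_apply, sym2, Matrix.cons_val, smul_eq_mul]
  rw [h, br_1_4 hw, br_3_5 hw, br_2_6 hw, br_2_3 hw, br_4_6 hw, br_1_5 hw]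
  linear_combination (Real.pi : ℂ) ^ 6 * (tc 1 w * tc 2 w * tc 3 w * tc 4 w * tc 5 w
    * tc 6 w * tc 7 w * tc 8 w * tc 9 w * tc 10 w) * (tc 1 w * tc 3 w * tc 4 w) ^ 4 * tc 2 w ^ 2
    * tc_relation_cubic hw

/-- Two of the products share the factor G₁, so the determinant is the single product [23][14][15]
and no theta relation is needed. -/
theorem wedge_12_13_45 {w : ℂ × ℂ × ℂ} (hw : w ∈ UHS) :
    wedge (Gf 1 2) (Gf 1 3) (Gf 4 5) (symMat w) = (Real.pi : ℂ) ^ 6 * chi5 (symMat w) *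
      (tc 1 w ^ 4 * tc 4 w ^ 4 * tc 6 w ^ 4) *
      (tc 3 w ^ 2 * tc 5 w ^ 2 * tc 8 w ^ 2 * tc 10 w ^ 2) := by
  rw [wedge, Gf_symMat 1 2 hw, Gf_symMat 1 3 hw, Gf_symMat 4 5 hw, prod_compl_1_2, prod_compl_1_3,
    prod_compl_4_5, chi5_symMat]
  have h : ∀ A B C : ℂ, Matrix.det
      !![A * (gc (fun x _ => x) 1 w * gc (fun x _ => x) 2 w),
        A * (gc (fun x _ => x) 1 w * gc (fun _ y => y) 2 w + gc (fun _ y => y) 1 w * gc (fun x _ => x) 2 w),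
        A * (gc (fun _ y => y) 1 w * gc (fun _ y => y) 2 w);
        B * (gc (fun x _ => x) 1 w * gc (fun x _ => x) 3 w),
        B * (gc (fun x _ => x) 1 w * gc (fun _ y => y) 3 w + gc (fun _ y => y) 1 w * gc (fun x _ => x) 3 w),
        B * (gc (fun _ y => y) 1 w * gc (fun _ y => y) 3 w);
        C * (gc (fun x _ => x) 4 w * gc (fun x _ => x) 5 w),
        C * (gc (fun x _ => x) 4 w * gc (fun _ y => y) 5 w + gc (fun _ y => y) 4 w * gc (fun x _ => x) 5 w),
        C * (gc (fun _ y => y) 4 w * gc (fun _ y => y) 5 w)]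
      = A * B * C * (br 2 3 w * br 1 4 w * br 1 5 w) := by
    intro A B C
    simp only [br, Matrix.det_fin_three, Matrix.of_apply, Matrix.cons_val]
    ring
  simp only [Pi.smul_apply, sym2, Matrix.cons_val, smul_eq_mul]
  rw [h, br_2_3 hw, br_1_4 hw, br_1_5 hw]
  ring

/-- The three vectors lie in the subspace of multiples of G₁, which has dimension at most two. -/
theorem wedge_12_13_14 (τ : Matrix (Fin 2) (Fin 2) ℂ) : wedge (Gf 1 2) (Gf 1 3) (Gf 1 4) τ = 0 := by
  simp only [wedge, Gf, Pi.smul_apply, sym2, Matrix.cons_val, smul_eq_mul, Matrix.det_fin_three,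
    Matrix.of_apply]
  ring

/-- If all ten theta constants are nonzero then `G₁₂` does not vanish. -/
theorem Gf_1_2_ne_zero {w : ℂ × ℂ × ℂ} (hw : w ∈ UHS) (h : chi5 (symMat w) ≠ 0) :
    Gf 1 2 (symMat w) ≠ 0 := by
  rw [chi5_symMat] at h
  simp only [mul_ne_zero_iff] at h
  obtain ⟨⟨⟨⟨⟨⟨⟨⟨⟨h1, h2⟩, h3⟩, h4⟩, h5⟩, h6⟩, h7⟩, h8⟩, h9⟩, h10⟩ := h
  have hb : br 1 2 w ≠ 0 := by
    rw [br_1_2 hw]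
    simp [h7, h8, h9, h10]
  rw [Gf_symMat 1 2 hw, prod_compl_1_2]
  refine smul_ne_zero ?_ fun h0 => hb ?_
  · simp [h1, h2, h3, h4, h5, h6]
  · have e0 := congrFun h0 0
    have e1 := congrFun h0 1
    have e2 := congrFun h0 2
    simp only [sym2, Matrix.cons_val, Pi.zero_apply] at e0 e1 e2
    -- The discriminant of the product of two linear forms is the square of their bracket.
    have : br 1 2 w ^ 2 = 0 := by
      simp only [br]
      linear_combination
        (gc (fun x _ => x) 1 w * gc (fun _ y => y) 2 w + gc (fun _ y => y) 1 w * gc (fun x _ => x) 2 w) * e1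
        - 4 * gc (fun _ y => y) 1 w * gc (fun _ y => y) 2 w * e0
    exact pow_eq_zero_iff two_ne_zero |>.1 this

/-! ### Generation of the level subgroups of `Sp(4, ℤ)` -/

/-- The integral symplectic group of degree two. -/
abbrev SpZ : Type := Matrix.symplecticGroup (Fin 2) ℤ

local notation "SL2Z" => Matrix.SpecialLinearGroup (Fin 2) ℤ

theorem mem_symplectic_fromBlocks {A B C D : Matrix (Fin 2) (Fin 2) ℤ} :
    fromBlocks A B C D ∈ Matrix.symplecticGroup (Fin 2) ℤ ↔
      Aᵀ * C = Cᵀ * A ∧ Bᵀ * D = Dᵀ * B ∧ Aᵀ * D - Cᵀ * B = 1 := by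
  rw [SymplecticGroup.mem_iff', Matrix.J, fromBlocks_transpose, fromBlocks_multiply,
    fromBlocks_multiply, fromBlocks_inj]
  simp only [Matrix.mul_zero, Matrix.mul_neg, Matrix.mul_one, zero_add, add_zero, Matrix.neg_mul]
  constructor
  · rintro ⟨h1, h2, h3, h4⟩
    refine ⟨?_, ?_, ?_⟩
    · rw [← sub_eq_zero, ← neg_eq_zero, ← h1]; abel
    · rw [← sub_eq_zero, ← neg_eq_zero, ← h4]; abel
    · rw [← neg_inj, ← h2]; abel
  · rintro ⟨h1, h2, h3⟩
    have h3' : Dᵀ * A - Bᵀ * C = 1 := by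
      have := congrArg Matrix.transpose h3
      simpa [Matrix.transpose_mul] using this
    refine ⟨?_, ?_, ?_, ?_⟩
    · rw [h1]; abel
    · rw [← h3]; abel
    · rw [← h3']; abel
    · rw [h2]; abel

theorem SL2Z.det_eq (g : SL2Z) : g.1 0 0 * g.1 1 1 - g.1 0 1 * g.1 1 0 = 1 := by
  rw [← Matrix.det_fin_two]; exact g.2

/-- Evaluation of `4 × 4` matrix identities entry by entry. -/
theorem sp_ext {M N : Matrix (Fin 2 ⊕ Fin 2) (Fin 2 ⊕ Fin 2) ℤ}
    (h₁ : ∀ i j, M (Sum.inl i) (Sum.inl j) = N (Sum.inl i) (Sum.inl j))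
    (h₂ : ∀ i j, M (Sum.inl i) (Sum.inr j) = N (Sum.inl i) (Sum.inr j))
    (h₃ : ∀ i j, M (Sum.inr i) (Sum.inl j) = N (Sum.inr i) (Sum.inl j))
    (h₄ : ∀ i j, M (Sum.inr i) (Sum.inr j) = N (Sum.inr i) (Sum.inr j)) : M = N := by
  ext i j
  rcases i with i | i <;> rcases j with j | j
  exacts [h₁ i j, h₂ i j, h₃ i j, h₄ i j]

/-- `SL(2)` acting on the first and third coordinates. -/
def spFst : SL2Z →* SpZ := MonoidHom.mk'
  (fun g => ⟨fromBlocks !![g.1 0 0, 0; 0, 1] !![g.1 0 1, 0; 0, 0] !![g.1 1 0, 0; 0, 0]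
    !![g.1 1 1, 0; 0, 1], by
      have := SL2Z.det_eq g
      rw [mem_symplectic_fromBlocks]
      refine ⟨?_, ?_, ?_⟩ <;> ext i j <;> fin_cases i <;> fin_cases j <;>
        simp [Matrix.mul_apply, Fin.sum_univ_two] <;> linarith⟩)
  (fun g h => by
    apply Subtype.ext
    rw [Submonoid.coe_mul]
    simp only [fromBlocks_multiply]
    congr 1 <;> ext i j <;> fin_cases i <;> fin_cases j <;>
        simp [Matrix.mul_apply, Fin.sum_univ_two])

/-- `SL(2)` acting on the second and fourth coordinates. -/
def spSnd : SL2Z →* SpZ := MonoidHom.mk'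
  (fun g => ⟨fromBlocks !![1, 0; 0, g.1 0 0] !![0, 0; 0, g.1 0 1] !![0, 0; 0, g.1 1 0]
    !![1, 0; 0, g.1 1 1], by
      have := SL2Z.det_eq g
      rw [mem_symplectic_fromBlocks]
      refine ⟨?_, ?_, ?_⟩ <;> ext i j <;> fin_cases i <;> fin_cases j <;>
        simp [Matrix.mul_apply, Fin.sum_univ_two] <;> linarith⟩)
  (fun g h => by
    apply Subtype.ext
    rw [Submonoid.coe_mul]
    simp only [fromBlocks_multiply]
    congr 1 <;> ext i j <;> fin_cases i <;> fin_cases j <;>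
        simp [Matrix.mul_apply, Fin.sum_univ_two])

/-- `SL(2)` in the Levi subgroup. -/
def spLevi : SL2Z →* SpZ := MonoidHom.mk'
  (fun g => ⟨fromBlocks !![g.1 0 0, g.1 0 1; g.1 1 0, g.1 1 1] 0 0
    !![g.1 1 1, -g.1 1 0; -g.1 0 1, g.1 0 0], by
      have := SL2Z.det_eq g
      rw [mem_symplectic_fromBlocks]
      refine ⟨?_, ?_, ?_⟩ <;> ext i j <;> fin_cases i <;> fin_cases j <;>
        simp [Matrix.mul_apply, Fin.sum_univ_two] <;> linarith⟩)
  (fun g h => by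
    apply Subtype.ext
    rw [Submonoid.coe_mul]
    simp only [fromBlocks_multiply]
    congr 1 <;> ext i j <;> fin_cases i <;> fin_cases j <;>
        simp [Matrix.mul_apply, Fin.sum_univ_two] <;> ring)

/-- Translations. -/
def spTrans (a b c : ℤ) : SpZ := ⟨fromBlocks 1 !![a, b; b, c] 0 1, by
  rw [mem_symplectic_fromBlocks]
  refine ⟨?_, ?_, ?_⟩ <;> ext i j <;> fin_cases i <;> fin_cases j <;> simp⟩

/-- The exchange of the two coordinates. -/
def spSwap : SpZ := ⟨fromBlocks !![0, 1; 1, 0] 0 0 !![0, 1; 1, 0], by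
  rw [mem_symplectic_fromBlocks]
  refine ⟨?_, ?_, ?_⟩ <;> ext i j <;> fin_cases i <;> fin_cases j <;> simp [Matrix.mul_apply]⟩

/-- The sign change of the first coordinate. -/
def spSign : SpZ := ⟨fromBlocks !![-1, 0; 0, 1] 0 0 !![-1, 0; 0, 1], by
  rw [mem_symplectic_fromBlocks]
  refine ⟨?_, ?_, ?_⟩ <;> ext i j <;> fin_cases i <;> fin_cases j <;> simp [Matrix.mul_apply]⟩

/-- `SL(2)` acting on the first and fourth coordinates. -/
def spMix : SL2Z →* SpZ := MonoidHom.mk'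
  (fun g => ⟨fromBlocks !![g.1 0 0, 0; 0, g.1 0 0] !![0, g.1 0 1; g.1 0 1, 0]
    !![0, g.1 1 0; g.1 1 0, 0] !![g.1 1 1, 0; 0, g.1 1 1], by
      have := SL2Z.det_eq g
      rw [mem_symplectic_fromBlocks]
      refine ⟨?_, ?_, ?_⟩ <;> ext i j <;> fin_cases i <;> fin_cases j <;>
        simp [Matrix.mul_apply, Fin.sum_univ_two] <;> linarith⟩)
  (fun g h => by
    apply Subtype.ext
    rw [Submonoid.coe_mul]
    simp only [fromBlocks_multiply]
    congr 1 <;> ext i j <;> fin_cases i <;> fin_cases j <;>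
        simp [Matrix.mul_apply, Fin.sum_univ_two])

theorem spFst_val (g : SL2Z) : (spFst g).1 = fromBlocks !![g.1 0 0, 0; 0, 1] !![g.1 0 1, 0; 0, 0]
    !![g.1 1 0, 0; 0, 0] !![g.1 1 1, 0; 0, 1] := rfl

theorem spSnd_val (g : SL2Z) : (spSnd g).1 = fromBlocks !![1, 0; 0, g.1 0 0] !![0, 0; 0, g.1 0 1]
    !![0, 0; 0, g.1 1 0] !![1, 0; 0, g.1 1 1] := rfl

theorem spLevi_val (g : SL2Z) : (spLevi g).1 = fromBlocks !![g.1 0 0, g.1 0 1; g.1 1 0, g.1 1 1] 0 0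
    !![g.1 1 1, -g.1 1 0; -g.1 0 1, g.1 0 0] := rfl

theorem spMix_val (g : SL2Z) : (spMix g).1 = fromBlocks !![g.1 0 0, 0; 0, g.1 0 0]
    !![0, g.1 0 1; g.1 0 1, 0] !![0, g.1 1 0; g.1 1 0, 0] !![g.1 1 1, 0; 0, g.1 1 1] := rfl

theorem spTrans_val (a b c : ℤ) : (spTrans a b c).1 = fromBlocks 1 !![a, b; b, c] 0 1 := rfl

/-- Congruence to the identity modulo `N`. -/
def LevelN (N : ℕ) {n : Type*} [DecidableEq n] (M : Matrix n n ℤ) : Prop :=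
  ∀ i j, (N : ℤ) ∣ M i j - (1 : Matrix n n ℤ) i j

theorem LevelN.mul {N : ℕ} {n : Type*} [DecidableEq n] [Fintype n] {A B : Matrix n n ℤ}
    (hA : LevelN N A) (hB : LevelN N B) : LevelN N (A * B) := by
  have hm : ∀ M : Matrix n n ℤ, LevelN N M ↔ M.map (Int.castRingHom (ZMod N)) = 1 := by
    intro M
    rw [← Matrix.ext_iff]
    refine forall_congr' fun i => forall_congr' fun j => ?_
    rw [Matrix.map_apply, ← ZMod.intCast_zmod_eq_zero_iff_dvd, Int.cast_sub, sub_eq_zero]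
    simp [Matrix.one_apply, apply_ite (Int.cast : ℤ → ZMod N)]
  rw [hm] at *
  rw [Matrix.map_mul, hA, hB, one_mul]

theorem levelN_embed {N : ℕ} {g : SL2Z} (hg : LevelN N g.1) :
    LevelN N (spFst g).1 ∧ LevelN N (spSnd g).1 ∧ LevelN N (spLevi g).1 ∧ LevelN N (spMix g).1 := by
  have h0 := hg 0 0
  have h1 := hg 0 1
  have h2 := hg 1 0
  have h3 := hg 1 1
  simp at h0 h1 h2 h3
  refine ⟨?_, ?_, ?_, ?_⟩ <;> intro i j <;> rcases i with i | i <;> rcases j with j | j <;>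
    fin_cases i <;> fin_cases j <;>
    simp [spFst_val, spSnd_val, spLevi_val, spMix_val, h0, h1, h2, h3]

/-- Partial inversion in the second variable carries the Levi copy of SL(2) to the mixed one, so the
mixed elements need no separate treatment later. -/
theorem spMix_eq (g : SL2Z) : spMix g = spSnd ModularGroup.S * spLevi g * (spSnd ModularGroup.S)⁻¹ := by
  rw [eq_mul_inv_iff_mul_eq]
  apply Subtype.ext
  rw [Submonoid.coe_mul, Submonoid.coe_mul]
  simp only [spMix_val, spSnd_val, spLevi_val, fromBlocks_multiply]
  congr 1 <;> ext i j <;> fin_cases i <;> fin_cases j <;>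
    simp [ModularGroup.S]

/-- With d the greatest common divisor, the second row is (-y/d, x/d) and the first a Bézout pair.
At level two x/d is odd and y/d even, so the matrix can be corrected to be congruent to the
identity. -/
theorem exists_SL2_kill {N : ℕ} (hN : N = 1 ∨ N = 2) {x y : ℤ} (hx : (N : ℤ) ∣ x - 1)
    (hy : (N : ℤ) ∣ y) : ∃ g : SL2Z, LevelN N g.1 ∧ g.1 1 0 * x + g.1 1 1 * y = 0 := by
  by_cases h0 : x = 0 ∧ y = 0
  · refine ⟨1, fun i j => by simp, by simp [h0]⟩
  have hg : Int.gcd x y ≠ 0 := by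
    rw [Ne, Int.gcd_eq_zero_iff]; exact h0
  obtain ⟨x', hx'⟩ := Int.gcd_dvd_left x y
  obtain ⟨y', hy'⟩ := Int.gcd_dvd_right x y
  have hg' : ((Int.gcd x y : ℕ) : ℤ) ≠ 0 := by exact_mod_cast hg
  have hbez := Int.gcd_eq_gcd_ab x y
  set u := Int.gcdA x y
  set v := Int.gcdB x y
  set d := ((Int.gcd x y : ℕ) : ℤ)
  have hcop : x' * u + y' * v = 1 := by
    apply mul_left_cancel₀ hg'
    calc d * (x' * u + y' * v) = (d * x') * u + (d * y') * v := by ring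
      _ = d * 1 := by rw [← hx', ← hy', mul_one]; exact hbez.symm
  rcases hN with rfl | rfl
  · refine ⟨⟨!![u, v; -y', x'], ?_⟩, fun i j => by simp, ?_⟩
    · rw [Matrix.det_fin_two_of]; linarith
    · simp
      rw [hx', hy']; ring
  · have hxo : Odd x := by
      obtain ⟨k, hk⟩ := hx; exact ⟨k, by push_cast at hk; linarith⟩
    have hye : Even y := even_iff_two_dvd.2 (by exact_mod_cast hy)
    have hdo : Odd d ∧ Odd x' := Int.odd_mul.1 (hx' ▸ hxo)
    have hy'e : Even y' := by
      rcases Int.even_mul.1 (hy' ▸ hye) with h | h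
      · exact absurd h (Int.not_even_iff_odd.2 hdo.1)
      · exact h
    -- Replacing the Bézout pair (u, v) by (u + ty', v - tx') keeps the determinant; as x' is odd, t
    -- can be chosen to make the second entry even. The determinant then forces the first entry to
    -- be odd.
    obtain ⟨t, ht⟩ : ∃ t, Even (v - t * x') := by
      rcases Int.even_or_odd v with h | h
      · exact ⟨0, by simpa using h⟩
      · exact ⟨1, by rw [one_mul]; exact h.sub_odd hdo.2⟩
    have hdet : (u + t * y') * x' - (v - t * x') * -y' = 1 := by linarith
    have hodd : Odd (u + t * y') := by
      have : Odd ((u + t * y') * x') := by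
        have e : (u + t * y') * x' = 1 + (v - t * x') * -y' := by linarith
        rw [e]
        exact odd_one.add_even (ht.mul_right _)
      exact (Int.odd_mul.1 this).1
    refine ⟨⟨!![u + t * y', v - t * x'; -y', x'], ?_⟩, ?_, ?_⟩
    · rw [Matrix.det_fin_two_of]; linarith
    · intro i j
      fin_cases i <;> fin_cases j <;> simp only [Nat.cast_ofNat] <;> simp
      · exact (hodd.sub_odd odd_one).two_dvd
      · exact ht.two_dvd
      · exact hy'e.two_dvd
      · exact (hdo.2.sub_odd odd_one).two_dvd
    · simp
      rw [hx', hy']; ring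

/-- The pairing relations between the columns of a symplectic matrix. -/
theorem sp_pairing (M : SpZ) (i j : Fin 2 ⊕ Fin 2) :
    M.1 (Sum.inl 0) i * M.1 (Sum.inr 0) j - M.1 (Sum.inr 0) i * M.1 (Sum.inl 0) j
    + (M.1 (Sum.inl 1) i * M.1 (Sum.inr 1) j - M.1 (Sum.inr 1) i * M.1 (Sum.inl 1) j)
    = -Matrix.J (Fin 2) ℤ i j := by
  have h := congrFun (congrFun (SymplecticGroup.mem_iff'.1 M.2) i) j
  simp [Matrix.mul_apply, Fintype.sum_sum_type, Fin.sum_univ_two, Matrix.J, Matrix.one_apply] at h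
  simp only [Matrix.J]
  rw [← h]
  ring

/-- When the first column is that of the identity, the pairing relations force the third row to be
(0, 0, 1, 0) and the middle block to have determinant one. What remains is an explicit product of an
`spSnd`, a unipotent Levi element and a translation. -/
theorem mem_of_col {N : ℕ} {H : Subgroup SpZ}
    (h₂ : ∀ g : SL2Z, LevelN N g.1 → spSnd g ∈ H)
    (h₃ : ∀ g : SL2Z, LevelN N g.1 → spLevi g ∈ H)
    (hT : ∀ a b : ℤ, (N : ℤ) ∣ a → (N : ℤ) ∣ b → spTrans a b 0 ∈ H)
    (M : SpZ) (hM : LevelN N M.1) (c0 : M.1 (Sum.inl 0) (Sum.inl 0) = 1)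
    (c1 : M.1 (Sum.inl 1) (Sum.inl 0) = 0) (c2 : M.1 (Sum.inr 0) (Sum.inl 0) = 0)
    (c3 : M.1 (Sum.inr 1) (Sum.inl 0) = 0) : M ∈ H := by
  have p1 := sp_pairing M (Sum.inl 0) (Sum.inl 1)
  have p2 := sp_pairing M (Sum.inl 0) (Sum.inr 0)
  have p3 := sp_pairing M (Sum.inl 0) (Sum.inr 1)
  have p4 := sp_pairing M (Sum.inl 1) (Sum.inr 1)
  have p5 := sp_pairing M (Sum.inl 1) (Sum.inr 0)
  have p6 := sp_pairing M (Sum.inr 1) (Sum.inr 0)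
  simp [Matrix.J, c0, c1, c2, c3] at p1 p2 p3
  simp [Matrix.J, p1, p2, p3] at p4 p5 p6
  have l11 := hM (Sum.inl 1) (Sum.inl 1)
  have l13 := hM (Sum.inl 1) (Sum.inr 1)
  have l31 := hM (Sum.inr 1) (Sum.inl 1)
  have l33 := hM (Sum.inr 1) (Sum.inr 1)
  have lx := hM (Sum.inl 0) (Sum.inl 1)
  have lz := hM (Sum.inl 0) (Sum.inr 0)
  have lw := hM (Sum.inl 0) (Sum.inr 1)
  simp at l11 l13 l31 l33 lx lz lw
  generalize ha : M.1 (Sum.inl 1) (Sum.inl 1) = a at *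
  generalize hb : M.1 (Sum.inl 1) (Sum.inr 1) = b at *
  generalize hc : M.1 (Sum.inr 1) (Sum.inl 1) = c at *
  generalize hd : M.1 (Sum.inr 1) (Sum.inr 1) = d at *
  generalize hx : M.1 (Sum.inl 0) (Sum.inl 1) = x at *
  generalize hz : M.1 (Sum.inl 0) (Sum.inr 0) = z at *
  generalize hw : M.1 (Sum.inl 0) (Sum.inr 1) = w at *
  generalize hm : M.1 (Sum.inl 1) (Sum.inr 0) = m at *
  generalize hn : M.1 (Sum.inr 1) (Sum.inr 0) = n at *
  let g : SL2Z := ⟨!![a, b; c, d], by rw [Matrix.det_fin_two_of]; linarith⟩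
  let u : SL2Z := ⟨!![1, x; 0, 1], by rw [Matrix.det_fin_two_of]; ring⟩
  have hg : LevelN N g.1 := by
    intro i j; fin_cases i <;> fin_cases j <;> simp [g, *]
  have hu : LevelN N u.1 := by
    intro i j; fin_cases i <;> fin_cases j <;> simp [u, *]
  have key : M = spSnd g * (spLevi u * spTrans (z - x * w) w 0) := by
    apply Subtype.ext
    rw [Submonoid.coe_mul, Submonoid.coe_mul, spSnd_val, spLevi_val, spTrans_val,
      fromBlocks_multiply, fromBlocks_multiply]
    -- The two entries m and n of the third column that are still free are determined by its
    -- pairings with the second and fourth columns.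
    have hm' : m = a * w - b * x := by linear_combination (-m) * p4 + b * p5 - a * p6
    have hn' : n = c * w - d * x := by linear_combination (-n) * p4 + d * p5 - c * p6
    apply sp_ext <;> intro i j <;> fin_cases i <;> fin_cases j <;>
      simp [g, u, *] <;> ring
  rw [key]
  exact H.mul_mem (h₂ g hg) (H.mul_mem (h₃ u hu) (hT _ _ (dvd_sub lz (lw.mul_left _)) lw))

/-- After the second entry is killed, applying the inverse matrix shows both x and y to be multiples
of the first entry. -/
theorem exists_SL2_gcd {N : ℕ} (hN : N = 1 ∨ N = 2) {x y : ℤ} (hx : (N : ℤ) ∣ x - 1)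
    (hy : (N : ℤ) ∣ y) : ∃ g : SL2Z, LevelN N g.1 ∧ g.1 0 0 * x + g.1 0 1 * y ∣ x ∧
      g.1 0 0 * x + g.1 0 1 * y ∣ y := by
  obtain ⟨g, hg, h⟩ := exists_SL2_kill hN hx hy
  have hd := SL2Z.det_eq g
  refine ⟨g, hg, ⟨g.1 1 1, ?_⟩, ⟨-g.1 1 0, ?_⟩⟩
  · linear_combination (-x) * hd - g.1 0 1 * h
  · linear_combination (-y) * hd + g.1 0 0 * h

theorem Int.natAbs_lt_of_dvd {x y d : ℤ} (hx : x ≠ 0) (h₁ : d ∣ x) (h₂ : d ∣ y) (h : ¬ x ∣ y) :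
    d ≠ 0 ∧ d.natAbs < x.natAbs := by
  refine ⟨fun h0 => hx (by simpa [h0] using h₁), ?_⟩
  refine lt_of_le_of_ne (Nat.le_of_dvd (Int.natAbs_pos.2 hx) (Int.natAbs_dvd_natAbs.2 h₁)) fun e => h ?_
  have : x ∣ d := Int.natAbs_dvd_natAbs.1 (by rw [e])
  exact this.trans h₂

/-- The lower unipotent elements of `SL(2, ℤ)`. -/
def lowerSL (r : ℤ) : SL2Z := ⟨!![1, 0; r, 1], by rw [Matrix.det_fin_two_of]; ring⟩

theorem lowerSL_val (r : ℤ) : (lowerSL r).1 = !![1, 0; r, 1] := rfl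

theorem levelN_lowerSL {N : ℕ} {r : ℤ} (h : (N : ℤ) ∣ r) : LevelN N (lowerSL r).1 := by
  intro i j; fin_cases i <;> fin_cases j <;> simp [lowerSL, h]

theorem levelN_spSign {N : ℕ} (hN : N = 1 ∨ N = 2) : LevelN N spSign.1 := by
  rcases hN with rfl | rfl
  · intro i j; simp
  · intro i j; rcases i with i | i <;> rcases j with j | j <;> fin_cases i <;> fin_cases j <;>
      simp [spSign]

section LevelGeneration

variable {N : ℕ} {H : Subgroup SpZ}

/-- A corner equal to 1 lets lower unipotent elements of level N clear the rest of the first column,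
leaving the situation of `mem_of_col`. -/
theorem mem_of_corner_one
    (h₁ : ∀ g : SL2Z, LevelN N g.1 → spFst g ∈ H)
    (h₂ : ∀ g : SL2Z, LevelN N g.1 → spSnd g ∈ H)
    (h₃ : ∀ g : SL2Z, LevelN N g.1 → spLevi g ∈ H)
    (h₄ : ∀ g : SL2Z, LevelN N g.1 → spMix g ∈ H)
    (hT : ∀ a b : ℤ, (N : ℤ) ∣ a → (N : ℤ) ∣ b → spTrans a b 0 ∈ H)
    (M : SpZ) (hM : LevelN N M.1) (h : M.1 (Sum.inl 0) (Sum.inl 0) = 1) : M ∈ H := by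
  have d1 := hM (Sum.inl 1) (Sum.inl 0)
  have d2 := hM (Sum.inr 0) (Sum.inl 0)
  have d3 := hM (Sum.inr 1) (Sum.inl 0)
  simp at d1 d2 d3
  generalize ha : M.1 (Sum.inl 1) (Sum.inl 0) = a at *
  generalize hb : M.1 (Sum.inr 0) (Sum.inl 0) = b at *
  generalize hc : M.1 (Sum.inr 1) (Sum.inl 0) = c at *
  have l1 := levelN_lowerSL ((dvd_neg (α := ℤ)).2 d1)
  have l2 := levelN_lowerSL ((dvd_neg (α := ℤ)).2 d3)
  -- The Levi element that removes a also acts on the lower half of the column and turns b into b +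
  -- ac.
  have l3 := levelN_lowerSL ((dvd_neg (α := ℤ)).2 (d2.add (d1.mul_right c)))
  set K := spFst (lowerSL (-(b + a * c))) * (spMix (lowerSL (-c)) * (spLevi (lowerSL (-a)) * M))
    with hK
  have hKH : K ∈ H := by
    refine mem_of_col h₂ h₃ hT K ((levelN_embed l3).1.mul ((levelN_embed l2).2.2.2.mul
      ((levelN_embed l1).2.2.1.mul hM))) ?_ ?_ ?_ ?_ <;>
    rw [hK, Submonoid.coe_mul, Submonoid.coe_mul, Submonoid.coe_mul, spFst_val, spLevi_val,
      spMix_val, lowerSL_val, lowerSL_val, lowerSL_val] <;>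
    simp [Matrix.mul_apply, Fintype.sum_sum_type, Fin.sum_univ_two, h, ha, hb, hc]
  have e : M = (spLevi (lowerSL (-a)))⁻¹ * ((spMix (lowerSL (-c)))⁻¹ *
      ((spFst (lowerSL (-(b + a * c))))⁻¹ * K)) := by rw [hK]; group
  rw [e]
  exact H.mul_mem (H.inv_mem (h₃ _ l1)) (H.mul_mem (H.inv_mem (h₄ _ l2))
    (H.mul_mem (H.inv_mem (h₁ _ l3)) hKH))

/-- Euclidean descent on the size of the corner. If it fails to divide an entry of its column, an
elementary element replaces it by a proper divisor. If it divides all of them, the pairing relation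
makes it a unit; the sign -1 is removed by `spSign`. -/
theorem mem_of_corner_ne_zero (hN : N = 1 ∨ N = 2)
    (h₁ : ∀ g : SL2Z, LevelN N g.1 → spFst g ∈ H)
    (h₂ : ∀ g : SL2Z, LevelN N g.1 → spSnd g ∈ H)
    (h₃ : ∀ g : SL2Z, LevelN N g.1 → spLevi g ∈ H)
    (h₄ : ∀ g : SL2Z, LevelN N g.1 → spMix g ∈ H)
    (hT : ∀ a b : ℤ, (N : ℤ) ∣ a → (N : ℤ) ∣ b → spTrans a b 0 ∈ H) (hS : spSign ∈ H)
    (n : ℕ) : ∀ (M : SpZ), LevelN N M.1 → M.1 (Sum.inl 0) (Sum.inl 0) ≠ 0 →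
      (M.1 (Sum.inl 0) (Sum.inl 0)).natAbs = n → M ∈ H := by
  induction n using Nat.strong_induction_on with
  | _ n ih =>
  intro M hM h0 hn
  have reduce : ∀ (K : SpZ), K ∈ H → LevelN N K.1 → (K * M).1 (Sum.inl 0) (Sum.inl 0) ≠ 0 ∧
      ((K * M).1 (Sum.inl 0) (Sum.inl 0)).natAbs < (M.1 (Sum.inl 0) (Sum.inl 0)).natAbs → M ∈ H := by
    intro K hK hKl h
    have := ih _ (hn ▸ h.2) (K * M) (hKl.mul hM) h.1 rfl
    exact (H.mul_mem_cancel_left hK).1 this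
  have d0 := hM (Sum.inl 0) (Sum.inl 0)
  have d1 := hM (Sum.inl 1) (Sum.inl 0)
  have d2 := hM (Sum.inr 0) (Sum.inl 0)
  have d3 := hM (Sum.inr 1) (Sum.inl 0)
  simp at d0 d1 d2 d3
  by_cases e1 : M.1 (Sum.inl 0) (Sum.inl 0) ∣ M.1 (Sum.inl 1) (Sum.inl 0)
  swap
  · obtain ⟨g, hg, a, b⟩ := exists_SL2_gcd hN d0 d1
    refine reduce (spLevi g) (h₃ g hg) (levelN_embed hg).2.2.1 ?_
    have := Int.natAbs_lt_of_dvd h0 a b e1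
    rw [Submonoid.coe_mul, spLevi_val]
    simpa [Matrix.mul_apply, Fintype.sum_sum_type, Fin.sum_univ_two] using this
  by_cases e2 : M.1 (Sum.inl 0) (Sum.inl 0) ∣ M.1 (Sum.inr 0) (Sum.inl 0)
  swap
  · obtain ⟨g, hg, a, b⟩ := exists_SL2_gcd hN d0 d2
    refine reduce (spFst g) (h₁ g hg) (levelN_embed hg).1 ?_
    have := Int.natAbs_lt_of_dvd h0 a b e2
    rw [Submonoid.coe_mul, spFst_val]
    simpa [Matrix.mul_apply, Fintype.sum_sum_type, Fin.sum_univ_two] using this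
  by_cases e3 : M.1 (Sum.inl 0) (Sum.inl 0) ∣ M.1 (Sum.inr 1) (Sum.inl 0)
  swap
  · obtain ⟨g, hg, a, b⟩ := exists_SL2_gcd hN d0 d3
    refine reduce (spMix g) (h₄ g hg) (levelN_embed hg).2.2.2 ?_
    have := Int.natAbs_lt_of_dvd h0 a b e3
    rw [Submonoid.coe_mul, spMix_val]
    simpa [Matrix.mul_apply, Fintype.sum_sum_type, Fin.sum_univ_two] using this
  have hp := sp_pairing M (Sum.inl 0) (Sum.inr 0)
  simp [Matrix.J] at hp
  have hu : M.1 (Sum.inl 0) (Sum.inl 0) ∣ 1 := by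
    rw [← hp]
    exact dvd_add (dvd_sub (Dvd.intro _ rfl) (e2.mul_right _)) (dvd_sub (e1.mul_right _) (e3.mul_right _))
  rcases Int.isUnit_iff.1 (isUnit_of_dvd_one hu) with h | h
  · exact mem_of_corner_one h₁ h₂ h₃ h₄ hT M hM h
  · refine (H.mul_mem_cancel_left hS).1
      (mem_of_corner_one h₁ h₂ h₃ h₄ hT (spSign * M) ((levelN_spSign hN).mul hM) ?_)
    rw [Submonoid.coe_mul]
    simp [spSign, Matrix.mul_apply, Fintype.sum_sum_type, Fin.sum_univ_two, h]

/-- A subgroup of `Sp(4, ℤ)` containing the elementary elements of level `N` contains the whole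
level subgroup. -/
theorem mem_of_levelN (hN : N = 1 ∨ N = 2)
    (h₁ : ∀ g : SL2Z, LevelN N g.1 → spFst g ∈ H)
    (h₂ : ∀ g : SL2Z, LevelN N g.1 → spSnd g ∈ H)
    (h₃ : ∀ g : SL2Z, LevelN N g.1 → spLevi g ∈ H)
    (h₄ : ∀ g : SL2Z, LevelN N g.1 → spMix g ∈ H)
    (hT : ∀ a b : ℤ, (N : ℤ) ∣ a → (N : ℤ) ∣ b → spTrans a b 0 ∈ H) (hS : spSign ∈ H)
    (M : SpZ) (hM : LevelN N M.1) : M ∈ H := by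
  have base : ∀ K : SpZ, LevelN N K.1 → K.1 (Sum.inl 0) (Sum.inl 0) ≠ 0 → K ∈ H :=
    fun K hK h => mem_of_corner_ne_zero hN h₁ h₂ h₃ h₄ hT hS _ K hK h rfl
  -- A zero corner, possible only at level one, is replaced by the greatest common divisor of itself
  -- and a nonzero entry of the first column.
  by_cases h0 : M.1 (Sum.inl 0) (Sum.inl 0) = 0
  swap
  · exact base M hM h0
  have reduce : ∀ (K : SpZ), K ∈ H → LevelN N K.1 → (K * M).1 (Sum.inl 0) (Sum.inl 0) ≠ 0 → M ∈ H :=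
    fun K hK hKl h => (H.mul_mem_cancel_left hK).1 (base (K * M) (hKl.mul hM) h)
  have d0 := hM (Sum.inl 0) (Sum.inl 0)
  have d1 := hM (Sum.inl 1) (Sum.inl 0)
  have d2 := hM (Sum.inr 0) (Sum.inl 0)
  have d3 := hM (Sum.inr 1) (Sum.inl 0)
  simp at d0 d1 d2 d3
  by_cases e1 : M.1 (Sum.inl 1) (Sum.inl 0) = 0
  swap
  · obtain ⟨g, hg, a, b⟩ := exists_SL2_gcd hN d0 d1
    refine reduce (spLevi g) (h₃ g hg) (levelN_embed hg).2.2.1 fun h => e1 ?_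
    rw [Submonoid.coe_mul, spLevi_val] at h
    simp [Matrix.mul_apply, Fintype.sum_sum_type, Fin.sum_univ_two] at h
    rw [h] at b; exact zero_dvd_iff.1 b
  by_cases e2 : M.1 (Sum.inr 0) (Sum.inl 0) = 0
  swap
  · obtain ⟨g, hg, a, b⟩ := exists_SL2_gcd hN d0 d2
    refine reduce (spFst g) (h₁ g hg) (levelN_embed hg).1 fun h => e2 ?_
    rw [Submonoid.coe_mul, spFst_val] at h
    simp [Matrix.mul_apply, Fintype.sum_sum_type, Fin.sum_univ_two] at h
    rw [h] at b; exact zero_dvd_iff.1 b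
  · obtain ⟨g, hg, a, b⟩ := exists_SL2_gcd hN d0 d3
    -- With the other three entries of the column zero, this pairing can equal 1 only if the last
    -- entry is nonzero.
    have hp := sp_pairing M (Sum.inl 0) (Sum.inr 0)
    simp [Matrix.J, h0, e1, e2] at hp
    refine reduce (spMix g) (h₄ g hg) (levelN_embed hg).2.2.2 fun h => ?_
    rw [Submonoid.coe_mul, spMix_val] at h
    simp [Matrix.mul_apply, Fintype.sum_sum_type, Fin.sum_univ_two] at h
    rw [h, zero_dvd_iff] at b
    rw [b] at hp
    simp at hp

end LevelGeneration

/-! ### Generators of `SL(2)` of level two -/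

/-- The upper unipotent elements of `SL(2, ℤ)`. -/
def upperSL (r : ℤ) : SL2Z := ⟨!![1, r; 0, 1], by rw [Matrix.det_fin_two_of]; ring⟩

theorem upperSL_val (r : ℤ) : (upperSL r).1 = !![1, r; 0, 1] := rfl

theorem upperSL_mul (a b : ℤ) : upperSL a * upperSL b = upperSL (a + b) := by
  apply Subtype.ext
  rw [Matrix.SpecialLinearGroup.coe_mul, upperSL_val, upperSL_val, upperSL_val]
  simp [add_comm]

theorem lowerSL_mul (a b : ℤ) : lowerSL a * lowerSL b = lowerSL (a + b) := by
  apply Subtype.ext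
  rw [Matrix.SpecialLinearGroup.coe_mul, lowerSL_val, lowerSL_val, lowerSL_val]
  simp

theorem mem_of_additive {G : Type*} [Group G] {H : Subgroup G} (f : ℤ → G)
    (hf : ∀ a b, f a * f b = f (a + b)) {c : ℤ} (h : f c ∈ H) (k : ℤ) : f (k * c) ∈ H := by
  have h0 : f 0 = 1 := by
    have := hf 0 0
    rw [add_zero] at this
    exact mul_eq_left.1 this
  have : f (k * c) = f c ^ k := by
    induction k using Int.induction_on with
    | zero => simp [h0]
    | succ n ih => rw [add_mul, one_mul, ← hf, ih, _root_.zpow_add_one]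
    | pred n ih =>
      rw [_root_.zpow_sub_one, ← ih, eq_mul_inv_iff_mul_eq, hf]
      congr 1; ring
  rw [this]
  exact H.zpow_mem h k

theorem Int.exists_centered (a : ℤ) {b : ℤ} (hb : b ≠ 0) : ∃ k : ℤ, |a + k * 2 * b| ≤ |b| := by
  have hpos : 0 < 2 * |b| := by positivity
  have h1 := Int.emod_nonneg (a + |b|) hpos.ne'
  have h2 := Int.emod_lt_of_pos (a + |b|) hpos
  have h3 := Int.emod_add_mul_ediv (a + |b|) (2 * |b|)
  generalize (a + |b|) / (2 * |b|) = q at h3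
  generalize (a + |b|) % (2 * |b|) = r at h1 h2 h3
  have key : |a - q * 2 * (|b|)| ≤ |b| := by
    rw [abs_le]
    constructor <;> linarith
  rcases abs_choice b with h | h
  · refine ⟨-q, ?_⟩
    rw [show a + -q * 2 * b = a - q * 2 * b by ring]
    nth_rw 1 [h] at key
    exact key
  · refine ⟨q, ?_⟩
    nth_rw 1 [h] at key
    rwa [show a - q * 2 * -b = a + q * 2 * b by ring] at key

/-- The Euclidean algorithm on the first column (a, c) with even quotients. Reduction of a modulo 2c
followed by reduction of c modulo 2a strictly decreases |c|, and the case c = 0 consists of ± upper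
unipotent elements. -/
theorem mem_of_level_two {H : Subgroup SL2Z} (hT : upperSL 2 ∈ H) (hL : lowerSL 2 ∈ H)
    (hneg : (-1 : SL2Z) ∈ H) (g : SL2Z) (hg : LevelN 2 g.1) : g ∈ H := by
  have hT' := fun k => mem_of_additive upperSL upperSL_mul hT k
  have hL' := fun k => mem_of_additive lowerSL lowerSL_mul hL k
  have main : ∀ n : ℕ, ∀ g : SL2Z, LevelN 2 g.1 → (g.1 1 0).natAbs = n → g ∈ H := by
    intro n
    induction n using Nat.strong_induction_on with
    | _ n ih =>
    intro g hg hn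
    have hd := SL2Z.det_eq g
    have l0 := hg 0 0
    have l1 := hg 0 1
    have l2 := hg 1 0
    simp at l0 l1 l2
    by_cases h0 : g.1 1 0 = 0
    · rw [h0, mul_zero, sub_zero] at hd
      obtain ⟨k, hk⟩ := l1
      rcases Int.mul_eq_one_iff_eq_one_or_neg_one.1 hd with ⟨e1, e2⟩ | ⟨e1, e2⟩
      · have : g = upperSL (k * 2) := by
          apply Subtype.ext
          rw [upperSL_val, Matrix.eta_fin_two g.1, h0, e1, e2, hk]
          rw [mul_comm]
        rw [this]; exact hT' k
      · have : g = -1 * upperSL (-k * 2) := by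
          apply Subtype.ext
          rw [neg_one_mul, Matrix.SpecialLinearGroup.coe_neg, upperSL_val,
            Matrix.eta_fin_two g.1, h0, e1, e2, hk]
          ext i j; fin_cases i <;> fin_cases j <;> simp [mul_comm]
        rw [this]; exact H.mul_mem hneg (hT' _)
    · obtain ⟨k, hk⟩ := Int.exists_centered (g.1 0 0) h0
      -- Equality is excluded by parity: the left entry is odd and the right one even.
      have hlt : |g.1 0 0 + k * 2 * g.1 1 0| < |g.1 1 0| := by
        refine lt_of_le_of_ne hk fun e => ?_
        obtain ⟨u, hu⟩ := l0
        obtain ⟨v, hv⟩ := l2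
        rw [hv] at e
        have e4 : k * 2 * (2 * v) = 4 * (k * v) := by ring
        rw [e4] at e
        rcases abs_eq_abs.1 e with e | e
        · omega
        · omega
      have hp0 : g.1 0 0 + k * 2 * g.1 1 0 ≠ 0 := by
        intro e
        obtain ⟨u, hu⟩ := l0
        have : g.1 0 0 = 2 * (-(k * g.1 1 0)) := by linarith
        omega
      obtain ⟨l, hl⟩ := Int.exists_centered (g.1 1 0) hp0
      set g' := lowerSL (l * 2) * (upperSL (k * 2) * g) with hg'
      have e10 : g'.1 1 0 = g.1 1 0 + l * 2 * (g.1 0 0 + k * 2 * g.1 1 0) := by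
        rw [hg', Matrix.SpecialLinearGroup.coe_mul, Matrix.SpecialLinearGroup.coe_mul]
        rw [Matrix.mul_apply, Fin.sum_univ_two, Matrix.mul_apply, Fin.sum_univ_two,
          Matrix.mul_apply, Fin.sum_univ_two, lowerSL_val, upperSL_val]
        simp
        ring
      have hlev : LevelN 2 g'.1 := by
        rw [hg', Matrix.SpecialLinearGroup.coe_mul, Matrix.SpecialLinearGroup.coe_mul]
        refine (levelN_lowerSL (Dvd.intro_left _ rfl)).mul (LevelN.mul ?_ hg)
        intro i j; fin_cases i <;> fin_cases j <;> simp [upperSL]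
      have hmem : g' ∈ H := by
        refine ih _ ?_ g' hlev rfl
        rw [← hn, e10]
        have := hl.trans_lt hlt
        rw [Int.abs_eq_natAbs, Int.abs_eq_natAbs] at this
        exact_mod_cast this
      exact (H.mul_mem_cancel_left (hT' k)).1 ((H.mul_mem_cancel_left (hL' l)).1 hmem)
  exact main _ g hg rfl

/-! ### The action of `Sp(4, ℤ)` on the upper half space -/

theorem im_star_dotProduct {τ : Matrix (Fin 2) (Fin 2) ℂ} (hs : τᵀ = τ) (v : Fin 2 → ℂ) :
    (star v ⬝ᵥ τ *ᵥ v).im =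
      (fun i => (v i).re) ⬝ᵥ τ.map Complex.im *ᵥ (fun i => (v i).re) +
      (fun i => (v i).im) ⬝ᵥ τ.map Complex.im *ᵥ (fun i => (v i).im) := by
  have h : τ 1 0 = τ 0 1 := congrFun (congrFun hs 0) 1
  simp [dotProduct, mulVec, Fin.sum_univ_two, h]
  ring

theorem mem_H2_iff {τ : Matrix (Fin 2) (Fin 2) ℂ} :
    τ ∈ H2 ↔ τᵀ = τ ∧ ∀ v ≠ 0, 0 < (star v ⬝ᵥ τ *ᵥ v).im := by
  constructor
  · rintro ⟨hs, hp⟩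
    refine ⟨hs, fun v hv => ?_⟩
    rw [im_star_dotProduct hs]
    by_cases h : (fun i => (v i).re) = 0
    · have h' : (fun i => (v i).im) ≠ 0 := by
        intro h'
        exact hv (funext fun i => Complex.ext (congrFun h i) (congrFun h' i))
      have := hp.dotProduct_mulVec_pos h'
      rw [h]
      simpa using this
    · have h1 := hp.dotProduct_mulVec_pos h
      have h2 := hp.posSemidef.dotProduct_mulVec_nonneg (fun i => (v i).im)
      simp only [star_trivial] at h1 h2
      linarith
  · rintro ⟨hs, hp⟩
    refine ⟨hs, Matrix.PosDef.of_dotProduct_mulVec_pos ?_ fun x hx => ?_⟩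
    · ext i j
      exact congrArg Complex.im (congrFun (congrFun hs i) j)
    · have := hp (fun i => (x i : ℂ)) fun h => hx (funext fun i => by
        simpa using congrFun h i)
      rw [im_star_dotProduct hs] at this
      have e : (fun _ : Fin 2 => (0 : ℝ)) = 0 := rfl
      simpa [e] using this

/-- Extension of scalars from `ℤ` to `ℂ`. -/
abbrev castM (A : Matrix (Fin 2) (Fin 2) ℤ) : Matrix (Fin 2) (Fin 2) ℂ := A.map (Int.cast : ℤ → ℂ)

theorem castM_mul (A B : Matrix (Fin 2) (Fin 2) ℤ) : castM (A * B) = castM A * castM B :=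
  Matrix.map_mul (f := Int.castRingHom ℂ)

theorem castM_transpose (A : Matrix (Fin 2) (Fin 2) ℤ) : castM Aᵀ = (castM A)ᵀ := rfl

theorem castM_conjTranspose (A : Matrix (Fin 2) (Fin 2) ℤ) : (castM A)ᴴ = (castM A)ᵀ := by
  ext i j; simp

theorem sp_blocks (M : SpZ) :
    (castM M.1.toBlocks₁₁)ᵀ * castM M.1.toBlocks₂₁ = (castM M.1.toBlocks₂₁)ᵀ * castM M.1.toBlocks₁₁ ∧
    (castM M.1.toBlocks₁₂)ᵀ * castM M.1.toBlocks₂₂ = (castM M.1.toBlocks₂₂)ᵀ * castM M.1.toBlocks₁₂ ∧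
    (castM M.1.toBlocks₁₁)ᵀ * castM M.1.toBlocks₂₂ - (castM M.1.toBlocks₂₁)ᵀ * castM M.1.toBlocks₁₂ = 1 ∧
    (castM M.1.toBlocks₂₂)ᵀ * castM M.1.toBlocks₁₁ - (castM M.1.toBlocks₁₂)ᵀ * castM M.1.toBlocks₂₁ = 1 := by
  have h := M.2
  rw [← fromBlocks_toBlocks M.1, mem_symplectic_fromBlocks] at h
  obtain ⟨h1, h2, h3⟩ := h
  have h3' : (castM M.1.toBlocks₁₁)ᵀ * castM M.1.toBlocks₂₂ -
      (castM M.1.toBlocks₂₁)ᵀ * castM M.1.toBlocks₁₂ = 1 := by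
    have := congrArg castM h3
    rw [← castM_transpose, ← castM_transpose, ← castM_mul, ← castM_mul]
    rw [← Matrix.map_sub _ (fun a b => Int.cast_sub a b)]
    refine this.trans ?_
    exact Matrix.map_one _ Int.cast_zero Int.cast_one
  refine ⟨?_, ?_, h3', ?_⟩
  · rw [← castM_transpose, ← castM_transpose, ← castM_mul, ← castM_mul, h1]
  · rw [← castM_transpose, ← castM_transpose, ← castM_mul, ← castM_mul, h2]
  · have := congrArg Matrix.transpose h3'
    simpa only [Matrix.transpose_sub, Matrix.transpose_mul, Matrix.transpose_transpose,
      Matrix.transpose_one] using this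

/-- Expansion and the symplectic block relations leave only the terms linear in τ and its adjoint.
This is the source of both the invertibility of Cτ + D and the stability of the upper half space. -/
theorem conjTranspose_denom_mul_numer (M : SpZ) (τ : Matrix (Fin 2) (Fin 2) ℂ) :
    (denom M.1 τ)ᴴ * numer M.1 τ - (numer M.1 τ)ᴴ * denom M.1 τ = τ - τᴴ := by
  obtain ⟨h1, h2, h3, h4⟩ := sp_blocks M
  simp only [denom, numer, Matrix.conjTranspose_add, Matrix.conjTranspose_mul]
  rw [castM_conjTranspose, castM_conjTranspose, castM_conjTranspose, castM_conjTranspose]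
  set A := castM M.1.toBlocks₁₁
  set B := castM M.1.toBlocks₁₂
  set C := castM M.1.toBlocks₂₁
  set D := castM M.1.toBlocks₂₂
  calc (τᴴ * Cᵀ + Dᵀ) * (A * τ + B) - (τᴴ * Aᵀ + Bᵀ) * (C * τ + D)
      = τᴴ * ((Cᵀ * A) - (Aᵀ * C)) * τ - τᴴ * (Aᵀ * D - Cᵀ * B) + (Dᵀ * A - Bᵀ * C) * τ
        + (Dᵀ * B - Bᵀ * D) := by noncomm_ring
    _ = τ - τᴴ := by rw [h1, h2, h3, h4]; simp; abel

theorem transpose_numer_mul_denom (M : SpZ) {τ : Matrix (Fin 2) (Fin 2) ℂ} (hs : τᵀ = τ) :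
    (numer M.1 τ)ᵀ * denom M.1 τ = (denom M.1 τ)ᵀ * numer M.1 τ := by
  obtain ⟨h1, h2, h3, h4⟩ := sp_blocks M
  rw [← sub_eq_zero]
  simp only [denom, numer, Matrix.transpose_add, Matrix.transpose_mul, hs]
  set A := castM M.1.toBlocks₁₁
  set B := castM M.1.toBlocks₁₂
  set C := castM M.1.toBlocks₂₁
  set D := castM M.1.toBlocks₂₂
  calc (τ * Aᵀ + Bᵀ) * (C * τ + D) - (τ * Cᵀ + Dᵀ) * (A * τ + B)
      = τ * ((Aᵀ * C) - (Cᵀ * A)) * τ + τ * (Aᵀ * D - Cᵀ * B) - (Dᵀ * A - Bᵀ * C) * τ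
        + (Bᵀ * D - Dᵀ * B) := by noncomm_ring
    _ = 0 := by rw [h1, h2, h3, h4]; simp

/-- For Hermitian reasons 2i Im(⟨Pv, Qv⟩) is the value at v of PᴴQ - QᴴP, and this matrix is the
same for the pair denominator, numerator as for the pair 1, τ. -/
theorem im_star_denom_numer (M : SpZ) (τ : Matrix (Fin 2) (Fin 2) ℂ) (v : Fin 2 → ℂ) :
    (star (denom M.1 τ *ᵥ v) ⬝ᵥ numer M.1 τ *ᵥ v).im = (star v ⬝ᵥ τ *ᵥ v).im := by
  have key : ∀ (P Q : Matrix (Fin 2) (Fin 2) ℂ),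
      2 * Complex.I * ((star (P *ᵥ v) ⬝ᵥ Q *ᵥ v).im : ℂ) = star v ⬝ᵥ (Pᴴ * Q - Qᴴ * P) *ᵥ v := by
    intro P Q
    have e : star v ⬝ᵥ (Pᴴ * Q - Qᴴ * P) *ᵥ v = star (P *ᵥ v) ⬝ᵥ Q *ᵥ v - star (Q *ᵥ v) ⬝ᵥ P *ᵥ v := by
      rw [Matrix.sub_mulVec, dotProduct_sub, ← Matrix.mulVec_mulVec, ← Matrix.mulVec_mulVec,
        Matrix.dotProduct_mulVec, Matrix.dotProduct_mulVec (star v) Qᴴ, Matrix.star_mulVec,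
        Matrix.star_mulVec]
    have e2 : star (Q *ᵥ v) ⬝ᵥ P *ᵥ v = (starRingEnd ℂ) (star (P *ᵥ v) ⬝ᵥ Q *ᵥ v) := by
      rw [starRingEnd_apply, ← Matrix.star_dotProduct_star, star_star]
    rw [e, e2, Complex.sub_conj]
    push_cast
    ring
  have h1 := key (denom M.1 τ) (numer M.1 τ)
  have h2 := key 1 τ
  rw [conjTranspose_denom_mul_numer] at h1
  simp only [Matrix.conjTranspose_one, Matrix.one_mul, Matrix.mul_one, Matrix.one_mulVec] at h2
  rw [← h2] at h1
  have h3 := mul_left_cancel₀ (mul_ne_zero two_ne_zero Complex.I_ne_zero) h1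
  exact_mod_cast h3

theorem det_denom_ne_zero (M : SpZ) {τ : Matrix (Fin 2) (Fin 2) ℂ} (hτ : τ ∈ H2) :
    (denom M.1 τ).det ≠ 0 := by
  intro h
  obtain ⟨v, hv, h0⟩ := Matrix.exists_mulVec_eq_zero_iff.2 h
  have := (mem_H2_iff.1 hτ).2 v hv
  rw [← im_star_denom_numer M, h0] at this
  simp at this

theorem act_mul_denom (M : SpZ) {τ : Matrix (Fin 2) (Fin 2) ℂ} (hτ : τ ∈ H2) :
    act M.1 τ * denom M.1 τ = numer M.1 τ := by
  rw [act, Matrix.mul_assoc, Matrix.nonsing_inv_mul _ (det_denom_ne_zero M hτ).isUnit, Matrix.mul_one]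

theorem act_mem_H2 (M : SpZ) {τ : Matrix (Fin 2) (Fin 2) ℂ} (hτ : τ ∈ H2) : act M.1 τ ∈ H2 := by
  have hE := (det_denom_ne_zero M hτ).isUnit
  refine mem_H2_iff.2 ⟨?_, fun u hu => ?_⟩
  · have h := transpose_numer_mul_denom M hτ.1
    rw [act, Matrix.transpose_mul]
    rw [Matrix.transpose_nonsing_inv]
    have hE' : IsUnit (denom M.1 τ)ᵀ.det := by rwa [Matrix.det_transpose]
    calc ((denom M.1 τ)ᵀ)⁻¹ * (numer M.1 τ)ᵀ
        = ((denom M.1 τ)ᵀ)⁻¹ * ((numer M.1 τ)ᵀ * denom M.1 τ) * (denom M.1 τ)⁻¹ := by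
          rw [← Matrix.mul_assoc, Matrix.mul_nonsing_inv_cancel_right _ _ hE]
      _ = numer M.1 τ * (denom M.1 τ)⁻¹ := by
          rw [h, Matrix.nonsing_inv_mul_cancel_left _ _ hE']
  · have hu' : u = denom M.1 τ *ᵥ ((denom M.1 τ)⁻¹ *ᵥ u) := by
      rw [Matrix.mulVec_mulVec, Matrix.mul_nonsing_inv _ hE, Matrix.one_mulVec]
    set v := (denom M.1 τ)⁻¹ *ᵥ u with hv
    have hv0 : v ≠ 0 := fun h => hu (by rw [hu', h, Matrix.mulVec_zero])
    have : act M.1 τ *ᵥ u = numer M.1 τ *ᵥ v := by rw [act, ← Matrix.mulVec_mulVec]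
    rw [this, hu', im_star_denom_numer]
    exact (mem_H2_iff.1 hτ).2 v hv0

theorem denom_mul (M N : SpZ) {τ : Matrix (Fin 2) (Fin 2) ℂ} (hτ : τ ∈ H2) :
    denom (M * N).1 τ = denom M.1 (act N.1 τ) * denom N.1 τ := by
  have h : (M * N).1 = fromBlocks M.1.toBlocks₁₁ M.1.toBlocks₁₂ M.1.toBlocks₂₁ M.1.toBlocks₂₂ *
      fromBlocks N.1.toBlocks₁₁ N.1.toBlocks₁₂ N.1.toBlocks₂₁ N.1.toBlocks₂₂ := by
    rw [fromBlocks_toBlocks, fromBlocks_toBlocks]; rfl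
  rw [denom, h, fromBlocks_multiply, toBlocks_fromBlocks₂₁, toBlocks_fromBlocks₂₂]
  conv_rhs => rw [denom, Matrix.add_mul, Matrix.mul_assoc, act_mul_denom N hτ, numer, denom]
  rw [Matrix.map_add _ (fun a b => Int.cast_add a b), Matrix.map_add _ (fun a b => Int.cast_add a b)]
  change (castM _ + castM _) * τ + (castM _ + castM _) = _
  rw [castM_mul, castM_mul, castM_mul, castM_mul]
  noncomm_ring

theorem numer_mul (M N : SpZ) {τ : Matrix (Fin 2) (Fin 2) ℂ} (hτ : τ ∈ H2) :
    numer (M * N).1 τ = numer M.1 (act N.1 τ) * denom N.1 τ := by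
  have h : (M * N).1 = fromBlocks M.1.toBlocks₁₁ M.1.toBlocks₁₂ M.1.toBlocks₂₁ M.1.toBlocks₂₂ *
      fromBlocks N.1.toBlocks₁₁ N.1.toBlocks₁₂ N.1.toBlocks₂₁ N.1.toBlocks₂₂ := by
    rw [fromBlocks_toBlocks, fromBlocks_toBlocks]; rfl
  rw [numer, h, fromBlocks_multiply, toBlocks_fromBlocks₁₁, toBlocks_fromBlocks₁₂]
  conv_rhs => rw [numer, Matrix.add_mul, Matrix.mul_assoc, act_mul_denom N hτ, numer, denom]
  rw [Matrix.map_add _ (fun a b => Int.cast_add a b), Matrix.map_add _ (fun a b => Int.cast_add a b)]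
  change (castM _ + castM _) * τ + (castM _ + castM _) = _
  rw [castM_mul, castM_mul, castM_mul, castM_mul]
  noncomm_ring

theorem act_mul (M N : SpZ) {τ : Matrix (Fin 2) (Fin 2) ℂ} (hτ : τ ∈ H2) :
    act (M * N).1 τ = act M.1 (act N.1 τ) := by
  change numer (M * N).1 τ * (denom (M * N).1 τ)⁻¹ =
    numer M.1 (act N.1 τ) * (denom M.1 (act N.1 τ))⁻¹
  rw [numer_mul M N hτ, denom_mul M N hτ, Matrix.mul_inv_rev, ← Matrix.mul_assoc,
    Matrix.mul_nonsing_inv_cancel_right _ _ (det_denom_ne_zero N hτ).isUnit]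

theorem castM_one : castM 1 = 1 := Matrix.map_one _ Int.cast_zero Int.cast_one

theorem castM_zero : castM 0 = 0 := Matrix.map_zero _ Int.cast_zero

theorem toBlocks_one : (1 : SpZ).1 = fromBlocks 1 0 0 1 := fromBlocks_one.symm

theorem denom_one (τ : Matrix (Fin 2) (Fin 2) ℂ) : denom (1 : SpZ).1 τ = 1 := by
  rw [denom, toBlocks_one, toBlocks_fromBlocks₂₁, toBlocks_fromBlocks₂₂]
  change castM 0 * τ + castM 1 = 1
  rw [castM_zero, castM_one, Matrix.zero_mul, zero_add]

theorem act_one (τ : Matrix (Fin 2) (Fin 2) ℂ) : act (1 : SpZ).1 τ = τ := by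
  rw [act, denom_one, numer, toBlocks_one, toBlocks_fromBlocks₁₁, toBlocks_fromBlocks₁₂]
  change (castM 1 * τ + castM 0) * 1⁻¹ = τ
  rw [castM_zero, castM_one, Matrix.one_mul, add_zero, inv_one, Matrix.mul_one]

/-- The factor of automorphy `det(Cτ + D)`. -/
noncomputable def autFactor (M : SpZ) (τ : Matrix (Fin 2) (Fin 2) ℂ) : ℂ := (denom M.1 τ).det

theorem autFactor_mul (M N : SpZ) {τ : Matrix (Fin 2) (Fin 2) ℂ} (hτ : τ ∈ H2) :
    autFactor (M * N) τ = autFactor M (act N.1 τ) * autFactor N τ := by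
  rw [autFactor, denom_mul M N hτ, Matrix.det_mul]; rfl

theorem autFactor_one (τ : Matrix (Fin 2) (Fin 2) ℂ) : autFactor 1 τ = 1 := by
  rw [autFactor, denom_one, Matrix.det_one]

theorem autFactor_ne_zero (M : SpZ) {τ : Matrix (Fin 2) (Fin 2) ℂ} (hτ : τ ∈ H2) :
    autFactor M τ ≠ 0 := det_denom_ne_zero M hτ

theorem act_act_inv (M : SpZ) {τ : Matrix (Fin 2) (Fin 2) ℂ} (hτ : τ ∈ H2) :
    act M.1 (act (M⁻¹).1 τ) = τ := by
  rw [← act_mul _ _ hτ, mul_inv_cancel, act_one]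

/-! ### The action of the elementary elements in coordinates -/

/-- Recognising `act` from its defining relation. -/
theorem act_eq_of_mul (M : SpZ) {w : ℂ × ℂ × ℂ} (hw : w ∈ UHS) {σ : Matrix (Fin 2) (Fin 2) ℂ}
    (h : σ * denom M.1 (symMat w) = numer M.1 (symMat w)) : act M.1 (symMat w) = σ := by
  rw [act, ← h, Matrix.mul_nonsing_inv_cancel_right _ _
    (det_denom_ne_zero M (symMat_mem_H2.2 hw)).isUnit]

theorem denom_fromBlocks (A B C D : Matrix (Fin 2) (Fin 2) ℤ) (τ : Matrix (Fin 2) (Fin 2) ℂ) :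
    denom (fromBlocks A B C D) τ = castM C * τ + castM D := rfl

theorem numer_fromBlocks (A B C D : Matrix (Fin 2) (Fin 2) ℤ) (τ : Matrix (Fin 2) (Fin 2) ℂ) :
    numer (fromBlocks A B C D) τ = castM A * τ + castM B := rfl

theorem act_spTrans (a b c : ℤ) {w : ℂ × ℂ × ℂ} (hw : w ∈ UHS) :
    act (spTrans a b c).1 (symMat w) = symMat (w.1 + a, w.2.1 + b, w.2.2 + c) := by
  refine act_eq_of_mul _ hw ?_
  rw [spTrans_val, denom_fromBlocks, numer_fromBlocks]
  ext i j; fin_cases i <;> fin_cases j <;> simp [symMat, Matrix.mul_apply, Fin.sum_univ_two]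

theorem autFactor_spTrans (a b c : ℤ) (τ : Matrix (Fin 2) (Fin 2) ℂ) :
    autFactor (spTrans a b c) τ = 1 := by
  rw [autFactor, spTrans_val, denom_fromBlocks, castM_zero, castM_one]; simp

theorem act_spSwap {w : ℂ × ℂ × ℂ} (hw : w ∈ UHS) :
    act spSwap.1 (symMat w) = symMat (w.2.2, w.2.1, w.1) := by
  refine act_eq_of_mul _ hw ?_
  rw [spSwap, denom_fromBlocks, numer_fromBlocks]
  ext i j; fin_cases i <;> fin_cases j <;> simp [symMat, Matrix.mul_apply, Fin.sum_univ_two]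

theorem autFactor_spSwap (τ : Matrix (Fin 2) (Fin 2) ℂ) : autFactor spSwap τ = -1 := by
  rw [autFactor, spSwap, denom_fromBlocks, castM_zero]; simp [Matrix.det_fin_two]

theorem act_spSign {w : ℂ × ℂ × ℂ} (hw : w ∈ UHS) :
    act spSign.1 (symMat w) = symMat (w.1, -w.2.1, w.2.2) := by
  refine act_eq_of_mul _ hw ?_
  rw [spSign, denom_fromBlocks, numer_fromBlocks]
  ext i j; fin_cases i <;> fin_cases j <;> simp [symMat, Matrix.mul_apply, Fin.sum_univ_two]

theorem autFactor_spSign (τ : Matrix (Fin 2) (Fin 2) ℂ) : autFactor spSign τ = -1 := by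
  rw [autFactor, spSign, denom_fromBlocks, castM_zero]; simp [Matrix.det_fin_two]

theorem act_spLevi_upper (r : ℤ) {w : ℂ × ℂ × ℂ} (hw : w ∈ UHS) :
    act (spLevi (upperSL r)).1 (symMat w) =
      symMat (w.1 + 2 * r * w.2.1 + r ^ 2 * w.2.2, w.2.1 + r * w.2.2, w.2.2) := by
  refine act_eq_of_mul _ hw ?_
  rw [spLevi_val, denom_fromBlocks, numer_fromBlocks, upperSL_val]
  ext i j; fin_cases i <;> fin_cases j <;> simp [symMat, Matrix.mul_apply, Fin.sum_univ_two] <;>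
    ring

theorem autFactor_spLevi (g : Matrix.SpecialLinearGroup (Fin 2) ℤ) (τ : Matrix (Fin 2) (Fin 2) ℂ) :
    autFactor (spLevi g) τ = 1 := by
  have h : (g.1 0 0 * g.1 1 1 - g.1 0 1 * g.1 1 0 : ℂ) = 1 := by exact_mod_cast SL2Z.det_eq g
  rw [autFactor, spLevi_val, denom_fromBlocks, castM_zero]
  simp [Matrix.det_fin_two]
  linear_combination h

theorem autFactor_spFst (g : Matrix.SpecialLinearGroup (Fin 2) ℤ) (w : ℂ × ℂ × ℂ) :
    autFactor (spFst g) (symMat w) = g.1 1 0 * w.1 + g.1 1 1 := by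
  rw [autFactor, spFst_val, denom_fromBlocks]
  simp [Matrix.det_fin_two, symMat, Matrix.mul_apply, Fin.sum_univ_two]

theorem act_spFst (g : Matrix.SpecialLinearGroup (Fin 2) ℤ) {w : ℂ × ℂ × ℂ} (hw : w ∈ UHS) :
    act (spFst g).1 (symMat w) = symMat ((g.1 0 0 * w.1 + g.1 0 1) / (g.1 1 0 * w.1 + g.1 1 1),
      w.2.1 / (g.1 1 0 * w.1 + g.1 1 1),
      w.2.2 - g.1 1 0 * w.2.1 ^ 2 / (g.1 1 0 * w.1 + g.1 1 1)) := by
  have h0 := autFactor_ne_zero (spFst g) (symMat_mem_H2.2 hw)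
  rw [autFactor_spFst] at h0
  have h : (g.1 0 0 * g.1 1 1 - g.1 0 1 * g.1 1 0 : ℂ) = 1 := by exact_mod_cast SL2Z.det_eq g
  refine act_eq_of_mul _ hw ?_
  rw [spFst_val, denom_fromBlocks, numer_fromBlocks]
  ext i j; fin_cases i <;> fin_cases j <;>
    simp [symMat, Matrix.mul_apply, Fin.sum_univ_two]
  all_goals
    generalize hE : (g.1 1 0 : ℂ) * w.1 + g.1 1 1 = e at *
    field_simp
  · rw [← hE]
    linear_combination (-w.2.1) * h
  · rw [← hE]
    ring

/-! ### Transformation of theta constants under the elementary elements -/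

theorem Complex.exp_eq_exp_of_int {x y : ℂ} (n : ℤ) (h : x = y + 2 * Real.pi * Complex.I * n) :
    Complex.exp x = Complex.exp y :=
  Complex.exp_eq_exp_iff_exists_int.2 ⟨n, by rw [h]; ring⟩

/-- The theta constants of arbitrary integral characteristic. -/
noncomputable abbrev th (m₁ m₂ k₁ k₂ : ℤ) (w : ℂ × ℂ × ℂ) : ℂ := wTheta (fun _ _ => 1) m₁ m₂ k₁ k₂ w

theorem th_eq (m₁ m₂ k₁ k₂ : ℤ) (w : ℂ × ℂ × ℂ) :
    th m₁ m₂ k₁ k₂ w = ∑' n : ℤ × ℤ, thTerm m₁ m₂ k₁ k₂ w n := by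
  simp [th, wTheta]

/-- Since n² ≡ n modulo 2, the quadratic contribution of an integral translation agrees up to a
constant with a linear one, which is a change of ν. -/
theorem th_add (a b d m₁ m₂ k₁ k₂ : ℤ) (w : ℂ × ℂ × ℂ) :
    th m₁ m₂ k₁ k₂ (w.1 + a, w.2.1 + b, w.2.2 + d) =
      Complex.exp (Real.pi * Complex.I * ((a * m₁ ^ 2 + 2 * b * m₁ * m₂ + d * m₂ ^ 2) / 4
        - (m₁ * (a * (1 + m₁) + b * m₂) + m₂ * (b * m₁ + d * (1 + m₂))) / 2)) *
      th m₁ m₂ (k₁ + (a * (1 + m₁) + b * m₂)) (k₂ + (b * m₁ + d * (1 + m₂))) w := by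
  rw [th_eq, th_eq, ← tsum_mul_left]
  refine tsum_congr fun n => ?_
  rw [thTerm, thTerm, ← Complex.exp_add]
  obtain ⟨s, hs⟩ := Int.even_mul_pred_self n.1
  obtain ⟨t, ht⟩ := Int.even_mul_pred_self n.2
  have hs' : (n.1 : ℂ) * (n.1 - 1) = s + s := by exact_mod_cast hs
  have ht' : (n.2 : ℂ) * (n.2 - 1) = t + t := by exact_mod_cast ht
  refine Complex.exp_eq_exp_of_int (a * s + b * n.1 * n.2 + d * t) ?_
  push_cast
  linear_combination (Real.pi * Complex.I * a) * hs' + (Real.pi * Complex.I * d) * ht'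

theorem th_add_even (a b d m₁ m₂ k₁ k₂ : ℤ) (w : ℂ × ℂ × ℂ) :
    th m₁ m₂ k₁ k₂ (w.1 + (2 * a : ℤ), w.2.1 + (2 * b : ℤ), w.2.2 + (2 * d : ℤ)) =
      Complex.exp (Real.pi * Complex.I * ((a * m₁ ^ 2 + 2 * b * m₁ * m₂ + d * m₂ ^ 2) / 2)) *
      th m₁ m₂ k₁ k₂ w := by
  rw [th_eq, th_eq, ← tsum_mul_left]
  refine tsum_congr fun n => ?_
  rw [thTerm, thTerm, ← Complex.exp_add]
  refine Complex.exp_eq_exp_of_int (a * (n.1 ^ 2 + n.1 * m₁) + b * (2 * n.1 * n.2 + n.1 * m₂ + m₁ * n.2)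
    + d * (n.2 ^ 2 + n.2 * m₂)) ?_
  push_cast
  ring

theorem th_swap (m₁ m₂ k₁ k₂ : ℤ) (w : ℂ × ℂ × ℂ) :
    th m₁ m₂ k₁ k₂ (w.2.2, w.2.1, w.1) = th m₂ m₁ k₂ k₁ w := by
  rw [th_eq, th_eq, ← (Equiv.prodComm ℤ ℤ).tsum_eq]
  refine tsum_congr fun n => ?_
  simp only [thTerm, Equiv.prodComm_apply, Prod.swap]
  congr 1
  ring

theorem th_sign (m₁ m₂ k₁ k₂ : ℤ) (w : ℂ × ℂ × ℂ) :
    th m₁ m₂ k₁ k₂ (w.1, -w.2.1, w.2.2) = th (-m₁) m₂ (-k₁) k₂ w := by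
  rw [th_eq, th_eq, ← ((Equiv.neg ℤ).prodCongr (Equiv.refl ℤ)).tsum_eq]
  refine tsum_congr fun n => ?_
  simp only [thTerm, Equiv.prodCongr_apply, Prod.map, Equiv.neg_apply, Equiv.refl_apply]
  congr 1
  push_cast
  ring

/-- The shear `(x, y) ↦ (x, y + r x)` of the integral plane. -/
def shearEquiv (r : ℤ) : ℤ × ℤ ≃ ℤ × ℤ where
  toFun n := (n.1, n.2 + r * n.1)
  invFun n := (n.1, n.2 - r * n.1)
  left_inv n := by simp
  right_inv n := by simp

theorem th_shear (r m₁ m₂ k₁ k₂ : ℤ) (w : ℂ × ℂ × ℂ) :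
    th m₁ m₂ k₁ k₂ (w.1 + 2 * r * w.2.1 + r ^ 2 * w.2.2, w.2.1 + r * w.2.2, w.2.2) =
      th m₁ (m₂ + r * m₁) (k₁ - r * k₂) k₂ w := by
  rw [th_eq, th_eq, ← (shearEquiv r).tsum_eq (thTerm m₁ (m₂ + r * m₁) (k₁ - r * k₂) k₂ w)]
  refine tsum_congr fun n => ?_
  simp only [thTerm, shearEquiv, Equiv.coe_fn_mk]
  congr 1
  push_cast
  ring

/-- Poisson summation for a shifted Gaussian with a character. -/
theorem tsum_gaussian_inversion {τ : ℂ} (hτ : τ ≠ 0) (a : ℂ) (m k : ℤ) :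
    ∑' n : ℤ, Complex.exp (Real.pi * Complex.I * (-((n : ℂ) + m / 2 - a) ^ 2 / τ + ((n : ℂ) + m / 2) * k))
      = (-Complex.I * τ) ^ (1 / 2 : ℂ) * Complex.exp (Real.pi * Complex.I * (m * k / 2)) *
        ∑' n : ℤ, Complex.exp (Real.pi * Complex.I * (τ * ((n : ℂ) + k / 2) ^ 2
          + 2 * ((n : ℂ) + k / 2) * a - ((n : ℂ) + k / 2) * m)) := by
  have hκ : (-Complex.I * τ) ^ (1 / 2 : ℂ) ≠ 0 := by
    rw [Complex.cpow_ne_zero_iff]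
    left
    exact mul_ne_zero (neg_ne_zero.2 Complex.I_ne_zero) hτ
  have h := jacobiTheta₂_functional_equation (k * τ / 2 - m / 2 + a) τ
  rw [jacobiTheta₂, jacobiTheta₂] at h
  have h1 : ∑' n : ℤ, Complex.exp (Real.pi * Complex.I * (-((n : ℂ) + m / 2 - a) ^ 2 / τ + ((n : ℂ) + m / 2) * k))
      = Complex.exp (Real.pi * Complex.I * (k * (m / 2) - (m / 2 - a) * k + k ^ 2 * τ / 4)) *
        (Complex.exp (-Real.pi * Complex.I * (k * τ / 2 - m / 2 + a) ^ 2 / τ) *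
        ∑' n : ℤ, jacobiTheta₂_term n ((k * τ / 2 - m / 2 + a) / τ) (-1 / τ)) := by
    rw [← tsum_mul_left, ← tsum_mul_left]
    refine tsum_congr fun n => ?_
    rw [jacobiTheta₂_term, ← Complex.exp_add, ← Complex.exp_add]
    congr 1
    field_simp
    ring
  have h2 : ∑' n : ℤ, Complex.exp (Real.pi * Complex.I * (τ * ((n : ℂ) + k / 2) ^ 2
          + 2 * ((n : ℂ) + k / 2) * a - ((n : ℂ) + k / 2) * m)) =
      Complex.exp (Real.pi * Complex.I * (k ^ 2 * τ / 4 + k * a - k * m / 2)) *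
        ∑' n : ℤ, jacobiTheta₂_term n (k * τ / 2 - m / 2 + a) τ := by
    rw [← tsum_mul_left]
    refine tsum_congr fun n => ?_
    rw [jacobiTheta₂_term, ← Complex.exp_add]
    congr 1
    ring
  rw [h1, h2, h]
  have e : Complex.exp (Real.pi * Complex.I * (k * (m / 2) - (m / 2 - a) * k + k ^ 2 * τ / 4)) =
      Complex.exp (Real.pi * Complex.I * (m * k / 2)) *
      Complex.exp (Real.pi * Complex.I * (k ^ 2 * τ / 4 + k * a - k * m / 2)) := by
    rw [← Complex.exp_add]; congr 1; ring
  rw [e]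
  field_simp

theorem th_eq_iterated (m₁ m₂ k₁ k₂ : ℤ) {w : ℂ × ℂ × ℂ} (hw : w ∈ UHS) :
    th m₁ m₂ k₁ k₂ w = ∑' n₂ : ℤ, ∑' n₁ : ℤ, thTerm m₁ m₂ k₁ k₂ w (n₁, n₂) := by
  rw [th_eq, ← (Equiv.prodComm ℤ ℤ).tsum_eq]
  exact Summable.tsum_prod ((Equiv.prodComm ℤ ℤ).summable_iff.2 (summable_thTerm _ _ _ _ hw))

/-- Poisson summation in the first variable only. For fixed n₂ the inner series is a Gaussian
shifted by τ₁₂(n₂ + m₂/2), and the new entries of the matrix come from completing the square. -/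
theorem th_inversion (m₁ m₂ k₁ k₂ : ℤ) {w : ℂ × ℂ × ℂ} (hw : w ∈ UHS)
    (hw' : (-1 / w.1, w.2.1 / w.1, w.2.2 - w.2.1 ^ 2 / w.1) ∈ UHS) :
    th m₁ m₂ k₁ k₂ (-1 / w.1, w.2.1 / w.1, w.2.2 - w.2.1 ^ 2 / w.1) =
      (-Complex.I * w.1) ^ (1 / 2 : ℂ) * Complex.exp (Real.pi * Complex.I * (m₁ * k₁ / 2)) *
        th k₁ m₂ (-m₁) k₂ w := by
  have h0 : w.1 ≠ 0 := fun h => by have := hw.1; rw [h] at this; simp at this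
  rw [th_eq_iterated _ _ _ _ hw', th_eq_iterated _ _ _ _ hw, ← tsum_mul_left]
  refine tsum_congr fun n₂ => ?_
  have h := tsum_gaussian_inversion h0 (w.2.1 * ((n₂ : ℂ) + m₂ / 2)) m₁ k₁
  have e1 : ∑' n : ℤ, thTerm m₁ m₂ k₁ k₂ (-1 / w.1, w.2.1 / w.1, w.2.2 - w.2.1 ^ 2 / w.1) (n, n₂) =
      Complex.exp (Real.pi * Complex.I * (w.2.2 * ((n₂ : ℂ) + m₂ / 2) ^ 2 + ((n₂ : ℂ) + m₂ / 2) * k₂)) *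
      ∑' n : ℤ, Complex.exp (Real.pi * Complex.I *
        (-((n : ℂ) + m₁ / 2 - w.2.1 * ((n₂ : ℂ) + m₂ / 2)) ^ 2 / w.1 + ((n : ℂ) + m₁ / 2) * k₁)) := by
    rw [← tsum_mul_left]
    refine tsum_congr fun n => ?_
    rw [thTerm, ← Complex.exp_add]
    congr 1
    field_simp
    ring
  have e2 : ∑' n : ℤ, thTerm k₁ m₂ (-m₁) k₂ w (n, n₂) =
      Complex.exp (Real.pi * Complex.I * (w.2.2 * ((n₂ : ℂ) + m₂ / 2) ^ 2 + ((n₂ : ℂ) + m₂ / 2) * k₂)) *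
      ∑' n : ℤ, Complex.exp (Real.pi * Complex.I * (w.1 * ((n : ℂ) + k₁ / 2) ^ 2
          + 2 * ((n : ℂ) + k₁ / 2) * (w.2.1 * ((n₂ : ℂ) + m₂ / 2)) - ((n : ℂ) + k₁ / 2) * m₁)) := by
    rw [← tsum_mul_left]
    refine tsum_congr fun n => ?_
    rw [thTerm, ← Complex.exp_add]
    congr 1
    push_cast
    ring
  rw [e1, e2, h]
  ring


/-! ### The product of the even theta constants on the full group -/

theorem tc_eq (k : ℕ) (w : ℂ × ℂ × ℂ) :
    tc k w = th (evenChar k 0) (evenChar k 1) (evenChar k 2) (evenChar k 3) w := rfl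

theorem neg_one_zpow_ne_zero (j : ℤ) : (-1 : ℂ) ^ j ≠ 0 := zpow_ne_zero _ (by norm_num)

theorem neg_one_zpow_pow_four (j : ℤ) : ((-1 : ℂ) ^ j) ^ 4 = 1 := by
  rw [← zpow_natCast, ← _root_.zpow_mul]
  exact Even.neg_one_zpow ⟨j * 2, by push_cast; ring⟩

theorem th_congr {m₁ m₂ k₁ k₂ m₁' m₂' k₁' k₂' : ℤ} (h₁ : 2 ∣ m₁ - m₁') (h₂ : 2 ∣ m₂ - m₂')
    (h₃ : 2 ∣ k₁ - k₁') (h₄ : 2 ∣ k₂ - k₂') :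
    ∃ j : ℤ, ∀ w, th m₁ m₂ k₁ k₂ w = (-1) ^ j * th m₁' m₂' k₁' k₂' w := by
  obtain ⟨a, ha⟩ := h₁
  obtain ⟨b, hb⟩ := h₂
  obtain ⟨c, hc⟩ := h₃
  obtain ⟨d, hd⟩ := h₄
  obtain rfl : m₁ = m₁' + 2 * a := by linarith
  obtain rfl : m₂ = m₂' + 2 * b := by linarith
  obtain rfl : k₁ = k₁' + 2 * c := by linarith
  obtain rfl : k₂ = k₂' + 2 * d := by linarith
  exact ⟨m₁' * c + m₂' * d, fun w => by rw [th, wTheta_m₁, wTheta_m₂, wTheta_k]⟩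

theorem exists_th_add (a b d m₁ m₂ k₁ k₂ : ℤ) : ∃ e : ℂ, e ≠ 0 ∧ ∀ w : ℂ × ℂ × ℂ,
    th m₁ m₂ k₁ k₂ (w.1 + a, w.2.1 + b, w.2.2 + d) =
      e * th m₁ m₂ (k₁ + (a * (1 + m₁) + b * m₂)) (k₂ + (b * m₁ + d * (1 + m₂))) w :=
  ⟨_, Complex.exp_ne_zero _, th_add a b d m₁ m₂ k₁ k₂⟩

/-- If the ten constants are permuted up to constants and a common factor κ, their product acquires
κ¹⁰. -/
theorem chi5_of_tc {f : ℂ × ℂ × ℂ → ℂ × ℂ × ℂ} {κ : ℂ × ℂ × ℂ → ℂ} {π : ℕ → ℕ}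
    (hπ : (Finset.Icc 1 10).val.map π = (Finset.Icc 1 10).val)
    (h : ∀ k ∈ Finset.Icc 1 10, ∃ u : ℂ, u ≠ 0 ∧ ∀ w ∈ UHS, tc k (f w) = u * κ w * tc (π k) w) :
    ∃ ε : ℂ, ε ≠ 0 ∧ ∀ w ∈ UHS, chi5 (symMat (f w)) = ε * κ w ^ 10 * chi5 (symMat w) := by
  choose! u hu0 hu using h
  refine ⟨∏ k ∈ Finset.Icc 1 10, u k, Finset.prod_ne_zero_iff.2 hu0, fun w hw => ?_⟩
  have e : ∏ k ∈ Finset.Icc 1 10, tc (π k) w = ∏ k ∈ Finset.Icc 1 10, tc k w := by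
    have := congrArg (fun s => (Multiset.map (fun k => tc k w) s).prod) hπ
    rw [Multiset.map_map] at this
    exact this
  simp only [chi5, vt_symMat]
  rw [Finset.prod_congr rfl fun k hk => hu k hk w hw, Finset.prod_mul_distrib,
    Finset.prod_mul_distrib, e]
  simp

/-- The elements of `Sp(4, ℤ)` under which `χ₅` transforms with weight five up to a constant. -/
noncomputable def chi5Sub : Subgroup SpZ where
  carrier := {M | ∃ ε : ℂ, ε ≠ 0 ∧ ∀ τ ∈ H2, chi5 (act M.1 τ) = ε * autFactor M τ ^ 5 * chi5 τ}
  one_mem' := ⟨1, one_ne_zero, fun τ _ => by rw [act_one, autFactor_one]; ring⟩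
  mul_mem' := by
    rintro M N ⟨ε, h0, h⟩ ⟨δ, h0', h'⟩
    refine ⟨ε * δ, mul_ne_zero h0 h0', fun τ hτ => ?_⟩
    rw [act_mul M N hτ, h _ (act_mem_H2 N hτ), h' τ hτ, autFactor_mul M N hτ]
    ring
  inv_mem' := by
    rintro M ⟨ε, h0, h⟩
    refine ⟨ε⁻¹, inv_ne_zero h0, fun τ hτ => ?_⟩
    have h1 := h _ (act_mem_H2 M⁻¹ hτ)
    have h2 := autFactor_mul M M⁻¹ hτ
    rw [mul_inv_cancel, autFactor_one] at h2
    rw [act_act_inv M hτ] at h1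
    rw [h1]
    have h3 : autFactor M⁻¹ τ ^ 5 * autFactor M (act (M⁻¹).1 τ) ^ 5 = 1 := by
      rw [← mul_pow, mul_comm, ← h2, one_pow]
    calc chi5 (act (M⁻¹).1 τ) = (ε⁻¹ * ε) * 1 * chi5 (act (M⁻¹).1 τ) := by
          rw [inv_mul_cancel₀ h0]; ring
      _ = _ := by rw [← h3]; ring

theorem mem_chi5Sub_of_tc {M : SpZ} {f : ℂ × ℂ × ℂ → ℂ × ℂ × ℂ} {κ : ℂ × ℂ × ℂ → ℂ} {π : ℕ → ℕ} {c : ℂ}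
    (hM : ∀ w ∈ UHS, act M.1 (symMat w) = symMat (f w)) (hc : c ≠ 0)
    (hj : ∀ w ∈ UHS, κ w ^ 10 = c * autFactor M (symMat w) ^ 5)
    (hπ : (Finset.Icc 1 10).val.map π = (Finset.Icc 1 10).val)
    (h : ∀ k ∈ Finset.Icc 1 10, ∃ u : ℂ, u ≠ 0 ∧ ∀ w ∈ UHS, tc k (f w) = u * κ w * tc (π k) w) :
    M ∈ chi5Sub := by
  obtain ⟨ε, h0, hε⟩ := chi5_of_tc hπ h
  refine ⟨ε * c, mul_ne_zero h0 hc, fun τ hτ => ?_⟩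
  obtain ⟨w, hw, rfl⟩ := exists_symMat hτ
  rw [hM w hw, hε w hw, hj w hw]
  ring

theorem spTrans_100_mem_chi5Sub : spTrans 1 0 0 ∈ chi5Sub := by
  -- Entry k of the list is the index of the image of the k-th even characteristic; the entry at
  -- position 0 is a filler.
  refine mem_chi5Sub_of_tc (κ := fun _ => 1) (c := 1) (π := fun k => [0, 3, 4, 1, 2, 6, 5, 7, 8, 9, 10].getD k 0)
    (fun w hw => act_spTrans 1 0 0 hw) one_ne_zero
    (fun w _ => by rw [autFactor_spTrans]; norm_num) (by decide) fun k hk => ?_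
  have hp : ∀ k ∈ Finset.Icc 1 10, ∀ i : Fin 4, (2 : ℤ) ∣
      ![evenChar k 0, evenChar k 1, evenChar k 2 + (1 * (1 + evenChar k 0) + 0 * evenChar k 1),
        evenChar k 3 + (0 * evenChar k 0 + 0 * (1 + evenChar k 1))] i -
      evenChar ([0, 3, 4, 1, 2, 6, 5, 7, 8, 9, 10].getD k 0) i := by decide
  obtain ⟨j, hj⟩ := th_congr (hp k hk 0) (hp k hk 1) (hp k hk 2) (hp k hk 3)
  obtain ⟨e, he, hadd⟩ := exists_th_add 1 0 0 (evenChar k 0) (evenChar k 1) (evenChar k 2) (evenChar k 3)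
  refine ⟨e * (-1) ^ j, mul_ne_zero he (neg_one_zpow_ne_zero j), fun w _ => ?_⟩
  rw [tc_eq, hadd]
  refine (congrArg _ (hj w)).trans ?_
  rw [mul_one, mul_assoc]
  rfl

theorem spTrans_010_mem_chi5Sub : spTrans 0 1 0 ∈ chi5Sub := by
  refine mem_chi5Sub_of_tc (κ := fun _ => 1) (c := 1) (π := fun k => [0, 1, 2, 3, 4, 6, 5, 8, 7, 10, 9].getD k 0)
    (fun w hw => act_spTrans 0 1 0 hw) one_ne_zero
    (fun w _ => by rw [autFactor_spTrans]; norm_num) (by decide) fun k hk => ?_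
  have hp : ∀ k ∈ Finset.Icc 1 10, ∀ i : Fin 4, (2 : ℤ) ∣
      ![evenChar k 0, evenChar k 1, evenChar k 2 + (0 * (1 + evenChar k 0) + 1 * evenChar k 1),
        evenChar k 3 + (1 * evenChar k 0 + 0 * (1 + evenChar k 1))] i -
      evenChar ([0, 1, 2, 3, 4, 6, 5, 8, 7, 10, 9].getD k 0) i := by decide
  obtain ⟨j, hj⟩ := th_congr (hp k hk 0) (hp k hk 1) (hp k hk 2) (hp k hk 3)
  obtain ⟨e, he, hadd⟩ := exists_th_add 0 1 0 (evenChar k 0) (evenChar k 1) (evenChar k 2) (evenChar k 3)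
  refine ⟨e * (-1) ^ j, mul_ne_zero he (neg_one_zpow_ne_zero j), fun w _ => ?_⟩
  rw [tc_eq, hadd]
  refine (congrArg _ (hj w)).trans ?_
  rw [mul_one, mul_assoc]
  rfl

theorem spLevi_upper_mem_chi5Sub : spLevi (upperSL 1) ∈ chi5Sub := by
  refine mem_chi5Sub_of_tc (κ := fun _ => 1) (c := 1) (π := fun k => [0, 1, 4, 3, 2, 5, 6, 9, 10, 7, 8].getD k 0)
    (fun w hw => act_spLevi_upper 1 hw) one_ne_zero
    (fun w _ => by rw [autFactor_spLevi]; norm_num) (by decide) fun k hk => ?_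
  have hp : ∀ k ∈ Finset.Icc 1 10, ∀ i : Fin 4, (2 : ℤ) ∣
      ![evenChar k 0, evenChar k 1 + 1 * evenChar k 0, evenChar k 2 - 1 * evenChar k 3,
        evenChar k 3] i -
      evenChar ([0, 1, 4, 3, 2, 5, 6, 9, 10, 7, 8].getD k 0) i := by decide
  obtain ⟨j, hj⟩ := th_congr (hp k hk 0) (hp k hk 1) (hp k hk 2) (hp k hk 3)
  refine ⟨_, neg_one_zpow_ne_zero j, fun w _ => ?_⟩
  rw [tc_eq, th_shear, mul_one]
  exact hj w

theorem spSwap_mem_chi5Sub : spSwap ∈ chi5Sub := by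
  refine mem_chi5Sub_of_tc (κ := fun _ => 1) (c := -1) (π := fun k => [0, 1, 3, 2, 4, 7, 8, 5, 6, 9, 10].getD k 0)
    (fun w hw => act_spSwap hw) (by norm_num)
    (fun w _ => by rw [autFactor_spSwap]; norm_num) (by decide) fun k hk => ?_
  have hp : ∀ k ∈ Finset.Icc 1 10, ∀ i : Fin 4, (2 : ℤ) ∣
      ![evenChar k 1, evenChar k 0, evenChar k 3, evenChar k 2] i -
      evenChar ([0, 1, 3, 2, 4, 7, 8, 5, 6, 9, 10].getD k 0) i := by decide
  obtain ⟨j, hj⟩ := th_congr (hp k hk 0) (hp k hk 1) (hp k hk 2) (hp k hk 3)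
  refine ⟨_, neg_one_zpow_ne_zero j, fun w _ => ?_⟩
  rw [tc_eq, th_swap, mul_one]
  exact hj w

theorem spSign_mem_chi5Sub : spSign ∈ chi5Sub := by
  refine mem_chi5Sub_of_tc (κ := fun _ => 1) (c := -1) (π := id)
    (fun w hw => act_spSign hw) (by norm_num)
    (fun w _ => by rw [autFactor_spSign]; norm_num) (by decide) fun k hk => ?_
  have hp : ∀ k ∈ Finset.Icc 1 10, ∀ i : Fin 4, (2 : ℤ) ∣
      ![-evenChar k 0, evenChar k 1, -evenChar k 2, evenChar k 3] i - evenChar k i := by decide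
  obtain ⟨j, hj⟩ := th_congr (hp k hk 0) (hp k hk 1) (hp k hk 2) (hp k hk 3)
  refine ⟨_, neg_one_zpow_ne_zero j, fun w _ => ?_⟩
  rw [tc_eq, th_sign, mul_one]
  exact hj w

theorem act_spFst_S {w : ℂ × ℂ × ℂ} (hw : w ∈ UHS) :
    act (spFst ModularGroup.S).1 (symMat w) =
      symMat (-1 / w.1, w.2.1 / w.1, w.2.2 - w.2.1 ^ 2 / w.1) := by
  rw [act_spFst _ hw]
  simp [ModularGroup.S]

theorem autFactor_spFst_S (w : ℂ × ℂ × ℂ) : autFactor (spFst ModularGroup.S) (symMat w) = w.1 := by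
  rw [autFactor_spFst]; simp [ModularGroup.S]

theorem inversion_mem_UHS {w : ℂ × ℂ × ℂ} (hw : w ∈ UHS) :
    (-1 / w.1, w.2.1 / w.1, w.2.2 - w.2.1 ^ 2 / w.1) ∈ UHS := by
  rw [← symMat_mem_H2, ← act_spFst_S hw]
  exact act_mem_H2 _ (symMat_mem_H2.2 hw)

theorem cpow_half_sq (z : ℂ) : (z ^ (1 / 2 : ℂ)) ^ 2 = z := by
  rw [one_div]
  exact_mod_cast Complex.cpow_nat_inv_pow z two_ne_zero

theorem spFst_S_mem_chi5Sub : spFst ModularGroup.S ∈ chi5Sub := by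
  refine mem_chi5Sub_of_tc (κ := fun w => (-Complex.I * w.1) ^ (1 / 2 : ℂ)) (c := (-Complex.I) ^ 5)
    (π := fun k => [0, 1, 2, 7, 8, 5, 9, 3, 4, 6, 10].getD k 0)
    (fun w hw => act_spFst_S hw) (pow_ne_zero _ (neg_ne_zero.2 Complex.I_ne_zero))
    (fun w _ => ?_) (by decide) fun k hk => ?_
  -- Since κ² = -iτ₁₁, the tenth power of κ is (-i)⁵ times the fifth power of the automorphy factor.
  · rw [autFactor_spFst_S, ← mul_pow, show (10 : ℕ) = 2 * 5 by norm_num, pow_mul, cpow_half_sq]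
  have hp : ∀ k ∈ Finset.Icc 1 10, ∀ i : Fin 4, (2 : ℤ) ∣
      ![evenChar k 2, evenChar k 1, -evenChar k 0, evenChar k 3] i -
      evenChar ([0, 1, 2, 7, 8, 5, 9, 3, 4, 6, 10].getD k 0) i := by decide
  obtain ⟨j, hj⟩ := th_congr (hp k hk 0) (hp k hk 1) (hp k hk 2) (hp k hk 3)
  refine ⟨Complex.exp (Real.pi * Complex.I * (evenChar k 0 * evenChar k 2 / 2)) * (-1) ^ j,
    mul_ne_zero (Complex.exp_ne_zero _) (neg_one_zpow_ne_zero j), fun w hw => ?_⟩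
  rw [tc_eq, th_inversion _ _ _ _ hw (inversion_mem_UHS hw)]
  refine (congrArg _ (hj w)).trans ?_
  rw [mul_comm ((-Complex.I * w.1) ^ (1 / 2 : ℂ))]
  simp only [tc_eq]
  ring

/-! ### The full group from its elementary elements -/

theorem spSnd_eq (g : SL2Z) : spSnd g = spSwap * spFst g * spSwap⁻¹ := by
  rw [eq_mul_inv_iff_mul_eq]
  apply Subtype.ext
  rw [Submonoid.coe_mul, Submonoid.coe_mul]
  simp only [spFst_val, spSnd_val, spSwap, fromBlocks_multiply]
  congr 1 <;> ext i j <;> fin_cases i <;> fin_cases j <;> simp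

theorem spLevi_lowerSL (r : ℤ) : spLevi (lowerSL r) = spSwap * spLevi (upperSL r) * spSwap⁻¹ := by
  rw [eq_mul_inv_iff_mul_eq]
  apply Subtype.ext
  rw [Submonoid.coe_mul, Submonoid.coe_mul]
  simp only [spLevi_val, upperSL_val, lowerSL_val, spSwap, fromBlocks_multiply]
  congr 1 <;> ext i j <;> fin_cases i <;> fin_cases j <;> simp

theorem spFst_upperSL (r : ℤ) : spFst (upperSL r) = spTrans r 0 0 := by
  apply Subtype.ext
  rw [spFst_val, upperSL_val, spTrans_val]
  congr 1 <;> ext i j <;> fin_cases i <;> fin_cases j <;> simp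

theorem upperSL_one : upperSL 1 = ModularGroup.T := by
  apply Subtype.ext
  rw [upperSL_val, ModularGroup.coe_T]

theorem S_eq : ModularGroup.S = upperSL (-1) * lowerSL 1 * upperSL (-1) := by
  apply Subtype.ext
  rw [Matrix.SpecialLinearGroup.coe_mul, Matrix.SpecialLinearGroup.coe_mul, upperSL_val, lowerSL_val,
    ModularGroup.coe_S]
  simp

theorem spTrans_add (a b c a' b' c' : ℤ) :
    spTrans a b c * spTrans a' b' c' = spTrans (a + a') (b + b') (c + c') := by
  apply Subtype.ext
  rw [Submonoid.coe_mul]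
  simp only [spTrans_val, fromBlocks_multiply]
  congr 1 <;> ext i j <;> fin_cases i <;> fin_cases j <;> simp [add_comm]

theorem SL2Z_induction {H : Subgroup SL2Z} (hS : ModularGroup.S ∈ H) (hT : ModularGroup.T ∈ H)
    (g : SL2Z) : g ∈ H := by
  have h : Subgroup.closure {ModularGroup.S, ModularGroup.T} ≤ H := by
    rw [Subgroup.closure_le]
    rintro x (rfl | rfl)
    exacts [hS, hT]
  rw [SpecialLinearGroup.SL2Z_generators] at h
  exact h trivial

/-- The level one case of `mem_of_levelN`: S and T generate SL(2, ℤ), and the copies of SL(2) not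
listed are conjugate to listed ones. -/
theorem Sp_induction {H : Subgroup SpZ} (h₁ : spTrans 1 0 0 ∈ H) (h₂ : spTrans 0 1 0 ∈ H)
    (h₃ : spLevi (upperSL 1) ∈ H) (h₄ : spSwap ∈ H) (h₅ : spSign ∈ H)
    (h₆ : spFst ModularGroup.S ∈ H) (M : SpZ) : M ∈ H := by
  have hF : ∀ g, spFst g ∈ H := fun g => SL2Z_induction (H := H.comap spFst) h₆
    (by rw [Subgroup.mem_comap, ← upperSL_one, spFst_upperSL]; exact h₁) g
  have hN : ∀ g, spSnd g ∈ H := fun g => by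
    rw [spSnd_eq]; exact H.mul_mem (H.mul_mem h₄ (hF g)) (H.inv_mem h₄)
  have hL : ∀ g, spLevi g ∈ H := by
    have hl : spLevi (lowerSL 1) ∈ H := by
      rw [spLevi_lowerSL]; exact H.mul_mem (H.mul_mem h₄ h₃) (H.inv_mem h₄)
    have hu : spLevi (upperSL (-1)) ∈ H := by
      have := mem_of_additive (H := H.comap spLevi) upperSL upperSL_mul (c := 1) h₃ (-1)
      simpa using this
    refine fun g => SL2Z_induction (H := H.comap spLevi) ?_ ?_ g
    · rw [Subgroup.mem_comap, S_eq, map_mul, map_mul]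
      exact H.mul_mem (H.mul_mem hu hl) hu
    · rw [Subgroup.mem_comap, ← upperSL_one]; exact h₃
  refine mem_of_levelN (N := 1) (Or.inl rfl) (fun g _ => hF g) (fun g _ => hN g) (fun g _ => hL g)
    (fun g _ => ?_) (fun a b _ _ => ?_) h₅ M (fun i j => by simp)
  · rw [spMix_eq]; exact H.mul_mem (H.mul_mem (hN _) (hL g)) (H.inv_mem (hN _))
  · have ha := mem_of_additive (H := H) (fun a => spTrans a 0 0) (fun a b => by
      rw [spTrans_add]; simp) (c := 1) h₁ a
    have hb := mem_of_additive (H := H) (fun a => spTrans 0 a 0) (fun a b => by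
      rw [spTrans_add]; simp) (c := 1) h₂ b
    have := H.mul_mem ha hb
    rw [spTrans_add] at this
    simpa using this

/-- The value of ε is never needed on the full group: it cancels in conjugations, and it affects
neither the cusp condition nor the zeros. -/
theorem exists_chi5_act (M : SpZ) :
    ∃ ε : ℂ, ε ≠ 0 ∧ ∀ τ ∈ H2, chi5 (act M.1 τ) = ε * autFactor M τ ^ 5 * chi5 τ :=
  Sp_induction spTrans_100_mem_chi5Sub spTrans_010_mem_chi5Sub spLevi_upper_mem_chi5Sub
    spSwap_mem_chi5Sub spSign_mem_chi5Sub spFst_S_mem_chi5Sub M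


/-! ### Level two -/

theorem theta_eq_th (c : Fin 4 → ℤ) (w : ℂ × ℂ × ℂ) :
    theta c (symMat w) 0 = th (c 0) (c 1) (c 2) (c 3) w := theta_zero c w

/-- The elements under which all fourth powers of theta constants have weight two, and `χ₅` has
weight five. -/
noncomputable def thetaSub : Subgroup SpZ where
  carrier := {M | ∀ τ ∈ H2, (∀ c, theta c (act M.1 τ) 0 ^ 4 = autFactor M τ ^ 2 * theta c τ 0 ^ 4) ∧
    chi5 (act M.1 τ) = autFactor M τ ^ 5 * chi5 τ}
  one_mem' := fun τ _ => by rw [act_one, autFactor_one]; simp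
  mul_mem' := by
    intro M N h h' τ hτ
    obtain ⟨h1, h2⟩ := h _ (act_mem_H2 N hτ)
    obtain ⟨h1', h2'⟩ := h' τ hτ
    refine ⟨fun c => ?_, ?_⟩
    · rw [act_mul M N hτ, autFactor_mul M N hτ, h1, h1']; ring
    · rw [act_mul M N hτ, autFactor_mul M N hτ, h2, h2']; ring
  inv_mem' := by
    intro M h τ hτ
    obtain ⟨h1, h2⟩ := h _ (act_mem_H2 M⁻¹ hτ)
    have h3 := autFactor_mul M M⁻¹ hτ
    rw [mul_inv_cancel, autFactor_one] at h3
    rw [act_act_inv M hτ] at h1 h2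
    refine ⟨fun c => ?_, ?_⟩
    · rw [h1, ← mul_assoc, ← mul_pow, mul_comm (autFactor M⁻¹ τ), ← h3]; ring
    · rw [h2, ← mul_assoc, ← mul_pow, mul_comm (autFactor M⁻¹ τ), ← h3]; ring

/-- The unknown constants η and ε occur once for G and once for its inverse and cancel, while the
automorphy factors combine by the cocycle relation. -/
theorem conj_mem_thetaSub {G M : SpZ}
    (hG : ∀ c, ∃ c' : Fin 4 → ℤ, ∃ η : ℂ, ∀ τ ∈ H2,
      theta c (act G.1 τ) 0 ^ 4 = η * autFactor G τ ^ 2 * theta c' τ 0 ^ 4)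
    (hM : M ∈ thetaSub) : G * M * G⁻¹ ∈ thetaSub := by
  intro τ hτ
  have hσ := act_mem_H2 G⁻¹ hτ
  obtain ⟨h1, h2⟩ := hM _ hσ
  have hj : autFactor (G * M * G⁻¹) τ * autFactor G (act (G⁻¹).1 τ) =
      autFactor G (act M.1 (act (G⁻¹).1 τ)) * autFactor M (act (G⁻¹).1 τ) := by
    have e := autFactor_mul (G * M * G⁻¹) G hσ
    rw [act_act_inv G hτ, inv_mul_cancel_right] at e
    rw [← e, autFactor_mul G M hσ]
  have hact : act (G * M * G⁻¹).1 τ = act G.1 (act M.1 (act (G⁻¹).1 τ)) := by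
    rw [act_mul _ _ hτ, act_mul _ _ hσ]
  refine ⟨fun c => ?_, ?_⟩
  · obtain ⟨c', η, h⟩ := hG c
    have e := h _ hσ
    rw [act_act_inv G hτ] at e
    rw [hact, h _ (act_mem_H2 M hσ), h1, e]
    linear_combination (-(η * theta c' (act (G⁻¹).1 τ) 0 ^ 4)) *
      (autFactor (G * M * G⁻¹) τ * autFactor G (act (G⁻¹).1 τ) +
      autFactor G (act M.1 (act (G⁻¹).1 τ)) * autFactor M (act (G⁻¹).1 τ)) * hj
  · obtain ⟨ε, -, h⟩ := exists_chi5_act G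
    have e := h _ hσ
    rw [act_act_inv G hτ] at e
    rw [hact, h _ (act_mem_H2 M hσ), h2, e]
    have hj5 := congrArg (· ^ 5) hj
    simp only [mul_pow] at hj5
    linear_combination (-(ε * chi5 (act (G⁻¹).1 τ))) * hj5

theorem spSwap_permutes (c : Fin 4 → ℤ) : ∃ c' : Fin 4 → ℤ, ∃ η : ℂ, ∀ τ ∈ H2,
    theta c (act spSwap.1 τ) 0 ^ 4 = η * autFactor spSwap τ ^ 2 * theta c' τ 0 ^ 4 := by
  refine ⟨![c 1, c 0, c 3, c 2], 1, fun τ hτ => ?_⟩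
  obtain ⟨w, hw, rfl⟩ := exists_symMat hτ
  rw [act_spSwap hw, theta_eq_th, theta_eq_th, autFactor_spSwap, th_swap]
  simp

theorem spFst_S_permutes (c : Fin 4 → ℤ) : ∃ c' : Fin 4 → ℤ, ∃ η : ℂ, ∀ τ ∈ H2,
    theta c (act (spFst ModularGroup.S).1 τ) 0 ^ 4 =
      η * autFactor (spFst ModularGroup.S) τ ^ 2 * theta c' τ 0 ^ 4 := by
  refine ⟨![c 2, c 1, -c 0, c 3], -1, fun τ hτ => ?_⟩
  obtain ⟨w, hw, rfl⟩ := exists_symMat hτ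
  rw [act_spFst_S hw, theta_eq_th, theta_eq_th, autFactor_spFst_S,
    th_inversion _ _ _ _ hw (inversion_mem_UHS hw), mul_pow, mul_pow, ← Complex.exp_nat_mul]
  have e : Complex.exp ((4 : ℕ) * (Real.pi * Complex.I * (c 0 * c 2 / 2))) = 1 := by
    rw [← Complex.exp_zero]
    refine Complex.exp_eq_exp_of_int (c 0 * c 2) ?_
    push_cast; ring
  have e2 : ((-Complex.I * w.1) ^ (1 / 2 : ℂ)) ^ 4 = -w.1 ^ 2 := by
    calc ((-Complex.I * w.1) ^ (1 / 2 : ℂ)) ^ 4 = (((-Complex.I * w.1) ^ (1 / 2 : ℂ)) ^ 2) ^ 2 := by ring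
      _ = -w.1 ^ 2 := by rw [cpow_half_sq, mul_pow, neg_sq, Complex.I_sq]; ring
  rw [e, e2]
  simp

theorem tc_pow_four_trans (a b : ℤ) (m₁ m₂ k₁ k₂ : ℤ) (w : ℂ × ℂ × ℂ) :
    th m₁ m₂ k₁ k₂ (w.1 + (2 * a : ℤ), w.2.1 + (2 * b : ℤ), w.2.2 + (2 * 0 : ℤ)) ^ 4 =
      th m₁ m₂ k₁ k₂ w ^ 4 := by
  rw [th_add_even, mul_pow, ← Complex.exp_nat_mul]
  have e : Complex.exp ((4 : ℕ) * (Real.pi * Complex.I *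
      ((a * m₁ ^ 2 + 2 * b * m₁ * m₂ + (0 : ℤ) * m₂ ^ 2) / 2))) = 1 := by
    rw [← Complex.exp_zero]
    refine Complex.exp_eq_exp_of_int (a * m₁ ^ 2 + 2 * b * m₁ * m₂) ?_
    push_cast; ring
  rw [e, one_mul]

theorem spTrans_even_mem_thetaSub (a b : ℤ) : spTrans (2 * a) (2 * b) 0 ∈ thetaSub := by
  intro τ hτ
  obtain ⟨w, hw, rfl⟩ := exists_symMat hτ
  have hact := act_spTrans (2 * a) (2 * b) (2 * 0) hw
  rw [mul_zero] at hact
  rw [hact, autFactor_spTrans]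
  refine ⟨fun c => ?_, ?_⟩
  · rw [theta_eq_th, theta_eq_th, one_pow, one_mul]
    simpa using tc_pow_four_trans a b (c 0) (c 1) (c 2) (c 3) w
  · have key : ∀ k, tc k (w.1 + (2 * a : ℤ), w.2.1 + (2 * b : ℤ), w.2.2 + (0 : ℤ)) =
        Complex.exp (Real.pi * Complex.I * ((a * evenChar k 0 ^ 2 + 2 * b * evenChar k 0 * evenChar k 1) / 2))
        * tc k w := by
      intro k
      have := th_add_even a b 0 (evenChar k 0) (evenChar k 1) (evenChar k 2) (evenChar k 3) w
      simpa [tc_eq] using this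
    rw [one_pow, one_mul]
    simp only [chi5, vt_symMat, key]
    rw [Finset.prod_mul_distrib, ← Complex.exp_sum]
    -- Four of the ten even characteristics have μ₁ = 1 and two of these have μ₂ = 1, so the phases
    -- add up to a multiple of 2πi.
    have hsum : ∑ k ∈ Finset.Icc 1 10, (Real.pi * Complex.I * ((a * evenChar k 0 ^ 2 +
        2 * b * evenChar k 0 * evenChar k 1) / 2) : ℂ) = 0 + 2 * Real.pi * Complex.I * (a + b : ℤ) := by
      simp [Finset.sum_Icc_succ_top, evenChar]
      ring
    rw [hsum, Complex.exp_eq_exp_of_int (a + b) rfl, Complex.exp_zero, one_mul]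

theorem spLevi_upper_two_mem_thetaSub : spLevi (upperSL 2) ∈ thetaSub := by
  intro τ hτ
  obtain ⟨w, hw, rfl⟩ := exists_symMat hτ
  rw [act_spLevi_upper 2 hw, autFactor_spLevi]
  have key : ∀ m₁ m₂ k₁ k₂ : ℤ, th m₁ m₂ k₁ k₂ (w.1 + 2 * (2 : ℤ) * w.2.1 + (2 : ℤ) ^ 2 * w.2.2,
      w.2.1 + (2 : ℤ) * w.2.2, w.2.2) = (-1) ^ (m₁ * k₂) * th m₁ m₂ k₁ k₂ w := by
    intro m₁ m₂ k₁ k₂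
    rw [th_shear 2, th, wTheta_m₂]
    have := wTheta_k (fun _ _ => 1) m₁ m₂ k₁ k₂ (-k₂) 0 w
    rw [mul_neg, ← sub_eq_add_neg, mul_zero, add_zero, mul_zero, add_zero, mul_neg, _root_.zpow_neg] at this
    rw [this]
    congr 1
    rw [← _root_.inv_zpow]
    norm_num
  refine ⟨fun c => ?_, ?_⟩
  · rw [theta_eq_th, theta_eq_th, key, mul_pow, neg_one_zpow_pow_four, one_pow]
  · have key' : ∀ k, tc k (w.1 + 2 * (2 : ℤ) * w.2.1 + (2 : ℤ) ^ 2 * w.2.2,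
      w.2.1 + (2 : ℤ) * w.2.2, w.2.2) = (-1) ^ (evenChar k 0 * evenChar k 3) * tc k w :=
      fun k => key _ _ _ _
    rw [one_pow, one_mul]
    simp only [chi5, vt_symMat, key']
    rw [Finset.prod_mul_distrib]
    -- Exactly two even characteristics, 1001 and 1111, contribute a sign.
    have : ∏ k ∈ Finset.Icc 1 10, (-1 : ℂ) ^ (evenChar k 0 * evenChar k 3) = 1 := by
      simp [Finset.prod_Icc_succ_top, evenChar]
    rw [this, one_mul]

theorem spSign_mem_thetaSub : spSign ∈ thetaSub := by
  intro τ hτ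
  obtain ⟨w, hw, rfl⟩ := exists_symMat hτ
  rw [act_spSign hw, autFactor_spSign]
  have key : ∀ m₁ m₂ k₁ k₂ : ℤ, th m₁ m₂ k₁ k₂ (w.1, -w.2.1, w.2.2)
      = (-1) ^ (m₁ * k₁) * th m₁ m₂ k₁ k₂ w := by
    intro m₁ m₂ k₁ k₂
    have e1 := wTheta_m₁ (fun _ _ => 1) m₁ m₂ (-k₁) k₂ (-m₁) w
    have e2 := wTheta_k (fun _ _ => 1) m₁ m₂ k₁ k₂ (-k₁) 0 w
    rw [show m₁ + 2 * -m₁ = -m₁ by ring] at e1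
    rw [show k₁ + 2 * -k₁ = -k₁ by ring, mul_zero, add_zero, mul_zero, add_zero, mul_neg, _root_.zpow_neg] at e2
    rw [th_sign, th, e1, e2]
    congr 1
    rw [← _root_.inv_zpow]
    norm_num
  refine ⟨fun c => ?_, ?_⟩
  · rw [theta_eq_th, theta_eq_th, key, mul_pow, neg_one_zpow_pow_four]; norm_num
  · have key' : ∀ k, tc k (w.1, -w.2.1, w.2.2) = (-1) ^ (evenChar k 0 * evenChar k 2) * tc k w :=
      fun k => key _ _ _ _
    simp only [chi5, vt_symMat, key']
    rw [Finset.prod_mul_distrib]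
    -- Only 1111 contributes a sign; the resulting -1 matches the fifth power of the automorphy
    -- factor -1.
    have : ∏ k ∈ Finset.Icc 1 10, (-1 : ℂ) ^ (evenChar k 0 * evenChar k 2) = -1 := by
      simp [Finset.prod_Icc_succ_top, evenChar]
    rw [this]
    norm_num

theorem spFst_neg_one : spFst (-1) = spSign := by
  apply Subtype.ext
  rw [spFst_val, spSign]
  congr 1 <;> ext i j <;> fin_cases i <;> fin_cases j <;> simp

theorem spLevi_neg_one : spLevi (-1) = spSign * (spSwap * spSign * spSwap⁻¹) := by
  rw [← mul_assoc, eq_mul_inv_iff_mul_eq]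
  apply Subtype.ext
  simp only [Submonoid.coe_mul, spLevi_val, spSwap, spSign, fromBlocks_multiply]
  congr 1 <;> ext i j <;> fin_cases i <;> fin_cases j <;> simp

theorem lowerSL_two : lowerSL 2 = ModularGroup.S * (upperSL 2)⁻¹ * ModularGroup.S⁻¹ := by
  have h : (upperSL 2)⁻¹ = upperSL (-2) := by
    rw [inv_eq_iff_mul_eq_one, upperSL_mul]
    apply Subtype.ext
    rw [upperSL_val, Matrix.SpecialLinearGroup.coe_one]
    ext i j; fin_cases i <;> fin_cases j <;> simp
  rw [h, eq_mul_inv_iff_mul_eq]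
  apply Subtype.ext
  rw [Matrix.SpecialLinearGroup.coe_mul, Matrix.SpecialLinearGroup.coe_mul, upperSL_val, lowerSL_val,
    ModularGroup.coe_S]
  simp

/-- Rewrites conjugation by the second partial inversion as successive conjugations by the swap, the
first partial inversion and the swap. -/
theorem conj_conj_eq {G : Type*} [Group G] {x y z : G} (hx : x⁻¹ = x) :
    x * y * x⁻¹ * z * (x * y * x⁻¹)⁻¹ = x * (y * (x * z * x⁻¹) * y⁻¹) * x⁻¹ := by
  rw [hx]
  simp only [_root_.mul_inv_rev, hx, mul_assoc]

/-- Every elementary element of level two comes from even translations, the Levi element with entry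
2 and the sign change, through products, inverses and conjugation by the swap and the partial
inversion. Conjugation is covered by `conj_mem_thetaSub`. -/
theorem mem_thetaSub (M : SpZ) (hM : LevelN 2 M.1) : M ∈ thetaSub := by
  have hsw : ∀ {K : SpZ}, K ∈ thetaSub → spSwap * K * spSwap⁻¹ ∈ thetaSub :=
    conj_mem_thetaSub spSwap_permutes
  have hin : ∀ {K : SpZ}, K ∈ thetaSub →
      spFst ModularGroup.S * K * (spFst ModularGroup.S)⁻¹ ∈ thetaSub :=
    conj_mem_thetaSub spFst_S_permutes
  have hF : ∀ g : SL2Z, LevelN 2 g.1 → spFst g ∈ thetaSub := by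
    have hu : spFst (upperSL 2) ∈ thetaSub := by
      rw [spFst_upperSL]; exact spTrans_even_mem_thetaSub 1 0
    refine mem_of_level_two (H := thetaSub.comap spFst) hu ?_ ?_
    · rw [Subgroup.mem_comap, lowerSL_two, map_mul, map_mul, map_inv, map_inv]
      exact hin (thetaSub.inv_mem hu)
    · rw [Subgroup.mem_comap, spFst_neg_one]; exact spSign_mem_thetaSub
  have hL : ∀ g : SL2Z, LevelN 2 g.1 → spLevi g ∈ thetaSub := by
    refine mem_of_level_two (H := thetaSub.comap spLevi) spLevi_upper_two_mem_thetaSub ?_ ?_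
    · rw [Subgroup.mem_comap, spLevi_lowerSL]; exact hsw spLevi_upper_two_mem_thetaSub
    · rw [Subgroup.mem_comap, spLevi_neg_one]
      exact thetaSub.mul_mem spSign_mem_thetaSub (hsw spSign_mem_thetaSub)
  refine mem_of_levelN (Or.inr rfl) hF (fun g hg => ?_) hL (fun g hg => ?_) (fun a b ha hb => ?_)
    spSign_mem_thetaSub M hM
  · rw [spSnd_eq]; exact hsw (hF g hg)
  · rw [spMix_eq, spSnd_eq]
    have h := hsw (hin (hsw (hL g hg)))
    have hW : spSwap⁻¹ = spSwap := by
      rw [inv_eq_iff_mul_eq_one]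
      apply Subtype.ext
      rw [Submonoid.coe_mul, toBlocks_one]
      simp only [spSwap, fromBlocks_multiply]
      congr 1 <;> ext i j <;> fin_cases i <;> fin_cases j <;> simp
    rwa [conj_conj_eq hW]
  · obtain ⟨a, rfl⟩ := ha
    obtain ⟨b, rfl⟩ := hb
    exact spTrans_even_mem_thetaSub a b

theorem theta_pow_four_act {M : Matrix (Fin 2 ⊕ Fin 2) (Fin 2 ⊕ Fin 2) ℤ} (hM : M ∈ GamTwo)
    (c : Fin 4 → ℤ) {τ : Matrix (Fin 2) (Fin 2) ℂ} (hτ : τ ∈ H2) :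
    theta c (act M τ) 0 ^ 4 = (denom M τ).det ^ 2 * theta c τ 0 ^ 4 :=
  (mem_thetaSub ⟨M, hM.1⟩ hM.2 τ hτ).1 c

theorem chi5_act {M : Matrix (Fin 2 ⊕ Fin 2) (Fin 2 ⊕ Fin 2) ℤ} (hM : M ∈ GamTwo)
    {τ : Matrix (Fin 2) (Fin 2) ℂ} (hτ : τ ∈ H2) :
    chi5 (act M τ) = (denom M τ).det ^ 5 * chi5 τ :=
  (mem_thetaSub ⟨M, hM.1⟩ hM.2 τ hτ).2

/-! ### The cusp forms -/

theorem isHolomorphic_of_tc {F : Matrix (Fin 2) (Fin 2) ℂ → ℂ} {f : ℂ × ℂ × ℂ → ℂ}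
    (hf : DifferentiableOn ℂ f UHS) (h : ∀ w ∈ UHS, F (symMat w) = f w) : IsHolomorphic F := by
  have e : {w : ℂ × ℂ × ℂ | !![w.1, w.2.1; w.2.1, w.2.2] ∈ H2} = UHS :=
    Set.ext fun w => symMat_mem_H2
  rw [IsHolomorphic, e]
  exact hf.congr h

/-- The sign change of τ₁₂ fixes diagonal matrices but turns ϑ₁₀ into its negative. -/
theorem chi5_diag (z w : ℂ) : chi5 !![z, 0; 0, w] = 0 := by
  have h1 := th_sign 1 1 1 1 (z, 0, w)
  have h2 := wTheta_m₁ (fun _ _ => 1) (-1) 1 (-1) 1 1 (z, 0, w)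
  have h3 := wTheta_neg_one₃ (fun _ _ => 1) 1 1 1 (z, 0, w)
  have h4 : tc 10 (z, 0, w) = 0 := by
    rw [tc_eq]
    change th 1 1 1 1 (z, 0, w) = 0
    simp only [neg_zero] at h1
    rw [show (-1 + 2 * 1 : ℤ) = 1 by norm_num] at h2
    rw [zpow_one] at h3
    linear_combination (h1 - h2 + h3) / 2
  change chi5 (symMat (z, 0, w)) = 0
  rw [chi5_symMat, h4, mul_zero]

/-- Each translate of χ₅ is a constant multiple of χ₅, so the translate of F vanishes identically on
the diagonal, not only in the limit. -/
theorem isCuspForm_of_chi5 {k : ℤ} {F g : Matrix (Fin 2) (Fin 2) ℂ → ℂ} (hF : IsModularForm k F)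
    (h : ∀ τ ∈ H2, F τ = chi5 τ * g τ) : IsCuspForm k F := by
  refine ⟨hF, fun M hM z hz => ?_⟩
  refine tendsto_const_nhds.congr' ?_
  filter_upwards [eventually_gt_atTop 0] with t ht
  have hw : (z, (0 : ℂ), Complex.I * (t : ℂ)) ∈ UHS := by
    refine ⟨hz, ?_⟩
    simpa using mul_pos hz ht
  have hτ : !![z, 0; 0, Complex.I * (t : ℂ)] ∈ H2 := symMat_mem_H2.2 hw
  obtain ⟨ε, -, hε⟩ := exists_chi5_act ⟨M, hM⟩
  rw [slash, h _ (act_mem_H2 ⟨M, hM⟩ hτ), hε _ hτ, chi5_diag]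
  simp

theorem isCuspForm_wedge_12_34_56 : IsCuspForm 15 (wedge (Gf 1 2) (Gf 3 4) (Gf 5 6)) := by
  have h : ∀ τ ∈ H2, wedge (Gf 1 2) (Gf 3 4) (Gf 5 6) τ = chi5 τ * ((Real.pi : ℂ) ^ 6 *
      (vt 1 τ ^ 4 * vt 2 τ ^ 4 * vt 3 τ ^ 4 * vt 4 τ ^ 4) * (vt 5 τ ^ 4 - vt 6 τ ^ 4)) := by
    intro τ hτ
    obtain ⟨w, hw, rfl⟩ := exists_symMat hτ
    rw [wedge_12_34_56 hw]
    simp only [vt_symMat]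
    ring
  refine isCuspForm_of_chi5 ⟨?_, fun M hM τ hτ => ?_⟩ h
  · refine isHolomorphic_of_tc ?_ fun w hw => wedge_12_34_56 hw
    simp only [chi5_symMat]
    have hd := differentiableOn_tc
    fun_prop (disch := exact hd _)
  · rw [h _ (act_mem_H2 ⟨M, hM.1⟩ hτ), h τ hτ, chi5_act hM hτ]
    simp only [vt, theta_pow_four_act hM _ hτ]
    norm_cast
    ring

/-- The product of four squares is replaced by a quadratic polynomial in fourth powers, making the
weight 5 + 2·3 + 2·2 visible. -/
theorem isCuspForm_wedge_12_13_45 : IsCuspForm 15 (wedge (Gf 1 2) (Gf 1 3) (Gf 4 5)) := by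
  have h : ∀ τ ∈ H2, wedge (Gf 1 2) (Gf 1 3) (Gf 4 5) τ = chi5 τ * ((Real.pi : ℂ) ^ 6 *
      (vt 1 τ ^ 4 * vt 4 τ ^ 4 * vt 6 τ ^ 4) * ((vt 3 τ ^ 4 * vt 5 τ ^ 4 + vt 8 τ ^ 4 * vt 10 τ ^ 4
        - vt 1 τ ^ 4 * vt 6 τ ^ 4) / 2)) := by
    intro τ hτ
    obtain ⟨w, hw, rfl⟩ := exists_symMat hτ
    rw [wedge_12_13_45 hw]
    simp only [vt_symMat]
    rw [← tc_relation_quadratic hw]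
    ring
  refine isCuspForm_of_chi5 ⟨?_, fun M hM τ hτ => ?_⟩ h
  · refine isHolomorphic_of_tc ?_ fun w hw => wedge_12_13_45 hw
    simp only [chi5_symMat]
    have hd := differentiableOn_tc
    fun_prop (disch := exact hd _)
  · rw [h _ (act_mem_H2 ⟨M, hM.1⟩ hτ), h τ hτ, chi5_act hM hτ]
    simp only [vt, theta_pow_four_act hM _ hτ]
    norm_cast
    ring

theorem isCuspForm_wedge_12_13_14 : IsCuspForm 15 (wedge (Gf 1 2) (Gf 1 3) (Gf 1 4)) := by
  refine isCuspForm_of_chi5 (g := 0) ⟨?_, fun M hM τ hτ => ?_⟩ fun τ _ => ?_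
  · exact isHolomorphic_of_tc (f := fun _ => 0) (differentiableOn_const _) fun w _ => wedge_12_13_14 _
  · rw [wedge_12_13_14, wedge_12_13_14, mul_zero]
  · rw [wedge_12_13_14]; simp


/-! ### Reduction theory -/

/-- The determinant of the imaginary part. -/
noncomputable def imDet (w : ℂ × ℂ × ℂ) : ℝ := w.1.im * w.2.2.im - w.2.1.im ^ 2

theorem imDet_pos {w : ℂ × ℂ × ℂ} (hw : w ∈ UHS) : 0 < imDet w := sub_pos.2 hw.2

/-- The last diagonal entry of the inverse of the imaginary part. -/
noncomputable def hgt (w : ℂ × ℂ × ℂ) : ℝ := w.1.im / imDet w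

theorem det_sub_conjTranspose (w : ℂ × ℂ × ℂ) :
    (symMat w - (symMat w)ᴴ).det = -4 * (imDet w : ℂ) := by
  have h : ∀ z : ℂ, z - (starRingEnd ℂ) z = 2 * Complex.I * z.im := fun z => by
    rw [Complex.sub_conj]; push_cast; ring
  rw [Matrix.det_fin_two]
  simp only [symMat, Matrix.sub_apply, Matrix.conjTranspose_apply, Matrix.of_apply, Matrix.cons_val',
    Matrix.cons_val, ← starRingEnd_apply, h, imDet]
  push_cast
  linear_combination 4 * (w.1.im * w.2.2.im - w.2.1.im ^ 2 : ℂ) * Complex.I_sq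

theorem imDet_act (M : SpZ) {w w' : ℂ × ℂ × ℂ} (hw : w ∈ UHS) (h : act M.1 (symMat w) = symMat w') :
    Complex.normSq (autFactor M (symMat w)) * imDet w' = imDet w := by
  have h1 := conjTranspose_denom_mul_numer M (symMat w)
  rw [← act_mul_denom M (symMat_mem_H2.2 hw), h, Matrix.conjTranspose_mul, ← Matrix.mul_assoc,
    ← Matrix.sub_mul, ← Matrix.mul_sub] at h1
  have h2 := congrArg Matrix.det h1
  rw [Matrix.det_mul, Matrix.det_mul, Matrix.det_conjTranspose, det_sub_conjTranspose,
    det_sub_conjTranspose] at h2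
  have h3 : (Complex.normSq (autFactor M (symMat w)) : ℂ) * imDet w' = imDet w := by
    rw [Complex.normSq_eq_conj_mul_self, starRingEnd_apply, autFactor]
    linear_combination (-1 / 4 : ℂ) * h2
  exact_mod_cast h3

/-- The value of the dual form of `Im τ` at the last row of `(C, D)`, up to the determinant. -/
noncomputable def rowForm (w : ℂ × ℂ × ℂ) (r : (ℤ × ℤ) × (ℤ × ℤ)) : ℝ :=
  imForm w (r.1.1 * w.2.1 + r.1.2 * w.2.2 + r.2.2).re (-(r.1.1 * w.1 + r.1.2 * w.2.1 + r.2.1)).re +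
  imForm w (r.1.1 * w.2.1 + r.1.2 * w.2.2 + r.2.2).im (-(r.1.1 * w.1 + r.1.2 * w.2.1 + r.2.1)).im

/-- The last row of `M`. -/
def lastRow (M : SpZ) : (ℤ × ℤ) × (ℤ × ℤ) :=
  ((M.1 (Sum.inr 1) (Sum.inl 0), M.1 (Sum.inr 1) (Sum.inl 1)),
    (M.1 (Sum.inr 1) (Sum.inr 0), M.1 (Sum.inr 1) (Sum.inr 1)))

theorem hgt_act (M : SpZ) {w w' : ℂ × ℂ × ℂ} (hw : w ∈ UHS) (h : act M.1 (symMat w) = symMat w') :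
    hgt w' = rowForm w (lastRow M) / imDet w := by
  have hj : Complex.normSq (autFactor M (symMat w)) ≠ 0 := by
    rw [Ne, Complex.normSq_eq_zero]; exact autFactor_ne_zero M (symMat_mem_H2.2 hw)
  -- The vector is chosen so that the denominator maps it to (det(Cτ + D), 0). The invariant
  -- Hermitian form then isolates y₁₁ of the image point and involves only the last row of M.
  have hv := im_star_denom_numer M (symMat w) ![denom M.1 (symMat w) 1 1, -denom M.1 (symMat w) 1 0]
  have hE : denom M.1 (symMat w) *ᵥ ![denom M.1 (symMat w) 1 1, -denom M.1 (symMat w) 1 0] =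
      ![autFactor M (symMat w), 0] := by
    ext i; fin_cases i <;> simp [mulVec, dotProduct, Fin.sum_univ_two, autFactor, Matrix.det_fin_two]
      <;> ring
  rw [← act_mul_denom M (symMat_mem_H2.2 hw), h, ← Matrix.mulVec_mulVec, hE,
    im_star_dotProduct (symMat_mem_H2.2 hw).1] at hv
  have hl : (star ![autFactor M (symMat w), 0] ⬝ᵥ symMat w' *ᵥ ![autFactor M (symMat w), 0]).im =
      Complex.normSq (autFactor M (symMat w)) * w'.1.im := by
    simp [dotProduct, mulVec, Fin.sum_univ_two, symMat, Complex.normSq_apply]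
    ring
  have hr : Complex.normSq (autFactor M (symMat w)) * w'.1.im = rowForm w (lastRow M) := by
    rw [← hl, hv]
    simp [rowForm, imForm, lastRow, denom, symMat, dotProduct, mulVec, Fin.sum_univ_two,
      Matrix.mul_apply, toBlocks₂₁, toBlocks₂₂]
    ring
  rw [hgt, ← imDet_act M hw h, ← hr, mul_div_mul_left _ _ hj]

theorem finite_abs_le (K : ℝ) : {n : ℤ | |(n : ℝ)| ≤ K}.Finite := by
  refine (Set.finite_Icc (-⌈K⌉) ⌈K⌉).subset fun n hn => ?_
  have h : -K ≤ (n : ℝ) ∧ (n : ℝ) ≤ K := abs_le.1 hn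
  have hc := Int.le_ceil K
  constructor
  · have : (-(⌈K⌉ : ℝ)) ≤ n := by linarith
    exact_mod_cast this
  · have : (n : ℝ) ≤ ⌈K⌉ := by linarith
    exact_mod_cast this

theorem mul_le_of_sq_le {ε K x y : ℝ} (hε : 0 ≤ ε) (hK : 0 ≤ K) (hx : 0 ≤ x) (hy : 0 ≤ y)
    (h : ε * (x ^ 2 + y ^ 2) ≤ K * (x + y)) : (x + y) * ε ≤ 2 * K := by
  rcases (add_nonneg hx hy).eq_or_lt with h0 | h0
  · rw [← h0, zero_mul]; linarith
  · have h1 : ε * (x + y) ^ 2 ≤ ε * (2 * (x ^ 2 + y ^ 2)) :=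
      mul_le_mul_of_nonneg_left (by nlinarith [sq_nonneg (x - y)]) hε
    have h2 : ((x + y) * ε) * (x + y) ≤ (2 * K) * (x + y) := by nlinarith
    exact le_of_mul_le_mul_right h2 h0

/-- The form is positive definite in the entries u, v of (c₁, c₂)τ + (d₁, d₂). Their imaginary parts
bound (c₁, c₂), and then their real parts bound (d₁, d₂). -/
theorem finite_rowForm_le {w : ℂ × ℂ × ℂ} (hw : w ∈ UHS) (B : ℝ) :
    {r | rowForm w r ≤ B}.Finite := by
  obtain ⟨ε, hε, h⟩ := exists_mem_UHSgt hw
  set K : ℝ := Real.sqrt (B / ε) with hK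
  set C : ℝ := 2 * K / ε with hC
  set D : ℝ := K + C * (|w.1.re| + |w.2.1.re| + |w.2.2.re|) with hD
  refine (((finite_abs_le C).prod (finite_abs_le C)).prod
    ((finite_abs_le D).prod (finite_abs_le D))).subset ?_
  rintro ⟨⟨c₁, c₂⟩, ⟨d₁, d₂⟩⟩ hr
  have hr' : rowForm w ((c₁, c₂), (d₁, d₂)) ≤ B := hr
  rw [rowForm] at hr'
  set u : ℂ := c₁ * w.2.1 + c₂ * w.2.2 + d₂ with hu
  set v : ℂ := c₁ * w.1 + c₂ * w.2.1 + d₁ with hv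
  have g1 := imForm_ge h u.re (-v).re
  have g2 := imForm_ge h u.im (-v).im
  have g : u.re ^ 2 + v.re ^ 2 + u.im ^ 2 + v.im ^ 2 ≤ B / ε := by
    rw [le_div_iff₀ hε]
    simp only [Complex.neg_re, Complex.neg_im, neg_sq] at g1 g2
    simp only [Complex.neg_re, Complex.neg_im] at hr'
    linarith
  have b1 : |u.re| ≤ K := Real.abs_le_sqrt (by nlinarith [sq_nonneg v.re, sq_nonneg u.im, sq_nonneg v.im])
  have b2 : |v.re| ≤ K := Real.abs_le_sqrt (by nlinarith [sq_nonneg u.re, sq_nonneg u.im, sq_nonneg v.im])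
  have b3 : |u.im| ≤ K := Real.abs_le_sqrt (by nlinarith [sq_nonneg v.re, sq_nonneg u.re, sq_nonneg v.im])
  have b4 : |v.im| ≤ K := Real.abs_le_sqrt (by nlinarith [sq_nonneg v.re, sq_nonneg u.im, sq_nonneg u.re])
  have eu : u.im = c₁ * w.2.1.im + c₂ * w.2.2.im := by simp [hu]
  have ev : v.im = c₁ * w.1.im + c₂ * w.2.1.im := by simp [hv]
  have eu' : (d₂ : ℝ) = u.re - (c₁ * w.2.1.re + c₂ * w.2.2.re) := by simp [hu]
  have ev' : (d₁ : ℝ) = v.re - (c₁ * w.1.re + c₂ * w.2.1.re) := by simp [hv]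
  have hK0 : 0 ≤ K := Real.sqrt_nonneg _
  have hc : ε * ((c₁ : ℝ) ^ 2 + c₂ ^ 2) ≤ K * (|(c₁ : ℝ)| + |(c₂ : ℝ)|) := by
    have e : imForm w c₁ c₂ = c₁ * v.im + c₂ * u.im := by rw [eu, ev, imForm]; ring
    have h1 : (c₁ : ℝ) * v.im ≤ |(c₁ : ℝ)| * K := by
      refine (le_abs_self _).trans ?_
      rw [abs_mul]; exact mul_le_mul_of_nonneg_left b4 (abs_nonneg _)
    have h2 : (c₂ : ℝ) * u.im ≤ |(c₂ : ℝ)| * K := by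
      refine (le_abs_self _).trans ?_
      rw [abs_mul]; exact mul_le_mul_of_nonneg_left b3 (abs_nonneg _)
    have h3 := imForm_ge h (c₁ : ℝ) c₂
    rw [e] at h3
    linarith
  have hsum : |(c₁ : ℝ)| + |(c₂ : ℝ)| ≤ C := by
    rw [hC, le_div_iff₀ hε]
    exact mul_le_of_sq_le hε.le hK0 (abs_nonneg _) (abs_nonneg _) (by rwa [sq_abs, sq_abs])
  have hC1 : |(c₁ : ℝ)| ≤ C := by linarith [abs_nonneg (c₂ : ℝ)]
  have hC2 : |(c₂ : ℝ)| ≤ C := by linarith [abs_nonneg (c₁ : ℝ)]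
  have hC0 : 0 ≤ C := (abs_nonneg _).trans hC1
  have bound : ∀ (a x y : ℝ), |a| ≤ K → |x| + |y| ≤ |w.1.re| + |w.2.1.re| + |w.2.2.re| →
      |a - (c₁ * x + c₂ * y)| ≤ D := by
    intro a x y ha hxy
    have t1 : |a - (c₁ * x + c₂ * y)| ≤ |a| + (|(c₁ : ℝ)| * |x| + |(c₂ : ℝ)| * |y|) := by
      rw [← abs_mul, ← abs_mul]
      exact (abs_sub _ _).trans (add_le_add_right (abs_add_le _ _) _)
    have t2 : |(c₁ : ℝ)| * |x| ≤ C * |x| := mul_le_mul_of_nonneg_right hC1 (abs_nonneg _)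
    have t3 : |(c₂ : ℝ)| * |y| ≤ C * |y| := mul_le_mul_of_nonneg_right hC2 (abs_nonneg _)
    have t4 : C * (|x| + |y|) ≤ C * (|w.1.re| + |w.2.1.re| + |w.2.2.re|) :=
      mul_le_mul_of_nonneg_left hxy hC0
    rw [hD]; linarith
  refine ⟨⟨hC1, hC2⟩, ?_, ?_⟩
  · show |(d₁ : ℝ)| ≤ D
    rw [ev']
    exact bound _ _ _ b2 (by linarith [abs_nonneg w.2.2.re])
  · show |(d₂ : ℝ)| ≤ D
    rw [eu']
    exact bound _ _ _ b1 (by linarith [abs_nonneg w.1.re])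

theorem exists_act_eq (M : SpZ) {w : ℂ × ℂ × ℂ} (hw : w ∈ UHS) :
    ∃ w' ∈ UHS, act M.1 (symMat w) = symMat w' :=
  exists_symMat (act_mem_H2 M (symMat_mem_H2.2 hw))

/-- Points of minimal height in their orbit. -/
def IsMinimal (w : ℂ × ℂ × ℂ) : Prop :=
  ∀ M : SpZ, ∀ w', act M.1 (symMat w) = symMat w' → hgt w ≤ hgt w'

/-- The height in the orbit depends only on the last row of the matrix, and only finitely many rows
have a value not exceeding that of the identity. -/
theorem exists_isMinimal {w : ℂ × ℂ × ℂ} (hw : w ∈ UHS) :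
    ∃ M : SpZ, ∃ w' ∈ UHS, act M.1 (symMat w) = symMat w' ∧ IsMinimal w' := by
  have hfin := (finite_rowForm_le hw (rowForm w (lastRow 1))).inter_of_left (Set.range lastRow)
  obtain ⟨r, ⟨hr, ⟨M, rfl⟩⟩, hmin⟩ := Set.exists_min_image _ (rowForm w) hfin 
    ⟨lastRow 1, le_refl (rowForm w (lastRow 1)), ⟨1, rfl⟩⟩
  obtain ⟨w', hw', h⟩ := exists_act_eq M hw
  refine ⟨M, w', hw', h, fun N w'' h'' => ?_⟩
  have h2 : act (N * M).1 (symMat w) = symMat w'' := by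
    rw [act_mul _ _ (symMat_mem_H2.2 hw), h, h'']
  rw [hgt_act M hw h, hgt_act (N * M) hw h2]
  refine div_le_div_of_nonneg_right ?_ (imDet_pos hw).le
  by_cases hc : rowForm w (lastRow (N * M)) ≤ rowForm w (lastRow 1)
  · exact hmin _ ⟨hc, ⟨_, rfl⟩⟩
  · exact hr.trans (not_le.1 hc).le

theorem IsMinimal.act {w w' : ℂ × ℂ × ℂ} (hw : w ∈ UHS) (h : IsMinimal w) (M : SpZ)
    (hM : SiegelTwo.act M.1 (symMat w) = symMat w') (he : hgt w' = hgt w) : IsMinimal w' := by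
  intro N w'' h''
  rw [he]
  refine h (N * M) w'' ?_
  rw [act_mul _ _ (symMat_mem_H2.2 hw), hM, h'']

theorem act_spLevi_lower (r : ℤ) {w : ℂ × ℂ × ℂ} (hw : w ∈ UHS) :
    act (spLevi (lowerSL r)).1 (symMat w) =
      symMat (w.1, w.2.1 + r * w.1, w.2.2 + 2 * r * w.2.1 + r ^ 2 * w.1) := by
  refine act_eq_of_mul _ hw ?_
  rw [spLevi_val, denom_fromBlocks, numer_fromBlocks, lowerSL_val]
  ext i j; fin_cases i <;> fin_cases j <;> simp [symMat, Matrix.mul_apply, Fin.sum_univ_two] <;>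
    ring

theorem hgt_spFst (g : SL2Z) {w w' : ℂ × ℂ × ℂ} (hw : w ∈ UHS)
    (h : act (spFst g).1 (symMat w) = symMat w') : hgt w' = hgt w := by
  rw [hgt_act _ hw h, hgt]
  congr 1
  simp [lastRow, spFst_val, rowForm, imForm]

/-- The conditions of reduction theory that are used below. -/
structure SiegelReduced (w : ℂ × ℂ × ℂ) : Prop where
  mem : w ∈ UHS
  im_ge : Real.sqrt 3 / 2 ≤ w.1.im
  im_off : 2 * |w.2.1.im| ≤ w.1.im
  im_le : w.1.im ≤ w.2.2.im
  re_off : 2 * |w.2.1.re| ≤ 1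

theorem exists_abs_add_mul_le (a : ℝ) {b : ℝ} (hb : 0 < b) : ∃ k : ℤ, 2 * |a + k * b| ≤ b := by
  refine ⟨-round (a / b), ?_⟩
  have h := abs_sub_round (a / b)
  have e : a + ((-round (a / b) : ℤ) : ℝ) * b = (a / b - round (a / b)) * b := by
    push_cast; field_simp; ring
  rw [e, abs_mul, abs_of_pos hb]
  nlinarith

/-- Starting from minimal height, SL(2, ℤ) moves τ₁₁ into its fundamental domain; then a Levi
element and a translation reduce τ₁₂ without changing τ₁₁. None of these steps alters the height. -/
theorem exists_isReduced {w : ℂ × ℂ × ℂ} (hw : w ∈ UHS) :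
    ∃ M : SpZ, ∃ w', act M.1 (symMat w) = symMat w' ∧ SiegelReduced w' := by
  obtain ⟨M₀, w₀, hw₀, e₀, m₀⟩ := exists_isMinimal hw
  obtain ⟨g, hg⟩ := ModularGroup.exists_smul_mem_fd ⟨w₀.1, hw₀.1⟩
  obtain ⟨w₁, hw₁, e₁⟩ := exists_act_eq (spFst g) hw₀
  have m₁ := m₀.act hw₀ _ e₁ (hgt_spFst g hw₀ e₁)
  have him : Real.sqrt 3 / 2 ≤ w₁.1.im := by
    have h3 := ModularGroup.three_le_four_mul_im_sq_of_mem_fd hg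
    have hc : ((g • (⟨w₀.1, hw₀.1⟩ : UpperHalfPlane) : UpperHalfPlane) : ℂ) = w₁.1 := by
      rw [UpperHalfPlane.coe_specialLinearGroup_apply]
      rw [act_spFst g hw₀] at e₁
      have := congrFun (congrFun e₁ 0) 0
      simpa [symMat] using this
    have hc' : (g • (⟨w₀.1, hw₀.1⟩ : UpperHalfPlane) : UpperHalfPlane).im = w₁.1.im := by
      rw [← hc]; rfl
    rw [hc'] at h3
    have : Real.sqrt 3 ≤ 2 * w₁.1.im := by
      rw [Real.sqrt_le_left (by linarith [hw₁.1])]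
      linarith
    linarith
  obtain ⟨k, hk⟩ := exists_abs_add_mul_le w₁.2.1.im hw₁.1
  obtain ⟨l, hl⟩ := exists_abs_add_mul_le (w₁.2.1.re + k * w₁.1.re) one_pos
  have hw₂ := act_mem_H2 (spLevi (lowerSL k)) (symMat_mem_H2.2 hw₁)
  have e₂ := act_spLevi_lower k hw₁
  rw [e₂, symMat_mem_H2] at hw₂
  have m₂ := m₁.act hw₁ _ e₂ (by
    simp only [hgt, imDet, Complex.add_im, Complex.mul_im, Complex.intCast_im, Complex.intCast_re,
      pow_two, Complex.mul_re, Complex.re_ofNat, Complex.im_ofNat]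
    congr 1
    ring)
  have hw₃ := act_mem_H2 (spTrans 0 l 0) (symMat_mem_H2.2 hw₂)
  have e₃ := act_spTrans 0 l 0 hw₂
  rw [e₃, symMat_mem_H2] at hw₃
  have m₃ := m₂.act hw₂ _ e₃ (by simp [hgt, imDet])
  refine ⟨spTrans 0 l 0 * (spLevi (lowerSL k) * (spFst g * M₀)), _, ?_, ⟨hw₃, ?_, ?_, ?_, ?_⟩⟩
  · have hτ := symMat_mem_H2.2 hw
    rw [act_mul _ _ hτ, act_mul _ _ hτ, act_mul _ _ hτ, e₀, e₁, e₂, e₃]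
  · simpa using him
  · simpa using hk
  -- Exchanging the coordinates gives height y₂₂/det, so minimality yields y₁₁ ≤ y₂₂.
  · have hs := m₃ spSwap _ (act_spSwap hw₃)
    have hp := imDet_pos hw₃
    have hd : ∀ u : ℂ × ℂ × ℂ, imDet (u.2.2, u.2.1, u.1) = imDet u := fun u => by
      simp only [imDet]; ring
    rw [hgt, hgt, hd, div_le_div_iff_of_pos_right hp] at hs
    exact hs
  · simpa using hl

/-! ### Series dominated by a few of their terms -/

/-- If the whole series were zero, the terms outside s would sum to minus the finite sum, which is
larger than their total bound permits. -/
theorem tsum_ne_zero_of_dominant {ι : Type*} {f : ι → ℂ} {g : ι → ℝ} {a : ℝ} (s : Finset ι)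
    (hf : Summable f) (hg : HasSum g a) (h : ∀ i ∉ s, ‖f i‖ ≤ g i)
    (hlt : a - ∑ i ∈ s, g i < ‖∑ i ∈ s, f i‖) : ∑' i, f i ≠ 0 := by
  intro h0
  have hg' : HasSum (g ∘ ((↑) : {x // x ∉ s} → ι)) (a - ∑ i ∈ s, g i) :=
    s.hasSum_compl_iff.2 (by rwa [sub_add_cancel])
  have hf' : HasSum (f ∘ ((↑) : {x // x ∉ s} → ι)) (-∑ i ∈ s, f i) :=
    s.hasSum_compl_iff.2 (by rw [neg_add_cancel, ← h0]; exact hf.hasSum)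
  have := tsum_of_norm_bounded hg' fun i => h i.1 i.2
  rw [show ∑' i : {x // x ∉ s}, f i = _ from hf'.tsum_eq, norm_neg] at this
  exact absurd this (not_le.2 hlt)

/-- The natural number `|n + 1/2| - 1/2`. -/
def halfAbs (n : ℤ) : ℕ := if 0 ≤ n then n.natAbs else n.natAbs - 1

theorem halfAbs_natCast (n : ℕ) : halfAbs n = n := by simp [halfAbs]

theorem halfAbs_neg (n : ℕ) : halfAbs (-(n + 1)) = n := by
  rw [halfAbs, if_neg (by omega)]
  omega

theorem halfAbs_spec (n : ℤ) : (n : ℝ) + 1 / 2 = halfAbs n + 1 / 2 ∨ (n : ℝ) + 1 / 2 = -(halfAbs n + 1 / 2) := by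
  rcases n with n | n
  · left; simp [halfAbs]
  · right
    have := halfAbs_neg n
    rw [Int.negSucc_eq, this]
    push_cast; ring

theorem abs_add_half (n : ℤ) : |(n : ℝ) + 1 / 2| = halfAbs n + 1 / 2 := by
  have h : (0 : ℝ) ≤ halfAbs n + 1 / 2 := by positivity
  rcases halfAbs_spec n with e | e <;> rw [e]
  · exact abs_of_nonneg h
  · rw [abs_neg, abs_of_nonneg h]

theorem hasSum_halfAbs {φ : ℕ → ℝ} {a : ℝ} (h : HasSum φ a) :
    HasSum (fun n : ℤ => φ (halfAbs n)) (a + a) :=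
  HasSum.of_nat_of_neg_add_one (by simpa only [halfAbs_natCast] using h)
    (by simpa only [halfAbs_neg] using h)

/-- The indicator of zero. -/
def zeroInd (n : ℤ) : ℝ := if n = 0 then 1 else 0

theorem hasSum_zeroInd : HasSum zeroInd 1 := hasSum_ite_eq 0 1

/-- The geometric weight away from zero. -/
noncomputable def geomWt (n : ℤ) : ℝ := if n = 0 then 0 else (4 / 15) ^ (2 * n.natAbs)

theorem hasSum_geomWt : HasSum geomWt (32 / 209) := by
  have h : HasSum (fun n : ℕ => ((16 / 225 : ℝ)) ^ n) (1 - 16 / 225)⁻¹ :=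
    hasSum_geometric_of_lt_one (by norm_num) (by norm_num)
  have h1 := h.mul_left (16 / 225)
  have e1 : (16 / 225 : ℝ) * (1 - 16 / 225)⁻¹ = 16 / 209 := by norm_num
  rw [e1] at h1
  have h2 : HasSum (fun n : ℕ => geomWt n) (16 / 209) := by
    rw [← hasSum_nat_add_iff' 1]
    simp only [Finset.range_one, Finset.sum_singleton]
    have : geomWt ((0 : ℕ) : ℤ) = 0 := by simp [geomWt]
    rw [this, sub_zero]
    refine h1.congr_fun fun n => ?_
    rw [geomWt, if_neg (by omega), pow_mul, show ((n + 1 : ℕ) : ℤ).natAbs = n + 1 by omega, pow_succ']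
    norm_num
  have h3 : HasSum (fun n : ℕ => geomWt (-(n + 1))) (16 / 209) := by
    refine h1.congr_fun fun n => ?_
    rw [geomWt, if_neg (by omega), pow_mul, show (-((n : ℤ) + 1)).natAbs = n + 1 by omega, pow_succ']
    norm_num
  have := HasSum.of_nat_of_neg_add_one h2 h3
  convert this using 1
  norm_num

theorem geomWt_nonneg (n : ℤ) : 0 ≤ geomWt n := by
  rw [geomWt]; split_ifs <;> positivity

theorem zeroInd_nonneg (n : ℤ) : 0 ≤ zeroInd n := by
  rw [zeroInd]; split_ifs <;> norm_num

/-- The geometric weight of half-integers. -/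
noncomputable def halfWt (n : ℤ) : ℝ := (4 / 15) ^ (2 * halfAbs n)

theorem hasSum_halfWt : HasSum halfWt (450 / 209) := by
  have h : HasSum (fun n : ℕ => (4 / 15 : ℝ) ^ (2 * n)) (1 - (4 / 15) ^ 2)⁻¹ := by
    simp only [pow_mul]
    exact hasSum_geometric_of_lt_one (by norm_num) (by norm_num)
  have := hasSum_halfAbs h
  rwa [show (1 - (4 / 15) ^ 2 : ℝ)⁻¹ + (1 - (4 / 15) ^ 2)⁻¹ = 450 / 209 by norm_num] at this

theorem halfWt_nonneg (n : ℤ) : 0 ≤ halfWt n := by rw [halfWt]; positivity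

/-- The arithmetico-geometric weight of half-integers. -/
noncomputable def oddWt (n : ℤ) : ℝ := (2 * halfAbs n + 1) * (4 / 15) ^ (2 * halfAbs n)

theorem hasSum_oddWt : HasSum oddWt (108450 / 43681) := by
  have h0 : HasSum (fun n : ℕ => (4 / 15 : ℝ) ^ (2 * n)) (1 - (4 / 15) ^ 2)⁻¹ := by
    simp only [pow_mul]
    exact hasSum_geometric_of_lt_one (by norm_num) (by norm_num)
  have h1 : HasSum (fun n : ℕ => (n : ℝ) * ((4 / 15) ^ 2) ^ n) ((4 / 15) ^ 2 / (1 - (4 / 15) ^ 2) ^ 2) :=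
    hasSum_coe_mul_geometric_of_norm_lt_one (by norm_num)
  have h2 : HasSum (fun n : ℕ => (2 * n + 1 : ℝ) * (4 / 15) ^ (2 * n))
      (2 * ((4 / 15) ^ 2 / (1 - (4 / 15) ^ 2) ^ 2) + (1 - (4 / 15) ^ 2)⁻¹) := by
    refine ((h1.mul_left 2).add h0).congr_fun fun n => ?_
    rw [pow_mul]; ring
  have := hasSum_halfAbs h2
  rwa [show (2 * ((4 / 15) ^ 2 / (1 - (4 / 15) ^ 2) ^ 2) + (1 - (4 / 15) ^ 2)⁻¹ +
    (2 * ((4 / 15) ^ 2 / (1 - (4 / 15) ^ 2) ^ 2) + (1 - (4 / 15) ^ 2)⁻¹) : ℝ) = 108450 / 43681 by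
    norm_num] at this

theorem oddWt_nonneg (n : ℤ) : 0 ≤ oddWt n := by rw [oddWt]; positivity

theorem HasSum.mul_prod {u v : ℤ → ℝ} {a b : ℝ} (hu : HasSum u a) (hv : HasSum v b)
    (hu0 : ∀ n, 0 ≤ u n) (hv0 : ∀ n, 0 ≤ v n) : HasSum (fun n : ℤ × ℤ => u n.1 * v n.2) (a * b) :=
  hu.mul hv (hu.summable.mul_of_nonneg hv.summable hu0 hv0)

/-- The weights away from the origin add up to about 0.64 < 1. The factor 225/16 = (15/4)²
compensates for the mixed term in the quadratic form. -/
theorem tsum_ne_zero_integral {f : ℤ × ℤ → ℂ} (hf : Summable f) (h0 : f (0, 0) = 1)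
    (h : ∀ n : ℤ × ℤ, n ≠ 0 → ‖f n‖ ≤ zeroInd n.1 * zeroInd n.2 + geomWt n.1 * zeroInd n.2 +
      zeroInd n.1 * geomWt n.2 + 225 / 16 * (geomWt n.1 * geomWt n.2)) : ∑' n, f n ≠ 0 := by
  have hg := (((hasSum_zeroInd.mul_prod hasSum_zeroInd zeroInd_nonneg zeroInd_nonneg).add
    (hasSum_geomWt.mul_prod hasSum_zeroInd geomWt_nonneg zeroInd_nonneg)).add
    (hasSum_zeroInd.mul_prod hasSum_geomWt zeroInd_nonneg geomWt_nonneg)).add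
    ((hasSum_geomWt.mul_prod hasSum_geomWt geomWt_nonneg geomWt_nonneg).mul_left (225 / 16))
  refine tsum_ne_zero_of_dominant {0} hf hg (fun n hn => h n (by simpa using hn)) ?_
  have e : f 0 = 1 := h0
  simp only [Finset.sum_singleton, e, zeroInd, geomWt, Prod.fst_zero, Prod.snd_zero]
  norm_num

/-- Relative to the leading modulus, the two equal leading terms contribute 2 and the other weights
about 1.39. -/
theorem tsum_ne_zero_half {f : ℤ × ℤ → ℂ} (hf : Summable f) {m : ℂ} (hm : m ≠ 0) (h0 : f (0, 0) = m)
    (h1 : f (-1, 0) = m) (h : ∀ n : ℤ × ℤ, ‖f n‖ ≤ ‖m‖ * (halfWt n.1 * zeroInd n.2 +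
      15 / 4 * (halfWt n.1 * geomWt n.2))) : ∑' n, f n ≠ 0 := by
  have hg := ((hasSum_halfWt.mul_prod hasSum_zeroInd halfWt_nonneg zeroInd_nonneg).add
    ((hasSum_halfWt.mul_prod hasSum_geomWt halfWt_nonneg geomWt_nonneg).mul_left (15 / 4))).mul_left ‖m‖
  refine tsum_ne_zero_of_dominant {(0, 0), (-1, 0)} hf hg (fun n _ => h n) ?_
  rw [Finset.sum_pair (by simp), Finset.sum_pair (by simp), h0, h1]
  have hp : 0 < ‖m‖ := norm_pos_iff.2 hm
  have e : ‖m + m‖ = 2 * ‖m‖ := by rw [← two_mul, norm_mul]; norm_num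
  have w0 : halfWt 0 = 1 := by simp [halfWt, halfAbs]
  have w1 : halfWt (-1) = 1 := by simp [halfWt, halfAbs]
  have z0 : zeroInd 0 = 1 := by simp [zeroInd]
  have g0 : geomWt 0 = 0 := by simp [geomWt]
  rw [e]
  simp only [w0, w1, z0, g0]
  nlinarith

/-- Relative to the leading modulus, the four equal leading terms contribute 4 and the other weights
about 2.17. -/
theorem tsum_ne_zero_odd {f : ℤ × ℤ → ℂ} (hf : Summable f) {m : ℂ} (hm : m ≠ 0) (h0 : f (0, 0) = m)
    (h1 : f (-1, 0) = m) (h2 : f (0, -1) = m) (h3 : f (-1, -1) = m)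
    (h : ∀ n : ℤ × ℤ, ‖f n‖ ≤ ‖m‖ * (oddWt n.1 * oddWt n.2)) : ∑' n, f n ≠ 0 := by
  have hg := (hasSum_oddWt.mul_prod hasSum_oddWt oddWt_nonneg oddWt_nonneg).mul_left ‖m‖
  refine tsum_ne_zero_of_dominant {(0, 0), (-1, 0), (0, -1), (-1, -1)} hf hg (fun n _ => h n) ?_
  rw [Finset.sum_insert (by simp), Finset.sum_insert (by simp), Finset.sum_pair (by simp),
    Finset.sum_insert (by simp), Finset.sum_insert (by simp), Finset.sum_pair (by simp), h0, h1, h2, h3]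
  have hp : 0 < ‖m‖ := norm_pos_iff.2 hm
  have e : ‖m + (m + (m + m))‖ = 4 * ‖m‖ := by
    rw [show m + (m + (m + m)) = 4 * m by ring, norm_mul]; norm_num
  have w0 : oddWt 0 = 1 := by simp [oddWt, halfAbs]
  have w1 : oddWt (-1) = 1 := by simp [oddWt, halfAbs]
  rw [e]
  simp only [w0, w1]
  nlinarith

/-! ### Estimates on the reduced domain -/

theorem exp_neg_pi_le {y : ℝ} (hy : Real.sqrt 3 / 2 ≤ y) : Real.exp (-(Real.pi * (y / 2))) ≤ 4 / 15 := by
  have h3 : (1.732 : ℝ) ≤ Real.sqrt 3 := Real.le_sqrt_of_sq_le (by norm_num)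
  have hpi := Real.pi_gt_d4
  -- The product π√3/4 slightly exceeds 1.36, and the Taylor polynomial of degree 4 at 1.36 exceeds
  -- 15/4.
  have h : (1.36 : ℝ) ≤ Real.pi * (y / 2) := by nlinarith
  rw [Real.exp_neg, inv_le_comm₀ (Real.exp_pos _) (by norm_num)]
  have he := Real.sum_le_exp_of_nonneg (x := 1.36) (by norm_num) 5
  have : (15 / 4 : ℝ) ≤ Real.exp 1.36 := by
    refine le_trans ?_ he
    norm_num [Finset.sum_range_succ, Nat.factorial]
  calc (4 / 15 : ℝ)⁻¹ = 15 / 4 := by norm_num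
    _ ≤ Real.exp 1.36 := this
    _ ≤ _ := Real.exp_le_exp.2 h

theorem exp_neg_pi_le_mul_pow {y X X₀ : ℝ} (hy : Real.sqrt 3 / 2 ≤ y) (N : ℕ) (h : N * (y / 2) ≤ X - X₀) :
    Real.exp (-(Real.pi * X)) ≤ Real.exp (-(Real.pi * X₀)) * (4 / 15) ^ N := by
  have h1 : Real.exp (-(Real.pi * X)) ≤
      Real.exp (-(Real.pi * X₀)) * Real.exp (-(Real.pi * (y / 2))) ^ N := by
    rw [← Real.exp_nat_mul, ← Real.exp_add, Real.exp_le_exp]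
    nlinarith [Real.pi_pos]
  exact h1.trans (mul_le_mul_of_nonneg_left
    (pow_le_pow_left₀ (Real.exp_pos _).le (exp_neg_pi_le hy) N) (Real.exp_pos _).le)

theorem SiegelReduced.im_pos {w : ℂ × ℂ × ℂ} (h : SiegelReduced w) : 0 < w.1.im := h.mem.1

/-- The condition 2|y₁₂| ≤ y₁₁ bounds the mixed term by y₁₁|x||y|. -/
theorem SiegelReduced.imForm_ge {w : ℂ × ℂ × ℂ} (h : SiegelReduced w) (x y : ℝ) :
    w.1.im * (|x| ^ 2 - |x| * |y|) + w.2.2.im * |y| ^ 2 ≤ imForm w x y := by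
  have h1 : -(2 * |w.2.1.im| * (|x| * |y|)) ≤ 2 * w.2.1.im * x * y := by
    have := neg_abs_le (2 * w.2.1.im * x * y)
    rw [abs_mul, abs_mul, abs_mul, abs_two] at this
    linarith
  have h2 : 2 * |w.2.1.im| * (|x| * |y|) ≤ w.1.im * (|x| * |y|) :=
    mul_le_mul_of_nonneg_right h.im_off (mul_nonneg (abs_nonneg _) (abs_nonneg _))
  rw [imForm, ← sq_abs x, ← sq_abs y]
  linarith

theorem abs_intCast_eq (n : ℤ) : |(n : ℝ)| = n.natAbs := by
  rw [Nat.cast_natAbs]; push_cast; rfl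

theorem th_00_ne_zero {w : ℂ × ℂ × ℂ} (h : SiegelReduced w) (k₁ k₂ : ℤ) : th 0 0 k₁ k₂ w ≠ 0 := by
  rw [th_eq]
  refine tsum_ne_zero_integral (summable_thTerm _ _ _ _ h.mem) (by simp [thTerm]) fun n hn => ?_
  rw [norm_thTerm]
  have hi := h.imForm_ge (n.1 + (0 : ℤ) / 2) (n.2 + (0 : ℤ) / 2)
  simp only [Int.cast_zero, zero_div, add_zero] at hi ⊢
  rw [abs_intCast_eq, abs_intCast_eq] at hi
  have hy := h.im_pos
  have hb : ∀ N : ℕ, N * (w.1.im / 2) ≤ imForm w n.1 n.2 →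
      Real.exp (-(Real.pi * imForm w n.1 n.2)) ≤ (4 / 15) ^ N := fun N hN => by
    have := exp_neg_pi_le_mul_pow (X := imForm w n.1 n.2) (X₀ := 0) h.im_ge N (by rwa [sub_zero])
    simpa using this
  have sq_le : ∀ a : ℕ, (a : ℝ) ≤ (a : ℝ) ^ 2 := fun a => by
    exact_mod_cast Nat.le_self_pow two_ne_zero a
  by_cases h1 : n.1 = 0
  · have h2 : n.2 ≠ 0 := fun h2 => hn (Prod.ext h1 h2)
    have e : zeroInd n.1 * zeroInd n.2 + geomWt n.1 * zeroInd n.2 + zeroInd n.1 * geomWt n.2 +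
        225 / 16 * (geomWt n.1 * geomWt n.2) = (4 / 15) ^ (2 * n.2.natAbs) := by
      simp [zeroInd, geomWt, h1, h2]
    rw [e]
    refine hb _ (le_trans ?_ hi)
    simp only [h1, Int.natAbs_zero]
    push_cast
    nlinarith [sq_le n.2.natAbs, h.im_le]
  · by_cases h2 : n.2 = 0
    · have e : zeroInd n.1 * zeroInd n.2 + geomWt n.1 * zeroInd n.2 + zeroInd n.1 * geomWt n.2 +
          225 / 16 * (geomWt n.1 * geomWt n.2) = (4 / 15) ^ (2 * n.1.natAbs) := by
        simp [zeroInd, geomWt, h1, h2]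
      rw [e]
      refine hb _ (le_trans ?_ hi)
      simp only [h2, Int.natAbs_zero]
      push_cast
      nlinarith [sq_le n.1.natAbs]
    · obtain ⟨a, ha⟩ := Nat.exists_eq_succ_of_ne_zero (Int.natAbs_ne_zero.2 h1)
      obtain ⟨b, hb'⟩ := Nat.exists_eq_succ_of_ne_zero (Int.natAbs_ne_zero.2 h2)
      have e : zeroInd n.1 * zeroInd n.2 + geomWt n.1 * zeroInd n.2 + zeroInd n.1 * geomWt n.2 +
          225 / 16 * (geomWt n.1 * geomWt n.2) = (4 / 15) ^ (2 * (a + b + 1)) := by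
        simp only [zeroInd, geomWt, h1, h2, ha, hb', if_false]
        rw [Nat.succ_eq_add_one, Nat.succ_eq_add_one]
        ring
      rw [e]
      refine hb _ (le_trans ?_ hi)
      rw [ha, hb']
      push_cast
      -- With a + 1 and b + 1 the absolute values of the coordinates, this makes the form at least
      -- y₁₁(a + b + 1), that is, 2(a + b + 1) units of y₁₁/2.
      have key : (a + b + 1 : ℝ) ≤ ((a + 1) ^ 2 - (a + 1) * (b + 1)) + (b + 1) ^ 2 := by
        nlinarith [sq_nonneg ((a : ℝ) - b), mul_nonneg (Nat.cast_nonneg (α := ℝ) a) (Nat.cast_nonneg (α := ℝ) b)]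
      have h4 : w.1.im * ((b : ℝ) + 1) ^ 2 ≤ w.2.2.im * (b + 1) ^ 2 :=
        mul_le_mul_of_nonneg_right h.im_le (sq_nonneg _)
      nlinarith

/-- It gives an excess of 2a + 2b + 1 units of y/2 over the leading term, which is the exponent in
`le_halfWt_bound`. Integrality is essential for small b, hence the case distinction. -/
theorem half_ineq (a b : ℕ) : (a + (b + 1) - 1 / 2 : ℝ) ≤
    (a + 1 / 2) ^ 2 - 1 / 4 - (a + 1 / 2) * (b + 1) + (b + 1) ^ 2 := by
  have h : (0 : ℤ) ≤ ((a : ℤ) - (b + 1)) ^ 2 + a ^ 2 + (b + 1) ^ 2 - 3 * (b + 1) + 1 := by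
    rcases b with _ | _ | b
    · rcases a with _ | a
      · norm_num
      · push_cast; nlinarith
    · rcases a with _ | a
      · norm_num
      · push_cast; nlinarith
    · push_cast; nlinarith [sq_nonneg ((a : ℤ) - (b + 1 + 1 + 1)), sq_nonneg (a : ℤ)]
  have h' : (0 : ℝ) ≤ ((a : ℝ) - (b + 1)) ^ 2 + a ^ 2 + (b + 1) ^ 2 - 3 * (b + 1) + 1 := by
    exact_mod_cast h
  nlinarith

theorem le_halfWt_bound {y : ℝ} (hy : Real.sqrt 3 / 2 ≤ y) {X X₀ : ℝ} (n : ℤ × ℤ)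
    (h : y * ((halfAbs n.1 + 1 / 2 : ℝ) ^ 2 - 1 / 4 - (halfAbs n.1 + 1 / 2) * n.2.natAbs + (n.2.natAbs : ℝ) ^ 2)
      ≤ X - X₀) :
    Real.exp (-(Real.pi * X)) ≤ Real.exp (-(Real.pi * X₀)) * (halfWt n.1 * zeroInd n.2 +
      15 / 4 * (halfWt n.1 * geomWt n.2)) := by
  have hy0 : 0 < y := lt_of_lt_of_le (by positivity) hy
  by_cases h2 : n.2 = 0
  · have e : halfWt n.1 * zeroInd n.2 + 15 / 4 * (halfWt n.1 * geomWt n.2) =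
        (4 / 15) ^ (2 * halfAbs n.1) := by
      simp [zeroInd, geomWt, h2, halfWt]
    rw [e]
    refine exp_neg_pi_le_mul_pow hy _ (le_trans ?_ h)
    simp only [h2, Int.natAbs_zero]
    push_cast
    nlinarith [sq_nonneg (halfAbs n.1 : ℝ)]
  · obtain ⟨b, hb⟩ := Nat.exists_eq_succ_of_ne_zero (Int.natAbs_ne_zero.2 h2)
    have e : halfWt n.1 * zeroInd n.2 + 15 / 4 * (halfWt n.1 * geomWt n.2) =
        (4 / 15) ^ (2 * halfAbs n.1 + 2 * b + 1) := by
      simp only [zeroInd, geomWt, h2, halfWt, hb, if_false]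
      rw [Nat.succ_eq_add_one]
      ring
    rw [e]
    refine exp_neg_pi_le_mul_pow hy _ (le_trans ?_ h)
    rw [hb]
    push_cast
    nlinarith [half_ineq (halfAbs n.1) b]

theorem th_10_ne_zero {w : ℂ × ℂ × ℂ} (h : SiegelReduced w) (k : ℤ) : th 1 0 0 k w ≠ 0 := by
  rw [th_eq]
  refine tsum_ne_zero_half (summable_thTerm _ _ _ _ h.mem)
    (m := Complex.exp (Real.pi * Complex.I * (w.1 / 4))) (Complex.exp_ne_zero _) ?_ ?_ fun n => ?_
  · rw [thTerm]; congr 1; push_cast; ring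
  · rw [thTerm]; congr 1; push_cast; ring
  · have hm : ‖Complex.exp (Real.pi * Complex.I * (w.1 / 4))‖ = Real.exp (-(Real.pi * (w.1.im / 4))) := by
      rw [Complex.norm_exp]; congr 1; simp
    rw [hm, norm_thTerm]
    refine le_halfWt_bound h.im_ge n ?_
    have hi := h.imForm_ge (n.1 + (1 : ℤ) / 2) (n.2 + (0 : ℤ) / 2)
    simp only [Int.cast_zero, zero_div, add_zero, Int.cast_one] at hi ⊢
    rw [abs_intCast_eq, abs_add_half] at hi
    nlinarith [mul_le_mul_of_nonneg_right h.im_le (sq_nonneg (n.2.natAbs : ℝ))]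

theorem th_01_ne_zero {w : ℂ × ℂ × ℂ} (h : SiegelReduced w) (k : ℤ) : th 0 1 k 0 w ≠ 0 := by
  rw [th_eq, ← (Equiv.prodComm ℤ ℤ).tsum_eq]
  refine tsum_ne_zero_half ((Equiv.prodComm ℤ ℤ).summable_iff.2 (summable_thTerm _ _ _ _ h.mem))
    (m := Complex.exp (Real.pi * Complex.I * (w.2.2 / 4))) (Complex.exp_ne_zero _) ?_ ?_ fun n => ?_
  · simp only [thTerm, Equiv.prodComm_apply, Prod.swap]; congr 1; push_cast; ring
  · simp only [thTerm, Equiv.prodComm_apply, Prod.swap]; congr 1; push_cast; ring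
  · have hm : ‖Complex.exp (Real.pi * Complex.I * (w.2.2 / 4))‖ =
        Real.exp (-(Real.pi * (w.2.2.im / 4))) := by
      rw [Complex.norm_exp]; congr 1; simp
    rw [hm, norm_thTerm]
    refine le_halfWt_bound h.im_ge n ?_
    simp only [Equiv.prodComm_apply, Prod.swap]
    have hi := h.imForm_ge (n.2 + (0 : ℤ) / 2) (n.1 + (1 : ℤ) / 2)
    simp only [Int.cast_zero, zero_div, add_zero, Int.cast_one] at hi ⊢
    rw [abs_intCast_eq, abs_add_half] at hi
    have h4 : (0 : ℝ) ≤ (halfAbs n.1 + 1 / 2 : ℝ) ^ 2 - 1 / 4 := by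
      have : (0 : ℝ) ≤ halfAbs n.1 := Nat.cast_nonneg _
      nlinarith
    nlinarith [mul_le_mul_of_nonneg_right h.im_le h4]

/-! ### The characteristics `(1, 1)` -/

theorem norm_cos_le (z : ℂ) : ‖Complex.cos z‖ ≤ Real.exp |z.im| := by
  rw [Complex.cos, norm_div]
  have h1 : ‖Complex.exp (z * Complex.I)‖ ≤ Real.exp |z.im| := by
    rw [Complex.norm_exp]; refine Real.exp_le_exp.2 ?_; simpa using neg_le_abs z.im
  have h2 : ‖Complex.exp (-z * Complex.I)‖ ≤ Real.exp |z.im| := by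
    rw [Complex.norm_exp]; refine Real.exp_le_exp.2 ?_; simpa using le_abs_self z.im
  have h3 := norm_add_le (Complex.exp (z * Complex.I)) (Complex.exp (-z * Complex.I))
  rw [Complex.norm_two]
  linarith

theorem norm_add_two_mul_cos_le {x y z : ℂ} {k : ℕ}
    (hx : ‖x‖ ≤ (2 * k + 1) * Real.exp (2 * k * |z.im|) * ‖y‖) :
    ‖x‖ + ‖2 * Complex.cos ((2 * k + 2) * z) * y‖ ≤
      (2 * (k + 1 : ℕ) + 1) * Real.exp (2 * (k + 1 : ℕ) * |z.im|) * ‖y‖ := by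
  have h1 := norm_cos_le ((2 * k + 2) * z)
  have e : ((2 * k + 2) * z : ℂ).im = 2 * (k + 1 : ℕ) * z.im := by
    rw [show (2 * k + 2 : ℂ) = ((2 * (k + 1 : ℕ) : ℝ) : ℂ) by push_cast; ring, Complex.im_ofReal_mul]
  rw [e, abs_mul, abs_of_nonneg (by positivity)] at h1
  have h2 : Real.exp (2 * k * |z.im|) ≤ Real.exp (2 * (k + 1 : ℕ) * |z.im|) := by
    refine Real.exp_le_exp.2 (mul_le_mul_of_nonneg_right ?_ (abs_nonneg _))
    push_cast; linarith
  rw [norm_mul, norm_mul, Complex.norm_two]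
  have h3 := mul_le_mul_of_nonneg_right h1 (norm_nonneg y)
  have h4 := mul_le_mul_of_nonneg_right
    (mul_le_mul_of_nonneg_left h2 (by positivity : (0 : ℝ) ≤ 2 * k + 1)) (norm_nonneg y)
  calc ‖x‖ + 2 * ‖Complex.cos ((2 * k + 2) * z)‖ * ‖y‖
      ≤ (2 * k + 1) * Real.exp (2 * (k + 1 : ℕ) * |z.im|) * ‖y‖
        + 2 * (Real.exp (2 * (k + 1 : ℕ) * |z.im|) * ‖y‖) := by linarith
    _ = _ := by push_cast; ring

/-- Induction with sin((2k+3)z) = sin((2k+1)z) + 2cos((2k+2)z) sin z. Keeping the factor |sin z|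
controls all terms relative to the leading one even near its zeros. -/
theorem norm_sin_odd_mul_le (z : ℂ) (k : ℕ) :
    ‖Complex.sin ((2 * k + 1) * z)‖ ≤ (2 * k + 1) * Real.exp (2 * k * |z.im|) * ‖Complex.sin z‖ := by
  induction k with
  | zero => simp
  | succ k ih =>
    have e : Complex.sin ((2 * (k + 1 : ℕ) + 1) * z) =
        Complex.sin ((2 * k + 1) * z) + 2 * Complex.cos ((2 * k + 2) * z) * Complex.sin z := by
      have h1 : (2 * (k + 1 : ℕ) + 1) * z = (2 * k + 2) * z + z := by push_cast; ring
      have h2 : (2 * k + 1) * z = (2 * k + 2) * z - z := by ring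
      rw [h1, h2, Complex.sin_add, Complex.sin_sub]; ring
    rw [e]
    exact (norm_add_le _ _).trans (norm_add_two_mul_cos_le ih)

theorem norm_cos_odd_mul_le (z : ℂ) (k : ℕ) :
    ‖Complex.cos ((2 * k + 1) * z)‖ ≤ (2 * k + 1) * Real.exp (2 * k * |z.im|) * ‖Complex.cos z‖ := by
  induction k with
  | zero => simp
  | succ k ih =>
    have e : Complex.cos ((2 * (k + 1 : ℕ) + 1) * z) =
        -Complex.cos ((2 * k + 1) * z) + 2 * Complex.cos ((2 * k + 2) * z) * Complex.cos z := by
      have h1 : (2 * (k + 1 : ℕ) + 1) * z = (2 * k + 2) * z + z := by push_cast; ring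
      have h2 : (2 * k + 1) * z = (2 * k + 2) * z - z := by ring
      rw [h1, h2, Complex.cos_add, Complex.cos_sub]; ring
    rw [e]
    refine (norm_add_le _ _).trans ?_
    rw [norm_neg]
    exact norm_add_two_mul_cos_le ih

/-- The diagonal part of the exponential, at half-integers. -/
noncomputable def diagTerm (w : ℂ × ℂ × ℂ) (n : ℤ × ℤ) : ℂ :=
  Complex.exp (Real.pi * Complex.I * (w.1 * ((n.1 : ℂ) + 1 / 2) ^ 2 + w.2.2 * ((n.2 : ℂ) + 1 / 2) ^ 2))

theorem norm_diagTerm (w : ℂ × ℂ × ℂ) (n : ℤ × ℤ) : ‖diagTerm w n‖ = Real.exp (-(Real.pi *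
    (w.1.im * (halfAbs n.1 + 1 / 2) ^ 2 + w.2.2.im * (halfAbs n.2 + 1 / 2) ^ 2))) := by
  rw [diagTerm, Complex.norm_exp, ← abs_add_half, ← abs_add_half, sq_abs, sq_abs]
  have e : (Real.pi * Complex.I * (w.1 * ((n.1 : ℂ) + 1 / 2) ^ 2 + w.2.2 * ((n.2 : ℂ) + 1 / 2) ^ 2) : ℂ) =
      Complex.I * ((Real.pi * ((n.1 : ℝ) + 1 / 2) ^ 2 : ℝ) * w.1 +
        (Real.pi * ((n.2 : ℝ) + 1 / 2) ^ 2 : ℝ) * w.2.2) := by push_cast; ring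
  rw [e, Complex.I_mul_re, Complex.add_im, Complex.im_ofReal_mul, Complex.im_ofReal_mul]
  congr 1
  ring

theorem sq_add_sq_ineq (a b : ℕ) : ((a : ℝ) + b) / 2 ≤ (a : ℝ) ^ 2 + (b : ℝ) ^ 2 - a * b := by
  have h : ((a : ℤ) + b) ≤ 2 * ((a : ℤ) ^ 2 + (b : ℤ) ^ 2 - a * b) := by
    have h1 : (a : ℤ) ≤ (a : ℤ) ^ 2 := by exact_mod_cast Nat.le_self_pow two_ne_zero a
    have h2 : (b : ℤ) ≤ (b : ℤ) ^ 2 := by exact_mod_cast Nat.le_self_pow two_ne_zero b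
    nlinarith [sq_nonneg ((a : ℤ) - b)]
  have h' : ((a : ℝ) + b) ≤ 2 * ((a : ℝ) ^ 2 + (b : ℝ) ^ 2 - a * b) := by exact_mod_cast h
  linarith

/-- As |y₁₂| ≤ y₁₁/2, the growth in the trigonometric factor costs at most 2k · πy₁₁/4, where 2k + 1
is four times the product of the two half-integers in absolute value. The diagonal Gaussian absorbs
this by `sq_add_sq_ineq`. -/
theorem norm_diagTerm_mul_le {w : ℂ × ℂ × ℂ} (h : SiegelReduced w) {x y : ℂ} (n : ℤ × ℤ) {k : ℕ}
    (hk : 2 * k + 1 = (2 * halfAbs n.1 + 1) * (2 * halfAbs n.2 + 1))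
    (hx : ‖x‖ ≤ (2 * k + 1) * Real.exp (2 * k * |(Real.pi * w.2.1 / 2 : ℂ).im|) * ‖y‖) :
    ‖diagTerm w n * x‖ ≤ ‖diagTerm w (0, 0) * y‖ * (oddWt n.1 * oddWt n.2) := by
  have hk' : (2 * k + 1 : ℝ) = (2 * halfAbs n.1 + 1) * (2 * halfAbs n.2 + 1) := by exact_mod_cast hk
  have him : |(Real.pi * w.2.1 / 2 : ℂ).im| ≤ Real.pi * (w.1.im / 4) := by
    have e : (Real.pi * w.2.1 / 2 : ℂ).im = Real.pi * (w.2.1.im / 2) := by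
      rw [show (Real.pi * w.2.1 / 2 : ℂ) = ((Real.pi / 2 : ℝ) : ℂ) * w.2.1 by push_cast; ring,
        Complex.im_ofReal_mul]
      ring
    rw [e, abs_mul, abs_of_pos Real.pi_pos, abs_div, abs_two]
    refine mul_le_mul_of_nonneg_left ?_ Real.pi_pos.le
    linarith [h.im_off]
  have h1 : Real.exp (2 * k * |(Real.pi * w.2.1 / 2 : ℂ).im|) ≤
      Real.exp (Real.pi * (2 * k * (w.1.im / 4))) := by
    refine Real.exp_le_exp.2 ?_
    have : (0 : ℝ) ≤ 2 * k := by positivity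
    nlinarith
  have h2 : ‖diagTerm w n‖ * Real.exp (Real.pi * (2 * k * (w.1.im / 4))) ≤
      ‖diagTerm w (0, 0)‖ * (4 / 15) ^ (2 * halfAbs n.1 + 2 * halfAbs n.2) := by
    rw [norm_diagTerm, norm_diagTerm, ← Real.exp_add]
    have e : -(Real.pi * (w.1.im * (halfAbs n.1 + 1 / 2) ^ 2 + w.2.2.im * (halfAbs n.2 + 1 / 2) ^ 2)) +
        Real.pi * (2 * k * (w.1.im / 4)) = -(Real.pi * (w.1.im * (halfAbs n.1 + 1 / 2) ^ 2 +
          w.2.2.im * (halfAbs n.2 + 1 / 2) ^ 2 - 2 * k * (w.1.im / 4))) := by ring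
    rw [e]
    refine exp_neg_pi_le_mul_pow h.im_ge _ ?_
    have z : halfAbs 0 = 0 := by simp [halfAbs]
    simp only [z]
    push_cast
    have hq := sq_add_sq_ineq (halfAbs n.1) (halfAbs n.2)
    have hb : (0 : ℝ) ≤ (halfAbs n.2 + 1 / 2 : ℝ) ^ 2 - 1 / 4 := by
      have : (0 : ℝ) ≤ halfAbs n.2 := Nat.cast_nonneg _
      nlinarith
    have hk2 : (2 * k : ℝ) = (2 * halfAbs n.1 + 1) * (2 * halfAbs n.2 + 1) - 1 := by linarith
    rw [hk2]
    nlinarith [mul_le_mul_of_nonneg_right h.im_le hb, mul_le_mul_of_nonneg_left hq h.im_pos.le]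
  rw [norm_mul, norm_mul]
  calc ‖diagTerm w n‖ * ‖x‖ ≤ ‖diagTerm w n‖ * ((2 * k + 1) *
        Real.exp (Real.pi * (2 * k * (w.1.im / 4))) * ‖y‖) := by
        refine mul_le_mul_of_nonneg_left (hx.trans ?_) (norm_nonneg _)
        exact mul_le_mul_of_nonneg_right (mul_le_mul_of_nonneg_left h1 (by positivity)) (norm_nonneg _)
    _ = (2 * k + 1) * ‖y‖ * (‖diagTerm w n‖ * Real.exp (Real.pi * (2 * k * (w.1.im / 4)))) := by ring
    _ ≤ (2 * k + 1) * ‖y‖ * (‖diagTerm w (0, 0)‖ * (4 / 15) ^ (2 * halfAbs n.1 + 2 * halfAbs n.2)) :=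
        mul_le_mul_of_nonneg_left h2 (by positivity)
    _ = _ := by rw [hk', oddWt, oddWt]; ring

/-- The product of two half-integers, in absolute value. -/
theorem four_mul_half (n : ℤ × ℤ) : ∃ k : ℕ, 2 * k + 1 = (2 * halfAbs n.1 + 1) * (2 * halfAbs n.2 + 1) ∧
    (4 * ((n.1 : ℂ) + 1 / 2) * ((n.2 : ℂ) + 1 / 2) = 2 * k + 1 ∨
      4 * ((n.1 : ℂ) + 1 / 2) * ((n.2 : ℂ) + 1 / 2) = -(2 * k + 1)) := by
  refine ⟨2 * halfAbs n.1 * halfAbs n.2 + halfAbs n.1 + halfAbs n.2, by ring, ?_⟩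
  have cast : ∀ m : ℤ, (m : ℂ) + 1 / 2 = halfAbs m + 1 / 2 ∨ (m : ℂ) + 1 / 2 = -(halfAbs m + 1 / 2) :=
    fun m => (halfAbs_spec m).imp
      (fun e => by have h := congrArg Complex.ofReal e; push_cast at h; exact h)
      (fun e => by have h := congrArg Complex.ofReal e; push_cast at h; exact h)
  rcases cast n.1 with e1 | e1 <;> rcases cast n.2 with e2 | e2 <;> rw [e1, e2]
  · left; push_cast; ring
  · right; push_cast; ring
  · right; push_cast; ring
  · left; push_cast; ring

/-- The reflection of half-integers in the first coordinate. -/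
def reflEquiv : ℤ × ℤ ≃ ℤ × ℤ := (Equiv.subLeft (-1)).prodCongr (Equiv.refl ℤ)

/-- Pairing n with its reflection changes the sign of the mixed term only, so the two exponentials
combine to a cosine for 1100 and a sine for 1111. -/
theorem two_mul_th_eq (k₁ k₂ : ℤ) {w : ℂ × ℂ × ℂ} (hw : w ∈ UHS) :
    2 * th 1 1 k₁ k₂ w = ∑' n : ℤ × ℤ, (thTerm 1 1 k₁ k₂ w n + thTerm 1 1 k₁ k₂ w (reflEquiv n)) := by
  have h := summable_thTerm 1 1 k₁ k₂ hw
  refine Eq.trans ?_ (h.tsum_add (reflEquiv.summable_iff.2 h)).symm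
  rw [Function.comp_def, reflEquiv.tsum_eq, ← th_eq]
  ring

theorem summable_refl (k₁ k₂ : ℤ) {w : ℂ × ℂ × ℂ} (hw : w ∈ UHS) :
    Summable fun n => thTerm 1 1 k₁ k₂ w n + thTerm 1 1 k₁ k₂ w (reflEquiv n) :=
  (summable_thTerm 1 1 k₁ k₂ hw).add (reflEquiv.summable_iff.2 (summable_thTerm 1 1 k₁ k₂ hw))

theorem th_1100_add_refl (w : ℂ × ℂ × ℂ) (n : ℤ × ℤ) :
    thTerm 1 1 0 0 w n + thTerm 1 1 0 0 w (reflEquiv n) =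
      diagTerm w n * (2 * Complex.cos (4 * ((n.1 : ℂ) + 1 / 2) * ((n.2 : ℂ) + 1 / 2) *
        (Real.pi * w.2.1 / 2))) := by
  rw [Complex.cos, mul_div_cancel₀ _ two_ne_zero, mul_add, diagTerm, ← Complex.exp_add,
    ← Complex.exp_add, thTerm, thTerm]
  simp only [reflEquiv, Equiv.prodCongr_apply, Prod.map, Equiv.subLeft_apply, Equiv.refl_apply]
  congr 2 <;> push_cast <;> ring

theorem th_1111_add_refl (w : ℂ × ℂ × ℂ) (n : ℤ × ℤ) :
    thTerm 1 1 1 1 w n + thTerm 1 1 1 1 w (reflEquiv n) =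
      diagTerm w n * (-(2 * Complex.I) * (-1) ^ (n.1 + n.2) *
        Complex.sin (4 * ((n.1 : ℂ) + 1 / 2) * ((n.2 : ℂ) + 1 / 2) * (Real.pi * w.2.1 / 2))) := by
  have e1 : thTerm 1 1 1 1 w n = diagTerm w n * (-(-1) ^ (n.1 + n.2) * Complex.exp
      (4 * ((n.1 : ℂ) + 1 / 2) * ((n.2 : ℂ) + 1 / 2) * (Real.pi * w.2.1 / 2) * Complex.I)) := by
    rw [← Complex.exp_pi_mul_I_int, neg_mul, ← neg_one_mul (Complex.exp _ * _), ← Complex.exp_pi_mul_I,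
      diagTerm, ← Complex.exp_add, ← Complex.exp_add, ← Complex.exp_add, thTerm]
    congr 1
    push_cast; ring
  have e2 : thTerm 1 1 1 1 w (reflEquiv n) = diagTerm w n * ((-1) ^ (n.1 + n.2) * Complex.exp
      (-(4 * ((n.1 : ℂ) + 1 / 2) * ((n.2 : ℂ) + 1 / 2) * (Real.pi * w.2.1 / 2)) * Complex.I)) := by
    rw [← Complex.exp_pi_mul_I_int, diagTerm, ← Complex.exp_add, ← Complex.exp_add, thTerm]
    simp only [reflEquiv, Equiv.prodCongr_apply, Prod.map, Equiv.subLeft_apply, Equiv.refl_apply]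
    refine Complex.exp_eq_exp_of_int (-n.1) ?_
    push_cast; ring
  rw [e1, e2, Complex.sin]
  linear_combination (diagTerm w n * (-1) ^ (n.1 + n.2) * (Complex.exp
    (-(4 * ((n.1 : ℂ) + 1 / 2) * ((n.2 : ℂ) + 1 / 2) * (Real.pi * w.2.1 / 2)) * Complex.I) - Complex.exp
    (4 * ((n.1 : ℂ) + 1 / 2) * ((n.2 : ℂ) + 1 / 2) * (Real.pi * w.2.1 / 2) * Complex.I))) * Complex.I_sq

/-- A zero would make τ₁₂ an odd integer, against |Re τ₁₂| ≤ 1/2. -/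
theorem cos_ne_zero_of_reduced {w : ℂ × ℂ × ℂ} (h : SiegelReduced w) :
    Complex.cos (Real.pi * w.2.1 / 2) ≠ 0 := by
  intro h0
  obtain ⟨k, hk⟩ := Complex.cos_eq_zero_iff.1 h0
  have hpi : (Real.pi : ℂ) ≠ 0 := by exact_mod_cast Real.pi_ne_zero
  have e : w.2.1 = ((2 * k + 1 : ℤ) : ℂ) := by
    apply mul_left_cancel₀ hpi
    push_cast
    linear_combination 2 * hk
  have hr := h.re_off
  rw [e, Complex.intCast_re] at hr
  have hr' : 2 * |2 * k + 1| ≤ 1 := by exact_mod_cast hr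
  have := abs_nonneg (2 * k + 1)
  have h1 : |2 * k + 1| = 0 := by omega
  rw [abs_eq_zero] at h1
  omega

theorem eq_zero_of_sin_eq_zero {w : ℂ × ℂ × ℂ} (h : SiegelReduced w)
    (h0 : Complex.sin (Real.pi * w.2.1 / 2) = 0) : w.2.1 = 0 := by
  obtain ⟨k, hk⟩ := Complex.sin_eq_zero_iff.1 h0
  have hpi : (Real.pi : ℂ) ≠ 0 := by exact_mod_cast Real.pi_ne_zero
  have e : w.2.1 = ((2 * k : ℤ) : ℂ) := by
    apply mul_left_cancel₀ hpi
    push_cast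
    linear_combination 2 * hk
  have hr := h.re_off
  rw [e, Complex.intCast_re] at hr
  have hr' : 2 * |2 * k| ≤ 1 := by exact_mod_cast hr
  have := abs_nonneg (2 * k)
  have h1 : |2 * k| = 0 := by omega
  rw [abs_eq_zero] at h1
  rw [e, h1, Int.cast_zero]

theorem diagTerm_ne_zero (w : ℂ × ℂ × ℂ) (n : ℤ × ℤ) : diagTerm w n ≠ 0 := Complex.exp_ne_zero _

theorem diagTerm_main (w : ℂ × ℂ × ℂ) : diagTerm w (-1, 0) = diagTerm w (0, 0) ∧
    diagTerm w (0, -1) = diagTerm w (0, 0) ∧ diagTerm w (-1, -1) = diagTerm w (0, 0) := by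
  refine ⟨?_, ?_, ?_⟩ <;> rw [diagTerm, diagTerm] <;> congr 1 <;> push_cast <;> ring

theorem th_1100_ne_zero {w : ℂ × ℂ × ℂ} (h : SiegelReduced w) : th 1 1 0 0 w ≠ 0 := by
  refine right_ne_zero_of_mul (a := (2 : ℂ)) ?_
  rw [two_mul_th_eq 0 0 h.mem]
  obtain ⟨d1, d2, d3⟩ := diagTerm_main w
  have hc := cos_ne_zero_of_reduced h
  set ζ : ℂ := Real.pi * w.2.1 / 2 with hζ
  refine tsum_ne_zero_odd (summable_refl 0 0 h.mem) (m := diagTerm w (0, 0) * (2 * Complex.cos ζ))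
    (mul_ne_zero (diagTerm_ne_zero _ _) (mul_ne_zero two_ne_zero hc)) ?_ ?_ ?_ ?_ fun n => ?_
  · rw [th_1100_add_refl, ← hζ]; congr 3; push_cast; ring
  · rw [th_1100_add_refl, d1, ← hζ, ← Complex.cos_neg]; congr 3; push_cast; ring
  · rw [th_1100_add_refl, d2, ← hζ, ← Complex.cos_neg]; congr 3; push_cast; ring
  · rw [th_1100_add_refl, d3, ← hζ]; congr 3; push_cast; ring
  · rw [th_1100_add_refl, ← hζ]
    obtain ⟨k, hk, hL⟩ := four_mul_half n
    refine norm_diagTerm_mul_le h n hk ?_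
    have hcos : ‖Complex.cos (4 * ((n.1 : ℂ) + 1 / 2) * ((n.2 : ℂ) + 1 / 2) * ζ)‖ =
        ‖Complex.cos ((2 * k + 1) * ζ)‖ := by
      rcases hL with e | e <;> rw [e]
      rw [neg_mul, Complex.cos_neg]
    rw [norm_mul, norm_mul, hcos, ← hζ]
    have := norm_cos_odd_mul_le ζ k
    have h2 : (0 : ℝ) ≤ ‖(2 : ℂ)‖ := norm_nonneg _
    nlinarith [mul_le_mul_of_nonneg_left this h2]

theorem th_1111_ne_zero {w : ℂ × ℂ × ℂ} (h : SiegelReduced w) (h0 : w.2.1 ≠ 0) : th 1 1 1 1 w ≠ 0 := by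
  refine right_ne_zero_of_mul (a := (2 : ℂ)) ?_
  rw [two_mul_th_eq 1 1 h.mem]
  obtain ⟨d1, d2, d3⟩ := diagTerm_main w
  have hc : Complex.sin (Real.pi * w.2.1 / 2) ≠ 0 := fun e => h0 (eq_zero_of_sin_eq_zero h e)
  set ζ : ℂ := Real.pi * w.2.1 / 2 with hζ
  have hI : (-(2 * Complex.I)) ≠ 0 := neg_ne_zero.2 (mul_ne_zero two_ne_zero Complex.I_ne_zero)
  refine tsum_ne_zero_odd (summable_refl 1 1 h.mem)
    (m := diagTerm w (0, 0) * (-(2 * Complex.I) * Complex.sin ζ))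
    (mul_ne_zero (diagTerm_ne_zero _ _) (mul_ne_zero hI hc)) ?_ ?_ ?_ ?_ fun n => ?_
  · rw [th_1111_add_refl, ← hζ,
      show 4 * (((0 : ℤ) : ℂ) + 1 / 2) * (((0 : ℤ) : ℂ) + 1 / 2) * ζ = ζ by push_cast; ring]
    norm_num
  -- The sign (-1)^(n₁+n₂) and the oddness of the sine compensate, so all four leading terms agree.
  · rw [th_1111_add_refl, d1, ← hζ,
      show 4 * (((-1 : ℤ) : ℂ) + 1 / 2) * (((0 : ℤ) : ℂ) + 1 / 2) * ζ = -ζ by push_cast; ring,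
      Complex.sin_neg]
    norm_num
  · rw [th_1111_add_refl, d2, ← hζ,
      show 4 * (((0 : ℤ) : ℂ) + 1 / 2) * (((-1 : ℤ) : ℂ) + 1 / 2) * ζ = -ζ by push_cast; ring,
      Complex.sin_neg]
    norm_num
  · rw [th_1111_add_refl, d3, ← hζ,
      show 4 * (((-1 : ℤ) : ℂ) + 1 / 2) * (((-1 : ℤ) : ℂ) + 1 / 2) * ζ = ζ by push_cast; ring]
    norm_num
  · rw [th_1111_add_refl, ← hζ]
    obtain ⟨k, hk, hL⟩ := four_mul_half n
    refine norm_diagTerm_mul_le h n hk ?_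
    have hsin : ‖Complex.sin (4 * ((n.1 : ℂ) + 1 / 2) * ((n.2 : ℂ) + 1 / 2) * ζ)‖ =
        ‖Complex.sin ((2 * k + 1) * ζ)‖ := by
      rcases hL with e | e <;> rw [e]
      rw [neg_mul, Complex.sin_neg, norm_neg]
    have h1 : ‖(-1 : ℂ) ^ (n.1 + n.2)‖ = 1 := by rw [norm_zpow, norm_neg, norm_one, _root_.one_zpow]
    rw [norm_mul, norm_mul, norm_mul, hsin, h1, mul_one, ← hζ]
    have := norm_sin_odd_mul_le ζ k
    nlinarith [mul_le_mul_of_nonneg_left this (norm_nonneg (-(2 * Complex.I)))]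

/-! ### Invariance of the Humbert surface -/

/-- The Humbert surface of invariant `Δ` in coordinates. -/
def IsHumbert (Δ : ℤ) (w : ℂ × ℂ × ℂ) : Prop :=
  ∃ a b c d e : ℤ,
    (∀ k : ℤ, k ∣ a → k ∣ b → k ∣ c → k ∣ d → k ∣ e → IsUnit k) ∧
    b ^ 2 - 4 * a * c - 4 * d * e = Δ ∧
    (a : ℂ) * w.1 + (b : ℂ) * w.2.1 + (c : ℂ) * w.2.2
      + (d : ℂ) * (w.2.1 ^ 2 - w.1 * w.2.2) + (e : ℂ) = 0

theorem symMat_mem_humbert {Δ : ℤ} {w : ℂ × ℂ × ℂ} (hw : w ∈ UHS) :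
    symMat w ∈ humbert Δ ↔ IsHumbert Δ w :=
  and_iff_right (symMat_mem_H2.2 hw)

/-- Substitution changes the five coefficients by an invertible integral linear map preserving b² -
4ac - 4de; the inverse map gives primitivity. -/
theorem IsHumbert.of_add_fst {Δ : ℤ} {x y z : ℂ} (r : ℤ) (h : IsHumbert Δ (x + r, y, z)) :
    IsHumbert Δ (x, y, z) := by
  obtain ⟨a, b, c, d, e, hp, hd, h⟩ := h
  refine ⟨a, b, c - r * d, d, e + r * a, ?_, by linear_combination hd, ?_⟩
  · rintro k ⟨a', ha⟩ hb ⟨c', hc⟩ ⟨d', hd⟩ ⟨e', he⟩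
    exact hp k ⟨a', ha⟩ hb ⟨c' + r * d', by linear_combination hc + r * hd⟩ ⟨d', hd⟩
      ⟨e' - r * a', by linear_combination he - r * ha⟩
  · push_cast
    linear_combination h

theorem IsHumbert.of_add_snd {Δ : ℤ} {x y z : ℂ} (r : ℤ) (h : IsHumbert Δ (x, y + r, z)) :
    IsHumbert Δ (x, y, z) := by
  obtain ⟨a, b, c, d, e, hp, hd, h⟩ := h
  refine ⟨a, b + 2 * r * d, c, d, e + r * b + r ^ 2 * d, ?_, by linear_combination hd, ?_⟩
  · rintro k ha ⟨b', hb⟩ hc ⟨d', hd⟩ ⟨e', he⟩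
    exact hp k ha ⟨b' - 2 * r * d', by linear_combination hb - 2 * r * hd⟩ hc ⟨d', hd⟩
      ⟨e' - r * b' + r ^ 2 * d', by linear_combination he - r * hb + r ^ 2 * hd⟩
  · push_cast
    linear_combination h

theorem IsHumbert.of_shear {Δ : ℤ} {x y z : ℂ} (r : ℤ)
    (h : IsHumbert Δ (x + 2 * r * y + r ^ 2 * z, y + r * z, z)) : IsHumbert Δ (x, y, z) := by
  obtain ⟨a, b, c, d, e, hp, hd, h⟩ := h
  refine ⟨a, b + 2 * r * a, c + r * b + r ^ 2 * a, d, e, ?_, by linear_combination hd, ?_⟩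
  · rintro k ⟨a', ha⟩ ⟨b', hb⟩ ⟨c', hc⟩ hd he
    exact hp k ⟨a', ha⟩ ⟨b' - 2 * r * a', by linear_combination hb - 2 * r * ha⟩
      ⟨c' - r * b' + r ^ 2 * a', by linear_combination hc - r * hb + r ^ 2 * ha⟩ hd he
  · push_cast
    linear_combination h

theorem IsHumbert.swap {Δ : ℤ} {x y z : ℂ} (h : IsHumbert Δ (x, y, z)) : IsHumbert Δ (z, y, x) := by
  obtain ⟨a, b, c, d, e, hp, hd, h⟩ := h
  exact ⟨c, b, a, d, e, fun k h₁ h₂ h₃ h₄ h₅ => hp k h₃ h₂ h₁ h₄ h₅, by linear_combination hd,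
    by linear_combination h⟩

theorem IsHumbert.neg {Δ : ℤ} {x y z : ℂ} (h : IsHumbert Δ (x, y, z)) : IsHumbert Δ (x, -y, z) := by
  obtain ⟨a, b, c, d, e, hp, hd, h⟩ := h
  refine ⟨a, -b, c, d, e, fun k h₁ h₂ h₃ h₄ h₅ => hp k h₁ ((dvd_neg).1 h₂) h₃ h₄ h₅,
    by linear_combination hd, ?_⟩
  push_cast
  linear_combination h

/-- Clearing the denominator x permutes the coefficients up to sign: a, e and c, d are interchanged.
-/
theorem isHumbert_inversion {Δ : ℤ} {x y z : ℂ} (hx : x ≠ 0) :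
    IsHumbert Δ (-1 / x, y / x, z - y ^ 2 / x) ↔ IsHumbert Δ (x, y, z) := by
  constructor
  · rintro ⟨a, b, c, d, e, hp, hd, h⟩
    refine ⟨e, b, d, -c, -a, fun k h₁ h₂ h₃ h₄ h₅ =>
      hp k ((dvd_neg).1 h₅) h₂ ((dvd_neg).1 h₄) h₃ h₁, by linear_combination hd, ?_⟩
    field_simp at h
    push_cast
    refine mul_left_cancel₀ hx ?_
    linear_combination h
  · rintro ⟨a, b, c, d, e, hp, hd, h⟩
    refine ⟨-e, b, -d, c, a, fun k h₁ h₂ h₃ h₄ h₅ =>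
      hp k h₅ h₂ h₄ ((dvd_neg).1 h₃) ((dvd_neg).1 h₁), by linear_combination hd, ?_⟩
    push_cast
    field_simp
    linear_combination x * h

/-- The stabilizer of the Humbert surface of invariant `Δ`. -/
def humbertStab (Δ : ℤ) : Subgroup SpZ where
  carrier := {M | ∀ τ ∈ H2, act M.1 τ ∈ humbert Δ ↔ τ ∈ humbert Δ}
  one_mem' τ _ := by rw [act_one]
  mul_mem' {M N} hM hN τ hτ := by rw [act_mul M N hτ, hM _ (act_mem_H2 N hτ), hN τ hτ]
  inv_mem' {M} hM τ hτ := by rw [← hM _ (act_mem_H2 M⁻¹ hτ), act_act_inv M hτ]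

theorem mem_humbertStab_of_coord {Δ : ℤ} {M : SpZ} (f : ℂ × ℂ × ℂ → ℂ × ℂ × ℂ)
    (hf : ∀ w ∈ UHS, act M.1 (symMat w) = symMat (f w))
    (h : ∀ w ∈ UHS, IsHumbert Δ (f w) ↔ IsHumbert Δ w) : M ∈ humbertStab Δ := by
  intro τ hτ
  obtain ⟨w, hw, rfl⟩ := exists_symMat hτ
  have h1 := act_mem_H2 M hτ
  rw [hf w hw] at h1 ⊢
  rw [symMat_mem_humbert hw, symMat_mem_humbert (symMat_mem_H2.1 h1), h w hw]

theorem humbertStab_eq_top (Δ : ℤ) (M : SpZ) : M ∈ humbertStab Δ := by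
  refine Sp_induction ?_ ?_ ?_ ?_ ?_ ?_ M
  · refine mem_humbertStab_of_coord _ (fun w hw => act_spTrans 1 0 0 hw) fun w _ => ?_
    simp only [Int.cast_zero, add_zero]
    refine ⟨fun h => h.of_add_fst 1, fun h => IsHumbert.of_add_fst (-1) ?_⟩
    convert h using 2
    push_cast; ring
  · refine mem_humbertStab_of_coord _ (fun w hw => act_spTrans 0 1 0 hw) fun w _ => ?_
    simp only [Int.cast_zero, add_zero]
    refine ⟨fun h => h.of_add_snd 1, fun h => IsHumbert.of_add_snd (-1) ?_⟩
    convert h using 3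
    push_cast; ring
  · refine mem_humbertStab_of_coord _ (fun w hw => act_spLevi_upper 1 hw) fun w _ => ?_
    refine ⟨fun h => h.of_shear 1, fun h => IsHumbert.of_shear (-1) ?_⟩
    convert h using 2
    · push_cast; ring
    · congr 1
      push_cast; ring
  · exact mem_humbertStab_of_coord _ (fun w hw => act_spSwap hw) fun w _ =>
      ⟨IsHumbert.swap, IsHumbert.swap⟩
  · refine mem_humbertStab_of_coord _ (fun w hw => act_spSign hw) fun w _ =>
      ⟨fun h => ?_, IsHumbert.neg⟩
    simpa using h.neg
  · refine mem_humbertStab_of_coord _ (fun w hw => act_spFst_S hw) fun w hw =>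
      isHumbert_inversion ?_
    rintro h0
    have := hw.1
    rw [h0] at this
    exact lt_irrefl _ this

/-! ### The zeros of `χ₅` -/

theorem chi5_ne_zero_of_reduced {w : ℂ × ℂ × ℂ} (h : SiegelReduced w) (h0 : w.2.1 ≠ 0) :
    chi5 (symMat w) ≠ 0 := by
  rw [chi5_symMat]
  simp only [ne_eq, mul_eq_zero, not_or]
  exact ⟨⟨⟨⟨⟨⟨⟨⟨⟨th_00_ne_zero h 0 0, th_00_ne_zero h 0 1⟩, th_00_ne_zero h 1 0⟩,
    th_00_ne_zero h 1 1⟩, th_01_ne_zero h 0⟩, th_01_ne_zero h 1⟩, th_10_ne_zero h 0⟩,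
    th_10_ne_zero h 1⟩, th_1100_ne_zero h⟩, th_1111_ne_zero h h0⟩

/-- `χ₅` vanishes only on the Humbert surface of invariant `1`. -/
theorem chi5_ne_zero {τ : Matrix (Fin 2) (Fin 2) ℂ} (hτ : τ ∈ H2) (h : τ ∉ humbert 1) :
    chi5 τ ≠ 0 := by
  obtain ⟨w, hw, rfl⟩ := exists_symMat hτ
  obtain ⟨M, w', e, hr⟩ := exists_isReduced hw
  obtain ⟨ε, -, hε⟩ := exists_chi5_act M
  have h1 : symMat w' ∉ humbert 1 := by
    rw [← e, humbertStab_eq_top 1 M _ hτ]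
    exact h
  -- The equation τ₁₂ = 0 is the Humbert equation with coefficients (0, 1, 0, 0, 0) of invariant 1.
  have h2 : w'.2.1 ≠ 0 := fun h0 => h1 <| (symMat_mem_humbert hr.mem).2
    ⟨0, 1, 0, 0, 0, fun k _ h _ _ _ => isUnit_of_dvd_one h, by norm_num, by simp [h0]⟩
  have h3 := chi5_ne_zero_of_reduced hr h2
  rw [← e, hε _ hτ] at h3
  exact right_ne_zero_of_mul h3

/-! ### Assembly of the proposition -/

theorem mainTheorem11 :
    -- the three wedge products are cusp forms of weight 15 on the level 2 group
    (IsCuspForm 15 (wedge (Gf 1 2) (Gf 3 4) (Gf 5 6)) ∧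
      IsCuspForm 15 (wedge (Gf 1 2) (Gf 1 3) (Gf 4 5)) ∧
      IsCuspForm 15 (wedge (Gf 1 2) (Gf 1 3) (Gf 1 4))) ∧
    -- first identity, in both forms
    (∀ τ ∈ H2,
      wedge (Gf 1 2) (Gf 3 4) (Gf 5 6) τ =
        (Real.pi : ℂ) ^ 6 * chi5 τ * vt 1 τ ^ 4 * vt 2 τ ^ 4 * vt 3 τ ^ 4 * vt 4 τ ^ 4 *
          (vt 5 τ ^ 4 - vt 6 τ ^ 4) ∧
      wedge (Gf 1 2) (Gf 3 4) (Gf 5 6) τ =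
        -(Real.pi : ℂ) ^ 6 * chi7 τ * xf 1 τ * xf 2 τ * xf 3 τ * xf 4 τ) ∧
    -- second identity: as a quotient off the zeros of the denominator, and everywhere after
    -- cancelling the denominator
    (∀ τ ∈ H2,
      (vt 2 τ ^ 2 * vt 7 τ ^ 2 * vt 9 τ ^ 2 ≠ 0 →
        wedge (Gf 1 2) (Gf 1 3) (Gf 4 5) τ =
          (Real.pi : ℂ) ^ 6 * ((chi5 τ ^ 3 * vt 1 τ ^ 2 * vt 4 τ ^ 2 * vt 6 τ ^ 2) /
            (vt 2 τ ^ 2 * vt 7 τ ^ 2 * vt 9 τ ^ 2))) ∧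
      wedge (Gf 1 2) (Gf 1 3) (Gf 4 5) τ =
        (Real.pi : ℂ) ^ 6 * chi5 τ * (vt 1 τ ^ 4 * vt 4 τ ^ 4 * vt 6 τ ^ 4) *
          (vt 3 τ ^ 2 * vt 5 τ ^ 2 * vt 8 τ ^ 2 * vt 10 τ ^ 2)) ∧
    -- third identity
    (∀ τ ∈ H2, wedge (Gf 1 2) (Gf 1 3) (Gf 1 4) τ = 0) ∧
    -- the zeros of the first form lie on the Humbert surface of invariant 1
    (∀ τ ∈ H2, τ ∉ humbert 1 → Gf 1 2 τ ≠ 0) := by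
  refine ⟨⟨isCuspForm_wedge_12_34_56, isCuspForm_wedge_12_13_45, isCuspForm_wedge_12_13_14⟩,
    fun τ hτ => ?_, fun τ hτ => ?_, fun τ _ => wedge_12_13_14 τ, fun τ hτ h => ?_⟩
  · obtain ⟨w, hw, rfl⟩ := exists_symMat hτ
    simp only [chi7, xf, vt_symMat]
    rw [wedge_12_34_56 hw]
    constructor <;> ring
  · obtain ⟨w, hw, rfl⟩ := exists_symMat hτ
    simp only [vt_symMat]
    rw [wedge_12_13_45 hw]
    refine ⟨fun h0 => ?_, by ring⟩
    -- Two of the three factors χ₅ contain the square of every theta constant, so the denominator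
    -- cancels.
    rw [← mul_div_assoc, eq_div_iff h0, chi5_symMat]
    ring
  · have h5 := chi5_ne_zero hτ h
    obtain ⟨w, hw, rfl⟩ := exists_symMat hτ
    exact Gf_1_2_ne_zero hw h5
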